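/- Let $K$ be a (not necessarily commutative) ring, let $S$ be a $K$-ring (a ring with a ring homomorphism $K\to S$), let $V$ be a $K$-bimodule and $n\ge 2$. Let $t:S\otimes_K V\to V\otimes_K S$ be a map of $K$-bimodules with $t(1\otimes v)=v\otimes 1$ and $t\circ(m_S\otimes V)=(V\otimes m_S)\circ(t\otimes S)\circ(S\otimes t)$, where $m_S$ is the multiplication of $S$. Put $T=T_K(V)=\bigoplus_m T^m$, $T^m=V^{\otimes_K m}$, and let $t^*:S\otimes_K T\to T\otimes_K S$ be the twisting map of rings which lifts $t$. Let $R\subseteq T^n$ be a $K$-subbimodule which is $t^*$-invariant, i.e. $t^*$ maps the image of $S\otimes_K R$ into the image of $R\otimes_K S$. Put $A=T/\langle R\rangle$, graded by $A^m=$ the image of $T^m$; then $t^*$ induces a twisting map $S\otimes_K A\to A\otimes_K S$, and $\bar A=A\otimes_t S$ denotes the corresponding twisted tensor product, that is, the group $A\otimes_K S$ with the product $(a\otimes s)(a'\otimes s')=a\,t(s\otimes a')\,s'$. Let $\bar V=V\otimes_K S$, an $S$-bimodule with the right regular action and the left action $s\cdot(v\otimes s')=t(s\otimes v)s'$. Let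 $\bar T=T_S(\bar V)=\bigoplus_m\bar T^m$, $\bar T^{\le m}=\bigoplus_{i\le m}\bar T^i$, and let $p^m:\bar T\to\bar T^m$ be the projections. Let $\psi:T\otimes_K S\to\bar T$ be the map $\psi(x\otimes s)=j(x)s$, where $j:T\to\bar T$ is the ring homomorphism which extends $K\to S$ with $j(v)=v\otimes 1$ for $v\in V$, and let $\bar R\subseteq\bar T^n$ be the $S$-subbimodule which is the image of $R\otimes_K S$ under $\psi$. Assume that $S$ is flat as a left $K$-module, that $V$ and $R$ are projective as right $K$-modules, and that $\operatorname{Tor}^A_3(K,K)$, where $K$ stands for the $A$-module $A/A^+=A^0$, is $(n+1)$-pure, i.e. concentrated in internal degree $n+1$. Let $\bar P\subseteq\bar T^{\le n}$ be an $S$-subbimodule with $p^n(\bar P)=\bar R$. Then the assignment $(x+\langle R\rangle)\otimes s\mapsto \psi(x\otimes s)+\langle\bar R\rangle$ defines an isomorphism of rings $\bar A\cong\bar T/\langle\bar R\rangle$, and the following are equivalent. (a) $\bar U=\bar T/\langle\bar P\rangle$ is a PBW-deformation of $\bar A\cong\bar T/\langle \bar R\rangle$: for the filtration of $\bar U$ by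 the images $\bar U^{\le m}$ of $\bar T^{\le m}$ (with $\bar U^{\le -1}=0$), the natural graded map $\bar T/\langle\bar R\rangle\to\operatorname{gr}\bar U$, given in degree $m$ by $x+\langle\bar R\rangle\mapsto (x+\langle\bar P\rangle)+\bar U^{\le m-1}$ for $x\in\bar T^m$, is a well-defined isomorphism. (b) There is a map of $S$-bimodules $\alpha:\bar R\to\bar T$ with image $\bar P$ which is filtered, $\alpha(\bar R)\subseteq\bar T^{\le n}$, with $p^n\circ\alpha$ equal to the inclusion $\bar R\subseteq \bar T^n$, and which satisfies the following Jacobi conditions. Put $\alpha_i=p^{n-i}\circ\alpha$ for $0\le i\le n$. Let $\bar X=(\bar V\otimes\bar R)\cap(\bar R\otimes\bar V)$, understood as the set of pairs of elements of $\bar V\otimes_S\bar R$ and $\bar R\otimes_S\bar V$ with the same image in $\bar T$. For $(y,z)\in\bar X$ let $\vartheta_i(y,z)\in\bar T$ be the image of $y$ under $w\otimes r\mapsto w\,\alpha_i(r)$ minus the image of $z$ under $r\otimes w\mapsto \alpha_i(r)\,w$ (so that $\vartheta_i=\bar V\otimes\alpha_i-\alpha_i\otimes\bar V$). Then for all $(y,z)\in\bar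 X$: - $(J'_0)$ $\vartheta_1(y,z)\in\bar R$; - $(J'_i)$ $\alpha_i(\vartheta_1(y,z))=\vartheta_{i+1}(y,z)$ for $0<i<n$; - $(J'_n)$ $\alpha_n(\vartheta_1(y,z))=0$. -/

import Mathlib

open MulOpposite TensorProduct

universe u v w x

namespace NCPBW

/-! ### Bimodules and tensor products over a noncommutative ring

A left action is written `k • m`; a right action is an action of the opposite ring,
`op k • m = m k`. -/

/-- A `K`-ring: a ring `B` together with a ring homomorphism `K → B`. -/
class RingOver (K : Type*) (B : Type*) [Ring K] [Ring B] where
  /-- the structure homomorphism -/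
  hom : K →+* B

section RingOver

variable {K : Type*} {B : Type*} [Ring K] [Ring B] [RingOver K B]

instance (priority := 50) RingOver.leftModule : Module K B :=
  Module.compHom B (RingOver.hom : K →+* B)

instance (priority := 50) RingOver.rightModule : Module Kᵐᵒᵖ B :=
  Module.compHom B (RingHom.op (RingOver.hom : K →+* B))

theorem RingOver.smul_eq (k : K) (b : B) : k • b = (RingOver.hom k : B) * b := rfl

theorem RingOver.op_smul_eq (k : K) (b : B) : op k • b = b * (RingOver.hom k : B) := rfl

instance (priority := 50) RingOver.smulComm : SMulCommClass K Kᵐᵒᵖ B where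
  smul_comm k l b := by
    induction l with
    | _ l => simp only [RingOver.smul_eq, RingOver.op_smul_eq, mul_assoc]

end RingOver

section BTensor

variable (K : Type*) [Ring K] (M : Type*) (N : Type*)
  [AddCommGroup M] [Module Kᵐᵒᵖ M] [AddCommGroup N] [Module K N]

/-- The relations `mk ⊗ n = m ⊗ kn`. -/
def BTensor.rel : AddSubgroup (M ⊗[ℤ] N) :=
  AddSubgroup.closure {z | ∃ (m : M) (k : K) (n : N), z = (op k • m) ⊗ₜ n - m ⊗ₜ (k • n)}

/-- The tensor product `M ⊗_K N` of a right `K`-module and a left `K`-module. -/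
def BTensor : Type _ := (M ⊗[ℤ] N) ⧸ BTensor.rel K M N

instance : AddCommGroup (BTensor K M N) :=
  inferInstanceAs (AddCommGroup ((M ⊗[ℤ] N) ⧸ BTensor.rel K M N))

/-- The projection `M ⊗_ℤ N → M ⊗_K N`. -/
def BTensor.mkHom : M ⊗[ℤ] N →+ BTensor K M N := QuotientAddGroup.mk' (BTensor.rel K M N)

variable {M N}

/-- The pure tensor `m ⊗ n`. -/
def BTensor.tmul (m : M) (n : N) : BTensor K M N := BTensor.mkHom K M N (m ⊗ₜ[ℤ] n)

variable {K}

theorem BTensor.tmul_add (m : M) (n n' : N) :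
    tmul K m (n + n') = tmul K m n + tmul K m n' := by
  simp [tmul, TensorProduct.tmul_add]

theorem BTensor.add_tmul (m m' : M) (n : N) :
    tmul K (m + m') n = tmul K m n + tmul K m' n := by
  simp [tmul, TensorProduct.add_tmul]

theorem BTensor.tmul_zero (m : M) : tmul K m (0 : N) = 0 := by
  simp [tmul, TensorProduct.tmul_zero]

theorem BTensor.zero_tmul (n : N) : tmul K (0 : M) n = 0 := by
  simp [tmul, TensorProduct.zero_tmul]

theorem BTensor.smul_tmul (m : M) (k : K) (n : N) :
    tmul K (op k • m) n = tmul K m (k • n) := by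
  rw [← sub_eq_zero, tmul, tmul, ← map_sub]
  exact (QuotientAddGroup.eq_zero_iff _).2 (AddSubgroup.subset_closure ⟨m, k, n, rfl⟩)

@[elab_as_elim]
theorem BTensor.induction {p : BTensor K M N → Prop} (z : BTensor K M N)
    (h0 : p 0) (ht : ∀ m n, p (tmul K m n)) (ha : ∀ a b, p a → p b → p (a + b)) : p z := by
  obtain ⟨z, rfl⟩ : ∃ y, BTensor.mkHom K M N y = z :=
    QuotientAddGroup.mk'_surjective (BTensor.rel K M N) z
  induction z with
  | zero => simpa using h0
  | tmul m n => exact ht m n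
  | add a b h1 h2 => rw [map_add]; exact ha _ _ h1 h2

variable {P : Type*} [AddCommGroup P]

theorem BTensor.hom_ext {f g : BTensor K M N →+ P}
    (h : ∀ m n, f (tmul K m n) = g (tmul K m n)) : f = g := by
  ext z
  induction z using BTensor.induction with
  | h0 => simp
  | ht m n => exact h m n
  | ha a b h1 h2 => simp [h1, h2]

/-- The additive map on `M ⊗_K N` given by a biadditive balanced map. -/
def BTensor.lift (f : M →+ N →+ P) (hf : ∀ m (k : K) n, f (op k • m) n = f m (k • n)) :
    BTensor K M N →+ P :=
  QuotientAddGroup.lift (BTensor.rel K M N)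
    (TensorProduct.liftAddHom (R := ℤ) f (fun r m n => by simp))
    (by
      rw [BTensor.rel, AddSubgroup.closure_le]
      rintro _ ⟨m, k, n, rfl⟩
      simp [hf])

@[simp]
theorem BTensor.lift_tmul (f : M →+ N →+ P)
    (hf : ∀ m (k : K) n, f (op k • m) n = f m (k • n)) (m : M) (n : N) :
    BTensor.lift f hf (tmul K m n) = f m n := rfl

variable {M' N' : Type*} [AddCommGroup M'] [Module Kᵐᵒᵖ M'] [AddCommGroup N'] [Module K N']

/-- The pure tensor as a biadditive map. -/
def BTensor.tmulHom : M →+ N →+ BTensor K M N :=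
  AddMonoidHom.mk' (fun m => AddMonoidHom.mk' (fun n => tmul K m n) (tmul_add m))
    (fun m m' => by ext n; exact add_tmul m m' n)

@[simp]
theorem BTensor.tmulHom_apply (m : M) (n : N) :
    BTensor.tmulHom (K := K) m n = tmul K m n := rfl

/-- The map `f ⊗ g`. -/
def BTensor.map (f : M →+ M') (g : N →+ N')
    (hf : ∀ (k : K) m, f (op k • m) = op k • f m) (hg : ∀ (k : K) n, g (k • n) = k • g n) :
    BTensor K M N →+ BTensor K M' N' :=
  BTensor.lift (((AddMonoidHom.compHom' g).comp BTensor.tmulHom).comp f)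
    (fun m k n => by simp [hf, hg, BTensor.smul_tmul])

@[simp]
theorem BTensor.map_tmul (f : M →+ M') (g : N →+ N')
    (hf : ∀ (k : K) m, f (op k • m) = op k • f m) (hg : ∀ (k : K) n, g (k • n) = k • g n)
    (m : M) (n : N) : BTensor.map f g hf hg (tmul K m n) = tmul K (f m) (g n) := rfl

end BTensor

/-- Flatness of a left module: `(-) ⊗_K N` preserves injective maps of right `K`-modules. -/
def IsLeftFlat (K : Type u) (N : Type v) [Ring K] [AddCommGroup N] [Module K N] : Prop :=
  ∀ (M M' : Type (max u w)) [AddCommGroup M] [AddCommGroup M'] [Module Kᵐᵒᵖ M]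
    [Module Kᵐᵒᵖ M'] (f : M →ₗ[Kᵐᵒᵖ] M'), Function.Injective f →
    Function.Injective (BTensor.map (K := K) (N := N) f.toAddMonoidHom (AddMonoidHom.id N)
      (fun k m => f.map_smul (op k) m) (fun _ _ => rfl))

section Bimodules

variable (K : Type*) [Ring K] (M : Type*) [AddCommGroup M] [Module K M] [Module Kᵐᵒᵖ M]

/-- A `K`-subbimodule. -/
structure SubBimodule extends AddSubgroup M where
  left_mem' : ∀ (k : K) {m : M}, m ∈ carrier → k • m ∈ carrier
  right_mem' : ∀ (k : K) {m : M}, m ∈ carrier → op k • m ∈ carrier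

variable {K M}

instance : SetLike (SubBimodule K M) M where
  coe R := R.carrier
  coe_injective R R' h := by
    cases R; cases R'; congr
    exact SetLike.coe_injective h

instance : AddSubgroupClass (SubBimodule K M) M where
  add_mem := fun {R} => R.add_mem'
  zero_mem := fun R => R.zero_mem'
  neg_mem := fun {R} => R.neg_mem'

theorem SubBimodule.left_mem (R : SubBimodule K M) (k : K) {m : M} (h : m ∈ R) : k • m ∈ R :=
  R.left_mem' k h

theorem SubBimodule.right_mem (R : SubBimodule K M) (k : K) {m : M} (h : m ∈ R) :
    op k • m ∈ R :=
  R.right_mem' k h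

instance (R : SubBimodule K M) : Module K R where
  smul k m := ⟨k • (m : M), R.left_mem k m.2⟩
  one_smul m := Subtype.ext (one_smul K (m : M))
  mul_smul k l m := Subtype.ext (mul_smul k l (m : M))
  smul_zero k := Subtype.ext (smul_zero k)
  smul_add k m m' := Subtype.ext (smul_add k (m : M) m')
  add_smul k l m := Subtype.ext (add_smul k l (m : M))
  zero_smul m := Subtype.ext (zero_smul K (m : M))

instance (R : SubBimodule K M) : Module Kᵐᵒᵖ R where
  smul k m := ⟨k • (m : M), R.right_mem k.unop m.2⟩
  one_smul m := Subtype.ext (one_smul Kᵐᵒᵖ (m : M))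
  mul_smul k l m := Subtype.ext (mul_smul k l (m : M))
  smul_zero k := Subtype.ext (smul_zero k)
  smul_add k m m' := Subtype.ext (smul_add k (m : M) m')
  add_smul k l m := Subtype.ext (add_smul k l (m : M))
  zero_smul m := Subtype.ext (zero_smul Kᵐᵒᵖ (m : M))

variable (K) in
/-- A morphism of `K`-bimodules. -/
structure BimoduleHom (M N : Type*) [AddCommGroup M] [Module K M] [Module Kᵐᵒᵖ M]
    [AddCommGroup N] [Module K N] [Module Kᵐᵒᵖ N] extends M →+ N where
  map_smul' : ∀ (k : K) m, toFun (k • m) = k • toFun m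
  map_op_smul' : ∀ (k : K) m, toFun (op k • m) = op k • toFun m

variable {N : Type*} [AddCommGroup N] [Module K N] [Module Kᵐᵒᵖ N]

instance : FunLike (BimoduleHom K M N) M N where
  coe f := f.toFun
  coe_injective f g h := by
    cases f; cases g; congr
    exact DFunLike.coe_injective h

instance : AddMonoidHomClass (BimoduleHom K M N) M N where
  map_add f := f.map_add'
  map_zero f := f.map_zero'

theorem BimoduleHom.map_smul (f : BimoduleHom K M N) (k : K) (m : M) :
    f (k • m) = k • f m := f.map_smul' k m

theorem BimoduleHom.map_op_smul (f : BimoduleHom K M N) (k : K) (m : M) :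
    f (op k • m) = op k • f m := f.map_op_smul' k m

/-- The inclusion of a subbimodule. -/
def SubBimodule.incl (R : SubBimodule K M) : BimoduleHom K R M where
  toFun r := r
  map_zero' := rfl
  map_add' _ _ := rfl
  map_smul' _ _ := rfl
  map_op_smul' _ _ := rfl

end Bimodules

/-! ### The tensor ring of a bimodule -/

section TensorRing

variable (K : Type u) [Ring K] (V : Type v) [AddCommGroup V] [Module K V] [Module Kᵐᵒᵖ V]

/-- The relations of the tensor ring. -/
inductive TensorRing.Rel : FreeAlgebra ℤ (K ⊕ V) → FreeAlgebra ℤ (K ⊕ V) → Prop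
  | one : Rel (FreeAlgebra.ι ℤ (Sum.inl 1)) 1
  | add (k l : K) : Rel (FreeAlgebra.ι ℤ (Sum.inl (k + l)))
      (FreeAlgebra.ι ℤ (Sum.inl k) + FreeAlgebra.ι ℤ (Sum.inl l))
  | mul (k l : K) : Rel (FreeAlgebra.ι ℤ (Sum.inl (k * l)))
      (FreeAlgebra.ι ℤ (Sum.inl k) * FreeAlgebra.ι ℤ (Sum.inl l))
  | vadd (v v' : V) : Rel (FreeAlgebra.ι ℤ (Sum.inr (v + v')))
      (FreeAlgebra.ι ℤ (Sum.inr v) + FreeAlgebra.ι ℤ (Sum.inr v'))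
  | left (k : K) (v : V) : Rel (FreeAlgebra.ι ℤ (Sum.inr (k • v)))
      (FreeAlgebra.ι ℤ (Sum.inl k) * FreeAlgebra.ι ℤ (Sum.inr v))
  | right (k : K) (v : V) : Rel (FreeAlgebra.ι ℤ (Sum.inr (op k • v)))
      (FreeAlgebra.ι ℤ (Sum.inr v) * FreeAlgebra.ι ℤ (Sum.inl k))

/-- The tensor ring `T_K(V) = K ⊕ V ⊕ (V ⊗_K V) ⊕ ⋯` of a `K`-bimodule `V`, constructed as the
universal ring with a ring homomorphism from `K` and a `K`-bimodule map from `V`. -/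
def TensorRing : Type (max u v) := RingQuot (TensorRing.Rel K V)

instance : Ring (TensorRing K V) := inferInstanceAs (Ring (RingQuot (TensorRing.Rel K V)))

namespace TensorRing

/-- The structure homomorphism `K → T_K(V)`. -/
def ofBase : K →+* TensorRing K V where
  toFun k := RingQuot.mkRingHom (Rel K V) (FreeAlgebra.ι ℤ (Sum.inl k))
  map_one' := (RingQuot.mkRingHom_rel Rel.one).trans (map_one _)
  map_mul' k l := (RingQuot.mkRingHom_rel (Rel.mul k l)).trans (map_mul _ _ _)
  map_add' k l := (RingQuot.mkRingHom_rel (Rel.add k l)).trans (map_add _ _ _)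
  map_zero' := by
    have h := (RingQuot.mkRingHom_rel (Rel.add (V := V) (0 : K) 0)).trans (map_add _ _ _)
    rw [add_zero] at h
    exact left_eq_add.1 h

instance : RingOver K (TensorRing K V) := ⟨ofBase K V⟩

variable {V}

/-- The inclusion `V → T_K(V)`. -/
def ι : V →+ TensorRing K V :=
  AddMonoidHom.mk' (fun v => RingQuot.mkRingHom (Rel K V) (FreeAlgebra.ι ℤ (Sum.inr v)))
    (fun v v' => (RingQuot.mkRingHom_rel (Rel.vadd v v')).trans (map_add _ _ _))

theorem ι_smul (k : K) (v : V) : ι K (k • v) = ofBase K V k * ι K v :=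
  (RingQuot.mkRingHom_rel (Rel.left k v)).trans (map_mul _ _ _)

theorem ι_op_smul (k : K) (v : V) : ι K (op k • v) = ι K v * ofBase K V k :=
  (RingQuot.mkRingHom_rel (Rel.right k v)).trans (map_mul _ _ _)

variable {K}

@[elab_as_elim]
theorem induction {p : TensorRing K V → Prop} (t : TensorRing K V)
    (hK : ∀ k, p (ofBase K V k)) (hV : ∀ v, p (ι K v))
    (hmul : ∀ a b, p a → p b → p (a * b)) (hadd : ∀ a b, p a → p b → p (a + b)) : p t := by
  obtain ⟨z, rfl⟩ := RingQuot.mkRingHom_surjective (Rel K V) t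
  induction z using FreeAlgebra.induction with
  | grade0 r =>
    have h : RingQuot.mkRingHom (Rel K V) (algebraMap ℤ _ r) = ofBase K V (r : K) := by
      simp
      rfl
    rw [h]; exact hK _
  | grade1 y =>
    rcases y with k | v
    · exact hK k
    · exact hV v
  | mul a b h1 h2 => rw [map_mul]; exact hmul _ _ h1 h2
  | add a b h1 h2 => rw [map_add]; exact hadd _ _ h1 h2

section lift

variable {B : Type*} [Ring B] (f : K →+* B) (g : V →+ B)
  (hl : ∀ k v, g (k • v) = f k * g v) (hr : ∀ k v, g (op k • v) = g v * f k)

/-- The universal property of the tensor ring. -/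
def lift : TensorRing K V →+* B :=
  RingQuot.lift ⟨(FreeAlgebra.lift ℤ (Sum.elim f g) : FreeAlgebra ℤ (K ⊕ V) →ₐ[ℤ] B).toRingHom, by
    intro a b h
    cases h <;> simp [hl, hr]⟩

@[simp]
theorem lift_ofBase (k : K) : lift f g hl hr (ofBase K V k) = f k := by
  have := RingQuot.lift_mkRingHom_apply
    (FreeAlgebra.lift ℤ (Sum.elim f g) : FreeAlgebra ℤ (K ⊕ V) →ₐ[ℤ] B).toRingHom
    (r := Rel K V) (by intro a b h; cases h <;> simp [hl, hr]) (FreeAlgebra.ι ℤ (Sum.inl k))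
  exact this.trans (by simp)

@[simp]
theorem lift_ι (v : V) : lift f g hl hr (ι K v) = g v := by
  have := RingQuot.lift_mkRingHom_apply
    (FreeAlgebra.lift ℤ (Sum.elim f g) : FreeAlgebra ℤ (K ⊕ V) →ₐ[ℤ] B).toRingHom
    (r := Rel K V) (by intro a b h; cases h <;> simp [hl, hr]) (FreeAlgebra.ι ℤ (Sum.inr v))
  exact this.trans (by simp)

end lift

variable (K V)

/-- The homogeneous component `T^m = V^{⊗ m}` of the tensor ring. -/
def gr : ℕ → AddSubgroup (TensorRing K V)
  | 0 => (ofBase K V).toAddMonoidHom.range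
  | m + 1 => AddSubgroup.closure {z | ∃ (v : V), ∃ y ∈ gr m, z = ι K v * y}

/-- The standard filtration `T^{≤ m} = ⊕_{i ≤ m} T^i`. -/
def filt (m : ℕ) : AddSubgroup (TensorRing K V) := ⨆ (i : ℕ) (_ : i ≤ m), gr K V i

theorem gr_le_filt (m : ℕ) : gr K V m ≤ filt K V m :=
  le_iSup₂_of_le m le_rfl le_rfl

/-- The ring homomorphism `T → T[X]` which multiplies the elements of degree `m` by `X ^ m`. -/
noncomputable def homog : TensorRing K V →+* Polynomial (TensorRing K V) :=
  lift (Polynomial.C.comp (ofBase K V))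
    (AddMonoidHom.mk' (fun v => Polynomial.C (ι K v) * Polynomial.X)
      (fun v v' => by simp [add_mul]))
    (fun k v => by simp [ι_smul, mul_assoc])
    (fun k v => by
      simp only [AddMonoidHom.mk'_apply, ι_op_smul, map_mul, RingHom.comp_apply, mul_assoc]
      rw [Polynomial.X_mul_C])

/-- The projection `p^m : T → T^m`. -/
noncomputable def proj (m : ℕ) : BimoduleHom K (TensorRing K V) (TensorRing K V) where
  toFun t := (homog K V t).coeff m
  map_zero' := by simp
  map_add' := by simp
  map_smul' k t := by
    simp only [RingOver.smul_eq, map_mul]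
    have : homog K V (RingOver.hom k) = Polynomial.C (RingOver.hom k) :=
      lift_ofBase _ _ _ _ k
    simp [this]
  map_op_smul' k t := by
    simp only [RingOver.op_smul_eq, map_mul]
    have : homog K V (RingOver.hom k) = Polynomial.C (RingOver.hom k) :=
      lift_ofBase _ _ _ _ k
    simp [this]

end TensorRing

end TensorRing

/-! ### Quotient rings and PBW-deformations -/

section Quotients

/-- The quotient `B / ⟨X⟩` of a ring by the two-sided ideal generated by `X`. -/
abbrev QuotRing {B : Type*} [Ring B] (X : Set B) : Type _ :=
  (TwoSidedIdeal.span X).ringCon.Quotient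

namespace QuotRing

variable {B : Type*} [Ring B] (X : Set B)

/-- The projection `B → B / ⟨X⟩`. -/
def mk : B →+* QuotRing X := (TwoSidedIdeal.span X).ringCon.mk'

theorem mk_surjective : Function.Surjective (mk X) := RingCon.mk'_surjective _

variable {X} in
/-- A ring homomorphism vanishing on `X` factors through `B / ⟨X⟩`. -/
def lift {C : Type*} [Ring C] (f : B →+* C) (hf : ∀ b ∈ X, f b = 0) : QuotRing X →+* C :=
  RingCon.lift _ f (by
    have h : TwoSidedIdeal.span X ≤ TwoSidedIdeal.ker f :=
      TwoSidedIdeal.span_le.2 fun b hb => (TwoSidedIdeal.mem_ker f).2 (hf b hb)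
    intro a b hab
    have h' := h ((TwoSidedIdeal.rel_iff _ a b).1 hab)
    rw [TwoSidedIdeal.mem_ker, map_sub, sub_eq_zero] at h'
    exact h')

@[simp]
theorem lift_mk {C : Type*} [Ring C] (f : B →+* C) (hf : ∀ b ∈ X, f b = 0) (b : B) :
    lift f hf (mk X b) = f b := rfl

instance {K : Type*} [Ring K] [RingOver K B] : RingOver K (QuotRing X) :=
  ⟨(mk X).comp RingOver.hom⟩

end QuotRing

variable {K : Type u} [Ring K] {V : Type v} [AddCommGroup V] [Module K V] [Module Kᵐᵒᵖ V]

/-- The homogeneous component of degree `m` of `T / ⟨X⟩` (for `X` homogeneous). -/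
def quotGr (X : Set (TensorRing K V)) (m : ℕ) : AddSubgroup (QuotRing X) :=
  (TensorRing.gr K V m).map (QuotRing.mk X).toAddMonoidHom

/-- The filtration `U^{≤ m} = (T^{≤ m} + ⟨X⟩) / ⟨X⟩` of `U = T / ⟨X⟩`. -/
def quotFilt (X : Set (TensorRing K V)) (m : ℕ) : AddSubgroup (QuotRing X) :=
  (TensorRing.filt K V m).map (QuotRing.mk X).toAddMonoidHom

/-- `U^{≤ m - 1}`, with `U^{≤ -1} = 0`. -/
def quotFiltPred (X : Set (TensorRing K V)) : ℕ → AddSubgroup (QuotRing X)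
  | 0 => ⊥
  | m + 1 => quotFilt X m

/-- `gr^m U = U^{≤ m} / U^{≤ m - 1}` for `U = T / ⟨X⟩`. -/
abbrev AssocGr (X : Set (TensorRing K V)) (m : ℕ) : Type _ :=
  quotFilt X m ⧸ (quotFiltPred X m).addSubgroupOf (quotFilt X m)

/-- The class in `gr^m U` of an element of `T^m`. -/
def initClass (X : Set (TensorRing K V)) (m : ℕ) (t : TensorRing.gr K V m) : AssocGr X m :=
  QuotientAddGroup.mk ⟨QuotRing.mk X t,
    AddSubgroup.mem_map_of_mem _ (TensorRing.gr_le_filt K V m t.2)⟩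

/-- `U(P) = T / ⟨P⟩` is a PBW-deformation of `A(R) = T / ⟨R⟩`: the assignments
`t + ⟨R⟩ ↦ (t + ⟨P⟩) + U(P)^{≤ m - 1}`, `t ∈ T^m`, are well-defined bijections
`A(R)^m → gr^m U(P)`. As they are the components of the natural homomorphism of graded rings
`A(R) → gr U(P)`, this says that the latter is an isomorphism. -/
def IsPBWDeformation (R P : Set (TensorRing K V)) : Prop :=
  ∀ m : ℕ, ∃ Φ : quotGr R m ≃+ AssocGr P m, ∀ t : TensorRing.gr K V m,
    Φ ⟨QuotRing.mk R t, AddSubgroup.mem_map_of_mem _ t.2⟩ = initClass P m t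

end Quotients

/-! ### Filtered morphisms and the Jacobi conditions -/

section Jacobi

variable {S : Type u} [Ring S] {W : Type v} [AddCommGroup W] [Module S W] [Module Sᵐᵒᵖ W]

/-- A bimodule map `α : R → T = T_S(W)` is a morphism of filtered bimodules,
`α(R^m) ⊆ T^{≤ m}`, whose component `α₀` of degree `0` is the inclusion. -/
structure IsFilteredMorphism {R : SubBimodule S (TensorRing S W)}
    (α : BimoduleHom S R (TensorRing S W)) : Prop where
  filtered : ∀ (m : ℕ) (r : R), (r : TensorRing S W) ∈ TensorRing.gr S W m →
    α r ∈ TensorRing.filt S W m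
  comp_zero : ∀ (m : ℕ) (r : R), (r : TensorRing S W) ∈ TensorRing.gr S W m →
    TensorRing.proj S W m (α r) = r

/-- The component `α_i = p^{n-i} ∘ α` of degree `-i` of a filtered morphism defined on an
`n`-pure bimodule (used only for `i ≤ n`). -/
noncomputable def component (n : ℕ) {R : SubBimodule S (TensorRing S W)}
    (α : BimoduleHom S R (TensorRing S W)) (i : ℕ) : BimoduleHom S R (TensorRing S W) where
  toFun r := TensorRing.proj S W (n - i) (α r)
  map_zero' := by simp
  map_add' := by simp
  map_smul' k r := by rw [BimoduleHom.map_smul, BimoduleHom.map_smul]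
  map_op_smul' k r := by rw [BimoduleHom.map_op_smul, BimoduleHom.map_op_smul]

/-- For `f : R → T`, the map `W ⊗ f : W ⊗_S R → T`, `w ⊗ r ↦ w f(r)`. -/
def leftTensor {R : SubBimodule S (TensorRing S W)} (f : BimoduleHom S R (TensorRing S W)) :
    BTensor S W R →+ TensorRing S W :=
  BTensor.lift
    (((AddMonoidHom.compHom' (f : R →+ TensorRing S W)).comp AddMonoidHom.mul).comp
      (TensorRing.ι S))
    (fun w s r => by
      simp [TensorRing.ι_op_smul, BimoduleHom.map_smul, RingOver.smul_eq, mul_assoc]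
      rfl)

/-- For `f : R → T`, the map `f ⊗ W : R ⊗_S W → T`, `r ⊗ w ↦ f(r) w`. -/
def rightTensor {R : SubBimodule S (TensorRing S W)} (f : BimoduleHom S R (TensorRing S W)) :
    BTensor S R W →+ TensorRing S W :=
  BTensor.lift
    (((AddMonoidHom.compHom' (TensorRing.ι S)).comp AddMonoidHom.mul).comp
      (f : R →+ TensorRing S W))
    (fun r s w => by
      simp [TensorRing.ι_smul, BimoduleHom.map_op_smul, RingOver.op_smul_eq, mul_assoc]
      rfl)

@[simp]
theorem leftTensor_tmul {R : SubBimodule S (TensorRing S W)}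
    (f : BimoduleHom S R (TensorRing S W)) (w : W) (r : R) :
    leftTensor f (BTensor.tmul S w r) = TensorRing.ι S w * f r := rfl

@[simp]
theorem rightTensor_tmul {R : SubBimodule S (TensorRing S W)}
    (f : BimoduleHom S R (TensorRing S W)) (r : R) (w : W) :
    rightTensor f (BTensor.tmul S r w) = f r * TensorRing.ι S w := rfl

/-- The Jacobi conditions for the components `α₁, …, α_n` of `α`.
An element of `X = (W ⊗ R) ∩ (R ⊗ W)` is given by an element `y` of `W ⊗ R` and an element `z` of
`R ⊗ W` which have the same image in `T`. With `ϑ_i = (W ⊗ α_i)(y) - (α_i ⊗ W)(z)`, the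
conditions are `ϑ₁ ∈ R`, `α_i(ϑ₁) = ϑ_{i+1}` for `0 < i < n`, and `α_n(ϑ₁) = 0`. -/
def SatisfiesJacobi (n : ℕ) {R : SubBimodule S (TensorRing S W)}
    (α : BimoduleHom S R (TensorRing S W)) : Prop :=
  ∀ (y : BTensor S W R) (z : BTensor S R W), leftTensor R.incl y = rightTensor R.incl z →
    ∃ h : leftTensor (component n α 1) y - rightTensor (component n α 1) z ∈ R,
      (∀ i : ℕ, 0 < i → i < n →
        component n α i ⟨leftTensor (component n α 1) y - rightTensor (component n α 1) z, h⟩ =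
          leftTensor (component n α (i + 1)) y - rightTensor (component n α (i + 1)) z) ∧
      component n α n ⟨leftTensor (component n α 1) y - rightTensor (component n α 1) z, h⟩ = 0

end Jacobi

/-! ### Graded projective resolutions and purity of Tor -/

section Tor

variable {A : Type u} [Ring A] (𝒜 : ℕ → AddSubgroup A)

/-- `A⁺ = ⊕_{m > 0} A^m` as a left ideal. -/
def leftAug : Submodule A A := Submodule.span A {a | ∃ m, 0 < m ∧ a ∈ 𝒜 m}

/-- `A⁺ = ⊕_{m > 0} A^m` as a right ideal. -/
def rightAug : Submodule Aᵐᵒᵖ A := Submodule.span Aᵐᵒᵖ {a | ∃ m, 0 < m ∧ a ∈ 𝒜 m}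

/-- A resolution of the right `A`-module `A⁰ = A / A⁺` by graded projective right modules, with
differentials of degree zero. -/
structure GradedProjectiveResolution where
  /-- the modules -/
  X : ℕ → Type w
  [group : ∀ i, AddCommGroup (X i)]
  [module : ∀ i, Module Aᵐᵒᵖ (X i)]
  /-- the homogeneous components -/
  comp : ∀ i, ℕ → AddSubgroup (X i)
  isInternal : ∀ i, DirectSum.IsInternal (comp i)
  smul_mem : ∀ i p q (y : X i) (a : A), y ∈ comp i p → a ∈ 𝒜 q → op a • y ∈ comp i (p + q)
  projective : ∀ i, Module.Projective Aᵐᵒᵖ (X i)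
  /-- the differentials -/
  d : ∀ i, X (i + 1) →ₗ[Aᵐᵒᵖ] X i
  d_mem : ∀ i p (y : X (i + 1)), y ∈ comp (i + 1) p → d i y ∈ comp i p
  /-- the augmentation -/
  ε : X 0 →ₗ[Aᵐᵒᵖ] A ⧸ rightAug 𝒜
  ε_comp : ∀ p (y : X 0), 0 < p → y ∈ comp 0 p → ε y = 0
  ε_surjective : Function.Surjective ε
  exact_zero : Function.Exact (d 0) ε
  exact_succ : ∀ i, Function.Exact (d (i + 1)) (d i)

namespace GradedProjectiveResolution

attribute [instance] GradedProjectiveResolution.group GradedProjectiveResolution.module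

variable {𝒜} (Q : GradedProjectiveResolution.{u, w} 𝒜)

/-- `Q_i ⊗_A A⁰`. -/
abbrev tensorX (i : ℕ) : Type _ := BTensor A (Q.X i) (A ⧸ leftAug 𝒜)

/-- The component of internal degree `p` of `Q_i ⊗_A A⁰`. -/
def tensorComp (i p : ℕ) : AddSubgroup (Q.tensorX i) :=
  AddSubgroup.closure {z | ∃ y ∈ Q.comp i p, ∃ c, z = BTensor.tmul A y c}

/-- The differential `d_i ⊗_A A⁰`. -/
def tensorD (i : ℕ) : Q.tensorX (i + 1) →+ Q.tensorX i :=
  BTensor.map (Q.d i).toAddMonoidHom (AddMonoidHom.id _)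
    (fun k m => (Q.d i).map_smul (op k) m) (fun _ _ => rfl)

/-- The cycles of homological degree `i + 1` and internal degree `p`. -/
def cycles (i p : ℕ) : AddSubgroup (Q.tensorX (i + 1)) :=
  Q.tensorComp (i + 1) p ⊓ (Q.tensorD i).ker

/-- The boundaries of homological degree `i + 1` and internal degree `p`. -/
def boundaries (i p : ℕ) : AddSubgroup (Q.tensorX (i + 1)) :=
  (Q.tensorComp (i + 2) p).map (Q.tensorD (i + 1))

/-- `Tor_{i+1,p}^A(A⁰, A⁰)`, computed with the resolution `Q`. -/
abbrev TorSucc (i p : ℕ) : Type _ := Q.cycles i p ⧸ (Q.boundaries i p).addSubgroupOf (Q.cycles i p)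

end GradedProjectiveResolution

/-- `Tor_{i+1}^A(A⁰, A⁰)` is `p`-pure, that is, concentrated in internal degree `p`. (All graded
projective resolutions give isomorphic groups.) -/
def TorSuccIsPure (i p : ℕ) : Prop :=
  ∀ (Q : GradedProjectiveResolution.{u, u} 𝒜) (q : ℕ), q ≠ p → Subsingleton (Q.TorSucc i q)

end Tor

/-! ### Twisting maps and twisted tensor products -/

section Twisting

variable (K : Type u) [Ring K]

section actions

variable {K} {M : Type*} [AddCommGroup M] [Module Kᵐᵒᵖ M] {S : Type w} [Ring S] [RingOver K S]

/-- The regular right action of `s ∈ S` on `M ⊗_K S`. -/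
def rmul (s : S) : BTensor K M S →+ BTensor K M S :=
  BTensor.map (AddMonoidHom.id M) (AddMonoidHom.mulRight s) (fun _ _ => rfl)
    (fun k t => by simp [RingOver.smul_eq, mul_assoc])

@[simp]
theorem rmul_tmul (s : S) (m : M) (t : S) :
    rmul (K := K) s (BTensor.tmul K m t) = BTensor.tmul K m (t * s) := rfl

theorem rmul_one (z : BTensor K M S) : rmul (1 : S) z = z := by
  induction z using BTensor.induction with
  | h0 => simp
  | ht m t => simp
  | ha a b h1 h2 => simp [h1, h2]

theorem rmul_mul (s t : S) (z : BTensor K M S) : rmul (s * t) z = rmul t (rmul s z) := by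
  induction z using BTensor.induction with
  | h0 => simp
  | ht m t => simp [mul_assoc]
  | ha a b h1 h2 => simp [h1, h2]

theorem rmul_add (s t : S) (z : BTensor K M S) : rmul (s + t) z = rmul s z + rmul t z := by
  induction z using BTensor.induction with
  | h0 => simp
  | ht m t => simp [mul_add, BTensor.tmul_add]
  | ha a b h1 h2 => simp only [map_add, h1, h2]; abel

/-- The left action of `k ∈ K` on `M ⊗_K N`, for a `K`-bimodule `M`. -/
def lsmul {M N : Type*} [AddCommGroup M] [Module K M] [Module Kᵐᵒᵖ M] [SMulCommClass K Kᵐᵒᵖ M]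
    [AddCommGroup N] [Module K N] (k : K) : BTensor K M N →+ BTensor K M N :=
  BTensor.map (DistribSMul.toAddMonoidHom M k) (AddMonoidHom.id N)
    (fun l m => smul_comm k (op l) m) (fun _ _ => rfl)

@[simp]
theorem lsmul_tmul {M N : Type*} [AddCommGroup M] [Module K M] [Module Kᵐᵒᵖ M]
    [SMulCommClass K Kᵐᵒᵖ M] [AddCommGroup N] [Module K N] (k : K) (m : M) (n : N) :
    lsmul k (BTensor.tmul K m n) = BTensor.tmul K (k • m) n := rfl

end actions

variable (S : Type w) [Ring S] [RingOver K S]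
  (V : Type v) [AddCommGroup V] [Module K V] [Module Kᵐᵒᵖ V] [SMulCommClass K Kᵐᵒᵖ V]

/-- A `K`-bimodule map `t : S ⊗_K V → V ⊗_K S`. -/
structure PreTwisting where
  /-- the map -/
  toHom : BTensor K S V →+ BTensor K V S
  map_smul : ∀ (k : K) (s : S) (v : V),
    toHom (BTensor.tmul K (k • s) v) = lsmul k (toHom (BTensor.tmul K s v))
  map_op_smul : ∀ (k : K) (s : S) (v : V),
    toHom (BTensor.tmul K s (op k • v)) = rmul (RingOver.hom k) (toHom (BTensor.tmul K s v))

variable {K S V}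

/-- The left twisted action of `s ∈ S` on `V ⊗_K S`, `s · (v ⊗ s') = t(s ⊗ v) s'`. -/
def PreTwisting.act (t : PreTwisting K S V) (s : S) : BTensor K V S →+ BTensor K V S :=
  BTensor.lift
    (AddMonoidHom.mk' (fun v => AddMonoidHom.mk' (fun s' => rmul s' (t.toHom (BTensor.tmul K s v)))
        (fun a b => rmul_add a b _))
      (fun v v' => by ext s'; simp [BTensor.tmul_add]))
    (fun v k s' => by simp [t.map_op_smul, RingOver.smul_eq, rmul_mul])

@[simp]
theorem PreTwisting.act_tmul (t : PreTwisting K S V) (s : S) (v : V) (s' : S) :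
    t.act s (BTensor.tmul K v s') = rmul s' (t.toHom (BTensor.tmul K s v)) := rfl

variable (K S V) in
/-- An object `(V, t)`: the bimodule map `t : S ⊗_K V → V ⊗_K S` satisfies
`t (m_S ⊗ V) = (V ⊗ m_S) (t ⊗ S) (S ⊗ t)` and `t (1 ⊗ v) = v ⊗ 1`. -/
structure Twisting extends PreTwisting K S V where
  one_twist : ∀ v : V, toHom (BTensor.tmul K 1 v) = BTensor.tmul K v 1
  mul_twist : ∀ (s s' : S) (v : V),
    toHom (BTensor.tmul K (s * s') v) = toPreTwisting.act s (toHom (BTensor.tmul K s' v))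

namespace Twisting

variable (t : Twisting K S V)

theorem act_rmul (s u : S) (z : BTensor K V S) : t.act s (rmul u z) = rmul u (t.act s z) := by
  induction z using BTensor.induction with
  | h0 => simp
  | ht v s' => simp [rmul_mul]
  | ha a b h1 h2 => simp [h1, h2]

theorem act_one (z : BTensor K V S) : t.act 1 z = z := by
  induction z using BTensor.induction with
  | h0 => simp
  | ht v s' => simp [t.one_twist]
  | ha a b h1 h2 => simp [h1, h2]

theorem act_mul (s s' : S) (z : BTensor K V S) : t.act (s * s') z = t.act s (t.act s' z) := by
  induction z using BTensor.induction with
  | h0 => simp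
  | ht v u => simp [t.mul_twist, act_rmul]
  | ha a b h1 h2 => simp [h1, h2]

theorem act_add (s s' : S) (z : BTensor K V S) : t.act (s + s') z = t.act s z + t.act s' z := by
  induction z using BTensor.induction with
  | h0 => simp
  | ht v u => simp [BTensor.add_tmul]
  | ha a b h1 h2 => simp only [map_add, h1, h2]; abel

theorem act_smul (k : K) (s : S) (z : BTensor K V S) :
    t.act (k • s) z = lsmul k (t.act s z) := by
  induction z using BTensor.induction with
  | h0 => simp
  | ht v u =>
    simp only [PreTwisting.act_tmul, t.map_smul]
    induction t.toHom (BTensor.tmul K s v) using BTensor.induction with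
    | h0 => simp
    | ht a b => simp
    | ha a b h1 h2 => simp [h1, h2]
  | ha a b h1 h2 => simp [h1, h2]

/-- The `S`-bimodule `V ⊗_t S`: the group `V ⊗_K S` with the left twisted and the right regular
`S`-actions. -/
def Bimod (_ : Twisting K S V) : Type _ := BTensor K V S

instance : AddCommGroup t.Bimod := inferInstanceAs (AddCommGroup (BTensor K V S))

instance : Module S t.Bimod where
  smul s z := t.act s z
  one_smul := t.act_one
  mul_smul := t.act_mul
  smul_zero s := (t.act s).map_zero
  smul_add s := (t.act s).map_add
  add_smul := t.act_add
  zero_smul z := by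
    have h := t.act_add 0 0 z
    rw [add_zero] at h
    exact left_eq_add.1 h

instance : Module Sᵐᵒᵖ t.Bimod where
  smul s z := rmul (K := K) (M := V) s.unop z
  one_smul := rmul_one (K := K) (M := V)
  mul_smul s s' z := rmul_mul (K := K) (M := V) s'.unop s.unop z
  smul_zero s := (rmul (K := K) (M := V) s.unop).map_zero
  smul_add s := (rmul (K := K) (M := V) s.unop).map_add
  add_smul s s' z := rmul_add (K := K) (M := V) s.unop s'.unop z
  zero_smul z := by
    have h := rmul_add (K := K) (M := V) (0 : S) 0 z
    rw [add_zero] at h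
    exact left_eq_add.1 h

instance : SMulCommClass S Sᵐᵒᵖ t.Bimod where
  smul_comm s s' z := t.act_rmul s s'.unop z

/-- The element `v ⊗ s` of `V ⊗_t S`. -/
def pure (v : V) (s : S) : t.Bimod := BTensor.tmul K v s

theorem smul_def (s : S) (z : t.Bimod) : s • z = t.act s z := rfl

theorem op_smul_pure (u : S) (v : V) (s : S) : op u • t.pure v s = t.pure v (s * u) := rfl

end Twisting

/-! #### The twisted tensor product of two `K`-rings -/

section rings

variable {A : Type x} [Ring A] [RingOver K A]

/-- Left multiplication by `a ∈ A` on `A ⊗_K S`. -/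
def lmul (a : A) : BTensor K A S →+ BTensor K A S :=
  BTensor.map (AddMonoidHom.mulLeft a) (AddMonoidHom.id S)
    (fun k b => by simp [RingOver.op_smul_eq, mul_assoc]) (fun _ _ => rfl)

@[simp]
theorem lmul_tmul (a b : A) (s : S) :
    lmul a (BTensor.tmul K b s) = BTensor.tmul K (a * b) s := rfl

theorem lmul_one (z : BTensor K A S) : lmul 1 z = z := by
  induction z using BTensor.induction with
  | h0 => simp
  | ht m t => simp
  | ha a b h1 h2 => simp [h1, h2]

theorem lmul_mul (a b : A) (z : BTensor K A S) : lmul (a * b) z = lmul a (lmul b z) := by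
  induction z using BTensor.induction with
  | h0 => simp
  | ht m t => simp [mul_assoc]
  | ha a b h1 h2 => simp [h1, h2]

theorem lmul_add (a b : A) (z : BTensor K A S) : lmul (a + b) z = lmul a z + lmul b z := by
  induction z using BTensor.induction with
  | h0 => simp
  | ht m t => simp [add_mul, BTensor.add_tmul]
  | ha a b h1 h2 => simp only [map_add, h1, h2]; abel

theorem lsmul_eq_lmul (k : K) (z : BTensor K A S) : lsmul k z = lmul (RingOver.hom k) z := rfl

theorem lmul_rmul (a : A) (u : S) (z : BTensor K A S) :
    lmul a (rmul u z) = rmul u (lmul a z) := by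
  induction z using BTensor.induction with
  | h0 => simp
  | ht m t => simp
  | ha a b h1 h2 => simp [h1, h2]

/-- The map `(m_A ⊗ S) (A ⊗ t)(- ⊗ a) : A ⊗_K S → A ⊗_K S`, `b ⊗ s ↦ b t(s ⊗ a)`. -/
def PreTwisting.coact (t : PreTwisting K S A) (a : A) : BTensor K A S →+ BTensor K A S :=
  BTensor.lift
    (AddMonoidHom.mk' (fun b => (lmul b).comp (t.toHom.comp
        ((AddMonoidHom.flip BTensor.tmulHom) a)))
      (fun b b' => by ext s; simp [lmul_add]))
    (fun b k s => by
      simp [t.map_smul, RingOver.op_smul_eq, lmul_mul, lsmul_eq_lmul])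

@[simp]
theorem PreTwisting.coact_tmul (t : PreTwisting K S A) (a b : A) (s : S) :
    t.coact a (BTensor.tmul K b s) = lmul b (t.toHom (BTensor.tmul K s a)) := rfl

variable (K S A) in
/-- A twisting map `t : S ⊗_K A → A ⊗_K S` between two `K`-rings: besides the conditions on
`(A, t)`, it satisfies `t (S ⊗ m_A) = (m_A ⊗ S) (A ⊗ t) (t ⊗ A)` and `t (s ⊗ 1) = 1 ⊗ s`. -/
structure TwistingMap extends Twisting K S A where
  map_unit : ∀ s : S, toHom (BTensor.tmul K s 1) = BTensor.tmul K 1 s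
  map_prod : ∀ (s : S) (a a' : A),
    toHom (BTensor.tmul K s (a * a')) = toPreTwisting.coact a' (toHom (BTensor.tmul K s a))

namespace TwistingMap

/-- The twisted tensor product `A ⊗_t S`: the group `A ⊗_K S` with the multiplication
`(a ⊗ s) (a' ⊗ s') = a t(s ⊗ a') s'`. -/
def Tensor (_ : TwistingMap K S A) : Type _ := BTensor K A S

variable (t : TwistingMap K S A)

instance : AddCommGroup t.Tensor := inferInstanceAs (AddCommGroup (BTensor K A S))

/-- The element `a ⊗ s` of `A ⊗_t S`. -/
def tmul (a : A) (s : S) : t.Tensor := BTensor.tmul K a s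

/-- The multiplication of `A ⊗_t S`. -/
def mulHom : BTensor K A S →+ BTensor K A S →+ BTensor K A S :=
  BTensor.lift
    (AddMonoidHom.mk' (fun a => AddMonoidHom.mk' (fun s => (lmul a).comp (t.act s))
        (fun s s' => by ext z; simp [t.act_add]))
      (fun a a' => by ext s z; simp [lmul_add]))
    (fun a k s => by
      ext z
      simp [RingOver.op_smul_eq, lmul_mul, t.act_smul, lsmul_eq_lmul])

@[simp]
theorem mulHom_tmul (a : A) (s : S) (z : BTensor K A S) :
    t.mulHom (BTensor.tmul K a s) z = lmul a (t.act s z) := rfl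

theorem mulHom_lmul (a : A) (z z' : BTensor K A S) :
    t.mulHom (lmul a z) z' = lmul a (t.mulHom z z') := by
  induction z using BTensor.induction with
  | h0 => simp
  | ht b s => simp [lmul_mul]
  | ha a b h1 h2 => simp [h1, h2]

theorem mulHom_rmul (u : S) (z z' : BTensor K A S) :
    t.mulHom (rmul u z) z' = t.mulHom z (t.act u z') := by
  induction z using BTensor.induction with
  | h0 => simp
  | ht b s => simp [t.act_mul]
  | ha a b h1 h2 => simp [h1, h2]

theorem mulHom_tmul_right (z : BTensor K A S) (c : A) (v : S) :
    t.mulHom z (BTensor.tmul K c v) = rmul v (t.coact c z) := by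
  induction z using BTensor.induction with
  | h0 => simp
  | ht b s => simp [lmul_rmul]
  | ha a b h1 h2 => simp [h1, h2]

theorem mulHom_toHom (s : S) (a : A) (z : BTensor K A S) :
    t.mulHom (t.toHom (BTensor.tmul K s a)) z = t.act s (lmul a z) := by
  induction z using BTensor.induction with
  | h0 => simp
  | ht c v => simp [mulHom_tmul_right, t.map_prod]
  | ha a b h1 h2 => simp [h1, h2]

theorem mulHom_assoc (x y z : BTensor K A S) :
    t.mulHom (t.mulHom x y) z = t.mulHom x (t.mulHom y z) := by
  induction x using BTensor.induction with
  | h0 => simp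
  | ht b s =>
    induction y using BTensor.induction with
    | h0 => simp
    | ht a u => simp [mulHom_lmul, mulHom_rmul, mulHom_toHom]
    | ha a b h1 h2 => simp only [map_add, AddMonoidHom.add_apply, h1, h2]
  | ha a b h1 h2 => simp only [map_add, AddMonoidHom.add_apply, h1, h2]

theorem one_mulHom (z : BTensor K A S) : t.mulHom (BTensor.tmul K 1 1) z = z := by
  rw [mulHom_tmul, t.act_one, lmul_one]

theorem mulHom_one (z : BTensor K A S) : t.mulHom z (BTensor.tmul K 1 1) = z := by
  induction z using BTensor.induction with
  | h0 => simp
  | ht b s => simp [t.map_unit]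
  | ha a b h1 h2 => simp only [map_add, AddMonoidHom.add_apply, h1, h2]

instance : Ring t.Tensor :=
  { (inferInstance : AddCommGroup t.Tensor) with
    mul := fun y z => t.mulHom y z
    one := t.tmul 1 1
    left_distrib := fun y z z' => (t.mulHom y).map_add z z'
    right_distrib := fun y z z' => congrArg (fun f => f z') (t.mulHom.map_add y z)
    zero_mul := fun z => congrArg (fun f => f z) t.mulHom.map_zero
    mul_zero := fun z => (t.mulHom z).map_zero
    mul_assoc := t.mulHom_assoc
    one_mul := t.one_mulHom
    mul_one := t.mulHom_one }

theorem tmul_mul_tmul (a : A) (s : S) (a' : A) (s' : S) :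
    t.tmul a s * t.tmul a' s' = lmul a (rmul s' (t.toHom (BTensor.tmul K s a'))) := rfl

end TwistingMap

end rings

/-! #### The lifting of `t` to the tensor ring and to its quotients -/

section opEnd

variable {M : Type*} [AddCommGroup M]

/-- Evaluation of an element of `End(M)ᵒᵖ`. -/
def ev : (AddMonoid.End M)ᵐᵒᵖ →+ M →+ M where
  toFun f := f.unop
  map_zero' := rfl
  map_add' _ _ := rfl

/-- An additive map as an element of `End(M)ᵒᵖ`. -/
def toOpEnd (f : M →+ M) : (AddMonoid.End M)ᵐᵒᵖ := op f

@[simp]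
theorem ev_toOpEnd (f : M →+ M) : ev (toOpEnd f) = f := rfl

@[simp]
theorem ev_mul (f g : (AddMonoid.End M)ᵐᵒᵖ) (z : M) : ev (f * g) z = ev g (ev f z) := rfl

@[simp]
theorem ev_one (z : M) : ev (1 : (AddMonoid.End M)ᵐᵒᵖ) z = z := rfl

theorem ev_injective : Function.Injective (ev : (AddMonoid.End M)ᵐᵒᵖ →+ M →+ M) :=
  fun _ _ h => unop_injective h

theorem opEnd_ext {f g : (AddMonoid.End M)ᵐᵒᵖ} (h : ∀ z, ev f z = ev g z) : f = g :=
  ev_injective (AddMonoidHom.ext h)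

end opEnd

section lifting

variable (t : Twisting K S V) {B : Type x} [Ring B] [RingOver K B]
  (π : TensorRing K V →+* B)
  (hπ : ∀ k, π (TensorRing.ofBase K V k) = RingOver.hom k)

/-- The map `π ⊗ S : V ⊗_K S → B ⊗_K S`. -/
def Twisting.emb : BTensor K V S →+ BTensor K B S :=
  BTensor.map (π.toAddMonoidHom.comp (TensorRing.ι K)) (AddMonoidHom.id S)
    (fun k v => by simp [TensorRing.ι_op_smul, RingOver.op_smul_eq, hπ]) (fun _ _ => rfl)

theorem Twisting.emb_tmul (v : V) (s : S) :
    Twisting.emb (S := S) π hπ (BTensor.tmul K v s) = BTensor.tmul K (π (TensorRing.ι K v)) s :=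
  rfl

theorem Twisting.emb_rmul (u : S) (z : BTensor K V S) :
    Twisting.emb π hπ (rmul u z) = rmul u (Twisting.emb π hπ z) := by
  induction z using BTensor.induction with
  | h0 => simp
  | ht v s => rfl
  | ha a b h1 h2 => simp [h1, h2]

theorem Twisting.emb_lsmul (k : K) (z : BTensor K V S) :
    Twisting.emb π hπ (lsmul k z) = lmul (RingOver.hom k) (Twisting.emb π hπ z) := by
  induction z using BTensor.induction with
  | h0 => simp
  | ht v s => simp [emb_tmul, TensorRing.ι_smul, hπ]
  | ha a b h1 h2 => simp [h1, h2]

/-- `b ⊗ s ↦ b (π ⊗ S)(t(s ⊗ v))`. -/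
def Twisting.rhoV (v : V) : BTensor K B S →+ BTensor K B S :=
  BTensor.lift
    (AddMonoidHom.mk' (fun b => (lmul b).comp ((Twisting.emb π hπ).comp (t.toHom.comp
        ((AddMonoidHom.flip BTensor.tmulHom) v))))
      (fun b b' => by ext s; simp [lmul_add]))
    (fun b k s => by
      simp [t.map_smul, RingOver.op_smul_eq, lmul_mul, Twisting.emb_lsmul])

theorem Twisting.rhoV_tmul (v : V) (b : B) (s : S) :
    t.rhoV π hπ v (BTensor.tmul K b s) =
      lmul b (Twisting.emb π hπ (t.toHom (BTensor.tmul K s v))) := rfl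

/-- Moving the elements of `T = T_K(V)` past `S`: the ring homomorphism
`T → End(B ⊗_K S)ᵒᵖ` which sends `k` to `b ⊗ s ↦ b ⊗ sk` and `v` to `b ⊗ s ↦ b (π ⊗ S)(t(s ⊗ v))`. -/
def Twisting.rho : TensorRing K V →+* (AddMonoid.End (BTensor K B S))ᵐᵒᵖ :=
  TensorRing.lift
    { toFun := fun k => toOpEnd (rmul (RingOver.hom k : S))
      map_one' := by
        refine opEnd_ext fun z => ?_
        simp [rmul_one]
      map_mul' := fun k l => by
        refine opEnd_ext fun z => ?_
        simp [rmul_mul]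
      map_zero' := by
        refine opEnd_ext fun z => ?_
        have h := rmul_add (0 : S) 0 z
        rw [add_zero] at h
        simpa using left_eq_add.1 h
      map_add' := fun k l => by
        refine opEnd_ext fun z => ?_
        simp [rmul_add] }
    (AddMonoidHom.mk' (fun v => toOpEnd (t.rhoV π hπ v)) (fun v v' => by
      apply ev_injective
      refine BTensor.hom_ext fun b s => ?_
      simp [Twisting.rhoV_tmul, BTensor.tmul_add]))
    (fun k v => by
      apply ev_injective
      refine BTensor.hom_ext fun b s => ?_
      simp [Twisting.rhoV_tmul, ← BTensor.smul_tmul, RingOver.op_smul_eq])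
    (fun k v => by
      apply ev_injective
      refine BTensor.hom_ext fun b s => ?_
      simp [Twisting.rhoV_tmul, t.map_op_smul, Twisting.emb_rmul, lmul_rmul])

theorem Twisting.rho_ofBase (k : K) (z : BTensor K B S) :
    ev (t.rho π hπ (TensorRing.ofBase K V k)) z = rmul (RingOver.hom k) z := by
  simp [rho]

theorem Twisting.rho_ι (v : V) (z : BTensor K B S) :
    ev (t.rho π hπ (TensorRing.ι K v)) z = t.rhoV π hπ v z := by
  simp [rho]

theorem Twisting.rho_mul (x y : TensorRing K V) (z : BTensor K B S) :
    ev (t.rho π hπ (x * y)) z = ev (t.rho π hπ y) (ev (t.rho π hπ x) z) := by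
  simp

theorem Twisting.rho_add (x y : TensorRing K V) (z : BTensor K B S) :
    ev (t.rho π hπ (x + y)) z = ev (t.rho π hπ x) z + ev (t.rho π hπ y) z := by
  simp

theorem Twisting.rho_lmul (x : TensorRing K V) (b : B) (z : BTensor K B S) :
    ev (t.rho π hπ x) (lmul b z) = lmul b (ev (t.rho π hπ x) z) := by
  induction x using TensorRing.induction generalizing z with
  | hK k => simp only [rho_ofBase, lmul_rmul]
  | hV v =>
    simp only [rho_ι]
    induction z using BTensor.induction with
    | h0 => simp
    | ht c s => simp [rhoV_tmul, lmul_mul]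
    | ha a b h1 h2 => simp [h1, h2]
  | hmul x y hx hy => simp only [rho_mul, hx, hy]
  | hadd x y hx hy => rw [rho_add, rho_add, hx, hy, map_add]

theorem Twisting.rho_tmul_one (x : TensorRing K V) (b : B) :
    ev (t.rho π hπ x) (BTensor.tmul K b 1) = BTensor.tmul K (b * π x) (1 : S) := by
  induction x using TensorRing.induction generalizing b with
  | hK k =>
    rw [rho_ofBase, hπ, rmul_tmul, one_mul, ← RingOver.op_smul_eq, BTensor.smul_tmul,
      RingOver.smul_eq, mul_one]
  | hV v => simp [rho_ι, rhoV_tmul, t.one_twist, emb_tmul]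
  | hmul x y hx hy => rw [rho_mul, hx, hy, map_mul π, mul_assoc]
  | hadd x y hx hy => rw [rho_add, hx, hy, map_add π, mul_add, BTensor.add_tmul]

variable (σ : B →+* (AddMonoid.End (BTensor K B S))ᵐᵒᵖ)

theorem Twisting.ev_hom_mul (hσ : ∀ x, σ (π x) = t.rho π hπ x) (k : K) (b : B) (z : BTensor K B S) :
    ev (σ ((RingOver.hom k : B) * b)) z = ev (σ b) (rmul (RingOver.hom k) z) := by
  rw [← hπ, map_mul σ, ev_mul, hσ, t.rho_ofBase]

theorem Twisting.ev_mul_hom (hσ : ∀ x, σ (π x) = t.rho π hπ x) (k : K) (b : B) (z : BTensor K B S) :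
    ev (σ (b * (RingOver.hom k : B))) z = rmul (RingOver.hom k) (ev (σ b) z) := by
  rw [← hπ, map_mul σ, ev_mul, hσ, t.rho_ofBase]

theorem Twisting.ev_lmul (hπs : Function.Surjective π)
    (hσ : ∀ x, σ (π x) = t.rho π hπ x) (b c : B) (z : BTensor K B S) :
    ev (σ b) (lmul c z) = lmul c (ev (σ b) z) := by
  obtain ⟨x, rfl⟩ := hπs b
  rw [hσ, t.rho_lmul]

/-- The map `S ⊗_K B → B ⊗_K S`, `s ⊗ b ↦ σ(b)(1 ⊗ s)`, obtained by moving `s` to the right. -/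
def Twisting.liftPre (hπs : Function.Surjective π) (hσ : ∀ x, σ (π x) = t.rho π hπ x) :
    PreTwisting K S B where
  toHom := BTensor.lift
    (AddMonoidHom.mk' (fun s => AddMonoidHom.mk' (fun b => ev (σ b) (BTensor.tmul K 1 s))
        (fun b b' => by simp))
      (fun s s' => by ext b; simp [BTensor.tmul_add]))
    (fun s k b => (t.ev_hom_mul π hπ σ hσ k b (BTensor.tmul K 1 s)).symm)
  map_smul k s b := by
    have h : BTensor.tmul K (1 : B) (k • s) = lmul (RingOver.hom k) (BTensor.tmul K (1 : B) s) := by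
      rw [← BTensor.smul_tmul, RingOver.op_smul_eq, one_mul, lmul_tmul, mul_one]
    have h' := t.ev_lmul π hπ σ hπs hσ b (RingOver.hom k) (BTensor.tmul K (1 : B) s)
    rw [← h] at h'
    exact h'
  map_op_smul k s b := t.ev_mul_hom π hπ σ hσ k b (BTensor.tmul K 1 s)

variable (hπs : Function.Surjective π) (hσ : ∀ x, σ (π x) = t.rho π hπ x)

theorem Twisting.liftPre_tmul (s : S) (b : B) :
    (t.liftPre π hπ σ hπs hσ).toHom (BTensor.tmul K s b) = ev (σ b) (BTensor.tmul K 1 s) := rfl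

theorem Twisting.liftPre_act_rmul (s u : S) (z : BTensor K B S) :
    (t.liftPre π hπ σ hπs hσ).act s (rmul u z) = rmul u ((t.liftPre π hπ σ hπs hσ).act s z) := by
  induction z using BTensor.induction with
  | h0 => simp only [map_zero]
  | ht v s' => rw [rmul_tmul, PreTwisting.act_tmul, PreTwisting.act_tmul, rmul_mul]
  | ha a b h1 h2 => simp only [map_add, h1, h2]

theorem Twisting.rhoV_add (v v' : V) (y : BTensor K B S) :
    t.rhoV π hπ (v + v') y = t.rhoV π hπ v y + t.rhoV π hπ v' y := by
  rw [← rho_ι, ← rho_ι, ← rho_ι, map_add, rho_add]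

theorem Twisting.rhoV_op_smul (k : K) (v : V) (y : BTensor K B S) :
    t.rhoV π hπ (op k • v) y = rmul (RingOver.hom k) (t.rhoV π hπ v y) := by
  rw [← rho_ι, ← rho_ι, TensorRing.ι_op_smul, rho_mul, rho_ofBase]

/-- `v ⊗ u ↦ rhoV(v)(y) u`. -/
def Twisting.rhoHom (y : BTensor K B S) : BTensor K V S →+ BTensor K B S :=
  BTensor.lift
    (AddMonoidHom.mk' (fun v => AddMonoidHom.mk' (fun u => rmul u (t.rhoV π hπ v y))
        (fun a b => rmul_add a b _))
      (fun v v' => AddMonoidHom.ext fun u =>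
        (congrArg (rmul u) (t.rhoV_add π hπ v v' y)).trans (map_add (rmul u) _ _)))
    (fun v k u => (congrArg (rmul u) (t.rhoV_op_smul π hπ k v y)).trans
      (rmul_mul (RingOver.hom k) u _).symm)

theorem Twisting.rhoHom_tmul (y : BTensor K B S) (v : V) (u : S) :
    t.rhoHom π hπ y (BTensor.tmul K v u) = rmul u (t.rhoV π hπ v y) := rfl

theorem Twisting.rhoHom_add (y y' : BTensor K B S) (z : BTensor K V S) :
    t.rhoHom π hπ (y + y') z = t.rhoHom π hπ y z + t.rhoHom π hπ y' z := by
  induction z using BTensor.induction with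
  | h0 => simp only [map_zero, add_zero]
  | ht v u => simp only [rhoHom_tmul, map_add]
  | ha a b h1 h2 => simp only [map_add, h1, h2]; abel

theorem Twisting.rhoHom_zero (z : BTensor K V S) : t.rhoHom π hπ 0 z = 0 := by
  have h := t.rhoHom_add π hπ 0 0 z
  rw [add_zero] at h
  exact left_eq_add.1 h

theorem Twisting.rhoHom_basic (c : B) (s : S) (z : BTensor K V S) :
    t.rhoHom π hπ (BTensor.tmul K c s) z = lmul c (Twisting.emb π hπ (t.act s z)) := by
  induction z using BTensor.induction with
  | h0 => simp only [map_zero]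
  | ht v u => rw [rhoHom_tmul, rhoV_tmul, PreTwisting.act_tmul, emb_rmul, lmul_rmul]
  | ha a b h1 h2 => simp only [map_add, h1, h2]

theorem Twisting.rhoV_rmul (v : V) (u : S) (y : BTensor K B S) :
    t.rhoV π hπ v (rmul u y) = t.rhoHom π hπ y (t.toHom (BTensor.tmul K u v)) := by
  induction y using BTensor.induction with
  | h0 => simp only [map_zero, rhoHom_zero]
  | ht c s => rw [rmul_tmul, rhoV_tmul, t.mul_twist, rhoHom_basic]
  | ha a b h1 h2 => simp only [map_add, h1, h2, rhoHom_add]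

theorem Twisting.liftPre_act_emb (s : S) (x : TensorRing K V) (z : BTensor K V S) :
    (t.liftPre π hπ σ hπs hσ).act s (lmul (π x) (Twisting.emb π hπ z)) =
      t.rhoHom π hπ (ev (t.rho π hπ x) (BTensor.tmul K 1 s)) z := by
  induction z using BTensor.induction with
  | h0 => simp only [map_zero]
  | ht v u =>
    rw [emb_tmul, lmul_tmul, ← map_mul π, PreTwisting.act_tmul, liftPre_tmul, hσ, rho_mul, rho_ι,
      rhoHom_tmul]
  | ha a b h1 h2 => simp only [map_add, h1, h2]

theorem Twisting.liftPre_act (s : S) (x : TensorRing K V) (z : BTensor K B S) :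
    (t.liftPre π hπ σ hπs hσ).act s (ev (t.rho π hπ x) z) =
      ev (t.rho π hπ x) ((t.liftPre π hπ σ hπs hσ).act s z) := by
  induction x using TensorRing.induction generalizing z with
  | hK k => rw [rho_ofBase, rho_ofBase, liftPre_act_rmul]
  | hV v =>
    rw [rho_ι, rho_ι]
    induction z using BTensor.induction with
    | h0 => simp only [map_zero]
    | ht b u =>
      obtain ⟨x, rfl⟩ := hπs b
      rw [rhoV_tmul, PreTwisting.act_tmul, liftPre_tmul, hσ, liftPre_act_emb, rhoV_rmul]
    | ha a b h1 h2 => simp only [map_add, h1, h2]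
  | hmul x y hx hy => rw [rho_mul, rho_mul, hy, hx]
  | hadd x y hx hy => rw [rho_add, rho_add, map_add, hx, hy]

/-- The twisting map `S ⊗_K B → B ⊗_K S` induced by `t` on a quotient `B` of the tensor ring. -/
def Twisting.liftMap : TwistingMap K S B where
  toPreTwisting := t.liftPre π hπ σ hπs hσ
  one_twist b := by
    obtain ⟨x, rfl⟩ := hπs b
    rw [t.liftPre_tmul, hσ, t.rho_tmul_one, one_mul]
  mul_twist s s' b := by
    obtain ⟨x, rfl⟩ := hπs b
    rw [t.liftPre_tmul, t.liftPre_tmul, hσ, t.liftPre_act, PreTwisting.act_tmul, t.liftPre_tmul]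
    simp
  map_unit s := by
    rw [t.liftPre_tmul]
    simp
  map_prod s a a' := by
    have h : ∀ z : BTensor K B S,
        (t.liftPre π hπ σ hπs hσ).coact a' z = ev (σ a') z := by
      intro z
      obtain ⟨x, rfl⟩ := hπs a'
      induction z using BTensor.induction with
      | h0 => simp
      | ht b s =>
        rw [PreTwisting.coact_tmul, t.liftPre_tmul, hσ, ← t.rho_lmul, lmul_tmul, mul_one]
      | ha a b h1 h2 => simp [h1, h2]
    rw [h, t.liftPre_tmul, t.liftPre_tmul, map_mul]
    simp

end lifting

namespace Twisting

variable (t : Twisting K S V)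

/-- The lifting `t* : S ⊗_K T → T ⊗_K S` of `t` to the tensor ring `T = T_K(V)`. -/
def star : TwistingMap K S (TensorRing K V) :=
  t.liftMap (RingHom.id _) (fun _ => rfl) (t.rho (RingHom.id _) (fun _ => rfl))
    Function.surjective_id (fun _ => rfl)

/-- The image of `R ⊗_K S` in `T ⊗_K S`. -/
def tensorSub (_ : Twisting K S V) (R : SubBimodule K (TensorRing K V)) :
    AddSubgroup (BTensor K (TensorRing K V) S) :=
  AddSubgroup.closure {z | ∃ r ∈ R, ∃ s : S, z = BTensor.tmul K r s}

/-- `R` is `t*`-invariant: `t*(S ⊗ R) ⊆ R ⊗ S`. -/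
def IsInvariant (R : SubBimodule K (TensorRing K V)) : Prop :=
  ∀ (s : S), ∀ r ∈ R, t.star.toHom (BTensor.tmul K s r) ∈ t.tensorSub R

/-- The tensor ring `T_S(V ⊗_t S)`. -/
abbrev Tbar : Type _ := TensorRing S t.Bimod

/-- The map `V → T_S(V ⊗_t S)`, `v ↦ v ⊗ 1`. -/
def jV : V →+ t.Tbar :=
  AddMonoidHom.mk' (fun v => TensorRing.ι S (t.pure v 1))
    (fun v v' => (congrArg _ (BTensor.add_tmul v v' (1 : S))).trans
      (map_add (TensorRing.ι S) (t.pure v 1) (t.pure v' 1)))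

theorem jV_apply (v : V) : t.jV v = TensorRing.ι S (t.pure v 1) := rfl

theorem jV_smul (k : K) (v : V) :
    t.jV (k • v) = TensorRing.ofBase S t.Bimod (RingOver.hom k) * t.jV v := by
  have h : t.pure (k • v) 1 = (RingOver.hom k : S) • t.pure v 1 := by
    change BTensor.tmul K (k • v) 1 = t.act (RingOver.hom k) (BTensor.tmul K v 1)
    have h1 := t.act_smul k 1 (BTensor.tmul K v 1)
    rw [RingOver.smul_eq, mul_one, t.act_one] at h1
    exact h1.symm
  rw [jV_apply, h, TensorRing.ι_smul, jV_apply]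

theorem jV_op_smul (k : K) (v : V) :
    t.jV (op k • v) = t.jV v * TensorRing.ofBase S t.Bimod (RingOver.hom k) := by
  have h : t.pure (op k • v) 1 = op (RingOver.hom k : S) • t.pure v 1 := by
    rw [t.op_smul_pure, one_mul]
    exact (BTensor.smul_tmul v k (1 : S)).trans (by rw [RingOver.smul_eq, mul_one]; rfl)
  rw [jV_apply, h, TensorRing.ι_op_smul, jV_apply]

/-- The ring homomorphism `T_K(V) → T_S(V ⊗_t S)`, `v ↦ v ⊗ 1`, extending `K → S`. -/
def j : TensorRing K V →+* t.Tbar :=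
  TensorRing.lift ((TensorRing.ofBase S t.Bimod).comp RingOver.hom) t.jV t.jV_smul t.jV_op_smul

theorem j_ofBase (k : K) :
    t.j (TensorRing.ofBase K V k) = TensorRing.ofBase S t.Bimod (RingOver.hom k) :=
  TensorRing.lift_ofBase _ _ _ _ k

theorem j_ι (v : V) : t.j (TensorRing.ι K v) = TensorRing.ι S (t.pure v 1) :=
  TensorRing.lift_ι _ _ _ _ v

/-- The isomorphism `ψ : T ⊗_K S → T_S(V ⊗_t S)`, `x ⊗ s ↦ j(x) s`, so that
`ψ(v₁ ⊗ ⋯ ⊗ v_m ⊗ s) = (v₁ ⊗ 1) ⊗ ⋯ ⊗ (v_m ⊗ s)`. -/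
def psi : BTensor K (TensorRing K V) S →+ t.Tbar :=
  BTensor.lift
    (((AddMonoidHom.compHom' (TensorRing.ofBase S t.Bimod).toAddMonoidHom).comp
      AddMonoidHom.mul).comp t.j.toAddMonoidHom)
    (fun x k s => by
      change t.j (x * TensorRing.ofBase K V k) * TensorRing.ofBase S t.Bimod s =
        t.j x * TensorRing.ofBase S t.Bimod (RingOver.hom k * s)
      rw [map_mul t.j, j_ofBase, map_mul (TensorRing.ofBase S t.Bimod), mul_assoc])

theorem psi_tmul (x : TensorRing K V) (s : S) :
    t.psi (BTensor.tmul K x s) = t.j x * TensorRing.ofBase S t.Bimod s := rfl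

theorem psi_rmul (u : S) (z : BTensor K (TensorRing K V) S) :
    t.psi (rmul u z) = t.psi z * TensorRing.ofBase S t.Bimod u := by
  induction z using BTensor.induction with
  | h0 => simp
  | ht x s => simp [psi_tmul, mul_assoc]
  | ha a b h1 h2 => simp [h1, h2, add_mul]

theorem psi_lmul (x : TensorRing K V) (z : BTensor K (TensorRing K V) S) :
    t.psi (lmul x z) = t.j x * t.psi z := by
  induction z using BTensor.induction with
  | h0 => simp
  | ht x s => simp [psi_tmul, mul_assoc]
  | ha a b h1 h2 => simp [h1, h2, mul_add]

theorem psi_rho (x : TensorRing K V) (z : BTensor K (TensorRing K V) S) :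
    t.psi (ev (t.rho (RingHom.id _) (fun _ => rfl) x) z) = t.psi z * t.j x := by
  induction x using TensorRing.induction generalizing z with
  | hK k => rw [rho_ofBase, psi_rmul, j_ofBase]
  | hV v =>
    rw [rho_ι]
    induction z using BTensor.induction with
    | h0 => simp
    | ht y s =>
      rw [rhoV_tmul, psi_lmul, psi_tmul, mul_assoc]
      congr 1
      have h : ∀ z : BTensor K V S, t.psi (emb (RingHom.id _) (fun _ => rfl) z) =
          TensorRing.ι S (show t.Bimod from z) := by
        intro z
        induction z using BTensor.induction with
        | h0 => exact (map_zero _).trans (map_zero (TensorRing.ι S : t.Bimod →+ _)).symm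
        | ht v s =>
          rw [emb_tmul, psi_tmul, RingHom.id_apply, j_ι, ← TensorRing.ι_op_smul, op_smul_pure,
            one_mul]
          rfl
        | ha a b h1 h2 =>
          rw [map_add, map_add, h1, h2]
          exact (map_add (TensorRing.ι S : t.Bimod →+ _) _ _).symm
      rw [h, j_ι, ← TensorRing.ι_smul]
      congr 1
      change _ = t.act s (BTensor.tmul K v 1)
      rw [PreTwisting.act_tmul, rmul_one]
    | ha a b h1 h2 => simp only [map_add, h1, h2, add_mul]
  | hmul x y hx hy => rw [rho_mul, hy, hx, map_mul, mul_assoc]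
  | hadd x y hx hy => rw [rho_add, map_add, hx, hy, map_add, mul_add]

theorem tensorSub_le_comap {R : SubBimodule K (TensorRing K V)} (hR : t.IsInvariant R) (s : S) :
    ∀ z ∈ t.tensorSub R, ∃ z' ∈ t.tensorSub R,
      t.psi z' = TensorRing.ofBase S t.Bimod s * t.psi z := by
  intro z hz
  induction hz using AddSubgroup.closure_induction with
  | mem z hz =>
    obtain ⟨r, hr, u, rfl⟩ := hz
    refine ⟨rmul u (t.star.toHom (BTensor.tmul K s r)), ?_, ?_⟩
    · have h := hR s r hr
      generalize t.star.toHom (BTensor.tmul K s r) = y at h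
      induction h using AddSubgroup.closure_induction with
      | mem y hy =>
        obtain ⟨r, hr, u', rfl⟩ := hy
        exact AddSubgroup.subset_closure ⟨r, hr, u' * u, rfl⟩
      | zero => simp [zero_mem]
      | add a b _ _ h1 h2 => rw [map_add]; exact add_mem h1 h2
      | neg a _ h1 => rw [map_neg]; exact neg_mem h1
    · rw [psi_rmul]
      have h : t.star.toHom (BTensor.tmul K s r) =
        ev (t.rho (RingHom.id _) (fun _ => rfl) r) (BTensor.tmul K 1 s) := rfl
      rw [h, psi_rho, psi_tmul, psi_tmul, map_one, one_mul, mul_assoc]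
  | zero => exact ⟨0, zero_mem _, by simp⟩
  | add a b _ _ h1 h2 =>
    obtain ⟨a', ha, ha'⟩ := h1
    obtain ⟨b', hb, hb'⟩ := h2
    exact ⟨a' + b', add_mem ha hb, by rw [map_add, ha', hb', map_add, mul_add]⟩
  | neg a _ h1 =>
    obtain ⟨a', ha, ha'⟩ := h1
    exact ⟨-a', neg_mem ha, by rw [map_neg, ha', map_neg, mul_neg]⟩

/-- The `S`-bimodule `R̄ = ψ(R ⊗ S)`. -/
def Rbar (R : SubBimodule K (TensorRing K V)) (hR : t.IsInvariant R) :
    SubBimodule S t.Tbar where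
  toAddSubgroup := (t.tensorSub R).map t.psi
  left_mem' := by
    rintro s _ ⟨z, hz, rfl⟩
    obtain ⟨z', hz', h⟩ := t.tensorSub_le_comap hR s z hz
    exact ⟨z', hz', h⟩
  right_mem' := by
    rintro s _ ⟨z, hz, rfl⟩
    refine ⟨rmul s z, ?_, t.psi_rmul s z⟩
    induction hz using AddSubgroup.closure_induction with
    | mem y hy =>
      obtain ⟨r, hr, u', rfl⟩ := hy
      exact AddSubgroup.subset_closure ⟨r, hr, u' * s, rfl⟩
    | zero => simp [zero_mem]
    | add a b _ _ h1 h2 => rw [map_add]; exact add_mem h1 h2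
    | neg a _ h1 => rw [map_neg]; exact neg_mem h1

theorem rho_mk (X : Set (TensorRing K V)) (x : TensorRing K V) (b : QuotRing X) (s : S) :
    ev (t.rho (QuotRing.mk X) (fun _ => rfl) x) (BTensor.tmul K b s) =
      lmul b (BTensor.map (QuotRing.mk X).toAddMonoidHom (AddMonoidHom.id S)
        (fun k y => map_mul (QuotRing.mk X) y (TensorRing.ofBase K V k)) (fun _ _ => rfl)
        (t.star.toHom (BTensor.tmul K s x))) := by
  have h : t.star.toHom (BTensor.tmul K s x) =
    ev (t.rho (RingHom.id _) (fun _ => rfl) x) (BTensor.tmul K 1 s) := rfl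
  rw [h]
  set M : BTensor K (TensorRing K V) S →+ BTensor K (QuotRing X) S :=
    BTensor.map (QuotRing.mk X).toAddMonoidHom (AddMonoidHom.id S)
        (fun k y => map_mul (QuotRing.mk X) y (TensorRing.ofBase K V k)) (fun _ _ => rfl) with hM
  have hM1 : ∀ y (u : S), M (BTensor.tmul K y u) = BTensor.tmul K (QuotRing.mk X y) u :=
    fun _ _ => rfl
  have hMr : ∀ (u : S) z, M (rmul u z) = rmul u (M z) := by
    intro u z
    induction z using BTensor.induction with
    | h0 => simp
    | ht y s => simp [hM1]
    | ha a b h1 h2 => simp [h1, h2]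
  have hMl : ∀ y z, M (lmul y z) = lmul (QuotRing.mk X y) (M z) := by
    intro u z
    induction z using BTensor.induction with
    | h0 => simp
    | ht y s => simp [hM1]
    | ha a b h1 h2 => simp [h1, h2]
  have hρ : ∀ x z, M (ev (t.rho (RingHom.id _) (fun _ => rfl) x) z) =
      ev (t.rho (QuotRing.mk X) (fun _ => rfl) x) (M z) := by
    intro x
    induction x using TensorRing.induction with
    | hK k => intro z; rw [rho_ofBase, rho_ofBase, hMr]
    | hV v =>
      intro z
      rw [rho_ι, rho_ι]
      induction z using BTensor.induction with
      | h0 => simp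
      | ht y s =>
        rw [rhoV_tmul, hMl, hM1, rhoV_tmul]
        congr 1
        induction t.toHom (BTensor.tmul K s v) using BTensor.induction with
        | h0 => simp
        | ht a b => simp only [emb_tmul, hM1]; rfl
        | ha a b h1 h2 => simp only [map_add, h1, h2]
      | ha a b h1 h2 => simp only [map_add, h1, h2]
    | hmul x y hx hy => intro z; rw [rho_mul, rho_mul, hy, hx]
    | hadd x y hx hy => intro z; rw [rho_add, rho_add, map_add, hx, hy]
  rw [hρ, hM1, map_one, ← rho_lmul, lmul_tmul, mul_one]

/-- For `A = T / ⟨R⟩` with `R` invariant, the twisting map `S ⊗_K A → A ⊗_K S` induced by `t*`. -/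
def quot (R : SubBimodule K (TensorRing K V)) (hR : t.IsInvariant R) :
    TwistingMap K S (QuotRing (R : Set (TensorRing K V))) :=
  t.liftMap (QuotRing.mk _) (fun _ => rfl)
    (QuotRing.lift (t.rho (QuotRing.mk _) (fun _ => rfl)) (fun r hr => by
      apply ev_injective
      refine BTensor.hom_ext fun b s => ?_
      have h := hR s r hr
      rw [rho_mk]
      generalize t.star.toHom (BTensor.tmul K s r) = y at h
      induction h using AddSubgroup.closure_induction with
      | mem y hy =>
        obtain ⟨r, hr, u, rfl⟩ := hy
        have h0 : QuotRing.mk (R : Set (TensorRing K V)) r = 0 :=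
          (RingCon.eq _).2 (TwoSidedIdeal.subset_span hr)
        simp [h0, BTensor.zero_tmul]
      | zero => simp
      | add a b _ _ h1 h2 => rw [map_add, map_add, h1, h2]; simp
      | neg a _ h1 => rw [map_neg, map_neg, h1]; simp))
    (QuotRing.mk_surjective _) (fun _ => rfl)

end Twisting

end Twisting

end NCPBW

open NCPBW

/-! Write `W` for the `S`-bimodule `V ⊗_t S`, and `T̄ = T_S(W)`.

The ring isomorphism. The map `psi` from `T ⊗_K S` to `T̄` is bijective. Its image is closed under
products because `t*` moves `S` to the right past `T`, and the universal property of `T̄` yields a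
left inverse (`psi_injective`, `psi_surjective`). By right exactness the kernel of `T ⊗_K S → A ⊗_K
S` is the image of `⟨R⟩ ⊗_K S`, and `psi` carries it onto `⟨R̄⟩`; this gives `exists_ringEquiv`.

The PBW property says that the leading components of the elements of `⟨P̄⟩` are exactly the
homogeneous elements of `⟨R̄⟩` (`isPBWDeformation_iff`). The Jacobi conditions, collected over all
degrees, say that `(W ⊗ α)(y) - (α ⊗ W)(z)` lies in the image of `α` for every `(y, z)` in the
intersection `X̄` (`satisfiesJacobi_iff`).

From (a) to (b): `⟨R̄⟩` is zero below degree `n` and equals `R̄` in degree `n`. So a PBW-deformation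
has no nonzero element of `⟨P̄⟩` below degree `n`, and the elements of `⟨P̄⟩` of degree at most `n`
form `P̄`. Hence `p^n : P̄ → R̄` is bijective with inverse `α`, and the element above has degree at
most `n`, so it lies in `P̄`.

From (b) to (a): lift `a r b ∈ ⟨R̄⟩` to `a α(r) b ∈ ⟨P̄⟩`. The PBW property follows once this lift
is well defined modulo elements of `⟨P̄⟩` which are visibly of lower degree
(`isPBWDeformation_of_liftRel`). Ambiguities are controlled by the kernel of `R̄ ⊗ T̄ → T̄ / W⟨R̄⟩`.
If this kernel consists of the obvious syzygies (`HasLinearSyzygies`), namely those from `X̄` and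
from `R̄ ⊗ ⟨R̄⟩`, then the Jacobi conditions settle the first kind and an identity for `α(r) a r' b`
the second (`exists_shiftRel_of_mem_syzygies`). What remains begins with a factor in `W`, which is
removed by a dual basis of the projective right module `W`, and one argues by induction on the
degree (`mem_lowerIdeal_of_mem_liftRel`).

The syzygies are first studied over `K`. The complex `R ⊗_K A → V ⊗_K A → A` begins a graded
projective resolution of `A⁰`, so minimal generators of the kernel of its first map are seen by
`Tor_3`. Purity and a graded Nakayama argument (`mem_closure_of_generated`) show that this kernel is
generated in degree `n + 1`, where it is `(V ⊗ R) ∩ (R ⊗ V)`; this is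
`hasLinearSyzygies_of_torSuccIsPure`. Since `S` is flat, the kernel over `S` comes from the kernel
over `K` tensored with `S` (`hasLinearSyzygies_Rbar`). -/

namespace NCPBW

/-! ### Right exactness of the tensor product over a noncommutative ring -/

section Exactness

variable {K : Type*} [Ring K] {M N M' N' P : Type*}
  [AddCommGroup M] [Module Kᵐᵒᵖ M] [AddCommGroup N] [Module K N]
  [AddCommGroup M'] [Module Kᵐᵒᵖ M'] [AddCommGroup N'] [Module K N'] [AddCommGroup P]

theorem BTensor.neg_tmul (m : M) (n : N) : tmul K (-m) n = -tmul K m n :=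
  map_neg ((AddMonoidHom.flip BTensor.tmulHom) n) m

theorem BTensor.tmul_neg (m : M) (n : N) : tmul K m (-n) = -tmul K m n :=
  map_neg (BTensor.tmulHom m) n

theorem BTensor.sub_tmul (m m' : M) (n : N) :
    tmul K (m - m') n = tmul K m n - tmul K m' n :=
  map_sub ((AddMonoidHom.flip BTensor.tmulHom) n) m m'

theorem BTensor.tmul_sub (m : M) (n n' : N) :
    tmul K m (n - n') = tmul K m n - tmul K m n' :=
  map_sub (BTensor.tmulHom m) n n'

theorem BTensor.sum_tmul {ι : Type*} (s : Finset ι) (f : ι → M) (n : N) :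
    tmul K (∑ i ∈ s, f i) n = ∑ i ∈ s, tmul K (f i) n :=
  map_sum ((AddMonoidHom.flip BTensor.tmulHom) n) f s

theorem BTensor.map_surjective (f : M →+ M') (g : N →+ N')
    (hf : ∀ (k : K) m, f (op k • m) = op k • f m) (hg : ∀ (k : K) n, g (k • n) = k • g n)
    (hfs : Function.Surjective f) (hgs : Function.Surjective g) :
    Function.Surjective (BTensor.map f g hf hg) := by
  intro z
  induction z using BTensor.induction with
  | h0 => exact ⟨0, map_zero _⟩
  | ht m n =>
    obtain ⟨m, rfl⟩ := hfs m
    obtain ⟨n, rfl⟩ := hgs n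
    exact ⟨tmul K m n, rfl⟩
  | ha a b h1 h2 =>
    obtain ⟨a, rfl⟩ := h1
    obtain ⟨b, rfl⟩ := h2
    exact ⟨a + b, map_add _ _ _⟩

/-- Right exactness of the tensor product. -/
theorem BTensor.mem_closure_of_map_eq_zero (f : M →+ M') (g : N →+ N')
    (hf : ∀ (k : K) m, f (op k • m) = op k • f m) (hg : ∀ (k : K) n, g (k • n) = k • g n)
    (hfs : Function.Surjective f) (hgs : Function.Surjective g)
    (z : BTensor K M N) (hz : BTensor.map f g hf hg z = 0) :
    z ∈ AddSubgroup.closure {y : BTensor K M N | ∃ m n, (f m = 0 ∨ g n = 0) ∧ y = tmul K m n} := by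
  set C := AddSubgroup.closure
    {y : BTensor K M N | ∃ m n, (f m = 0 ∨ g n = 0) ∧ y = tmul K m n} with hC
  let q : BTensor K M N →+ BTensor K M N ⧸ C := QuotientAddGroup.mk' C
  have hq : ∀ m n, (f m = 0 ∨ g n = 0) → q (tmul K m n) = 0 := fun m n h =>
    (QuotientAddGroup.eq_zero_iff _).2 (AddSubgroup.subset_closure ⟨m, n, h, rfl⟩)
  choose sf hsf using hfs
  choose sg hsg using hgs
  have hl : ∀ m m' n, f m = f m' → q (tmul K m n) = q (tmul K m' n) := by
    intro m m' n h
    rw [← sub_eq_zero, ← map_sub, ← sub_tmul]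
    exact hq _ _ (Or.inl (by rw [map_sub, h, sub_self]))
  have hr : ∀ m n n', g n = g n' → q (tmul K m n) = q (tmul K m n') := by
    intro m n n' h
    rw [← sub_eq_zero, ← map_sub, ← tmul_sub]
    exact hq _ _ (Or.inr (by rw [map_sub, h, sub_self]))
  -- An inverse of the map induced on the quotient by `C`: both factors are lifted arbitrarily, and
  -- `hl` and `hr` say that the choice of the lifts does not matter modulo `C`.
  let inv : BTensor K M' N' →+ BTensor K M N ⧸ C := BTensor.lift
    (AddMonoidHom.mk' (fun m => AddMonoidHom.mk' (fun n => q (tmul K (sf m) (sg n)))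
      (fun n n' => by
        rw [← map_add, ← tmul_add]
        exact hr _ _ _ (by rw [map_add, hsg, hsg, hsg])))
      (fun m m' => by
        ext n
        simp only [AddMonoidHom.mk'_apply, AddMonoidHom.add_apply]
        rw [← map_add, ← add_tmul]
        exact hl _ _ _ (by rw [map_add, hsf, hsf, hsf])))
    (fun m k n => by
      simp only [AddMonoidHom.mk'_apply]
      rw [hl _ (op k • sf m) _ (by rw [hf, hsf, hsf]), smul_tmul,
        hr _ _ (sg (k • n)) (by rw [hg, hsg, hsg])])
  have key : inv.comp (BTensor.map f g hf hg) = q := by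
    refine BTensor.hom_ext fun m n => ?_
    change q (tmul K (sf (f m)) (sg (g n))) = _
    rw [hl _ m _ (hsf _), hr _ _ n (hsg _)]
  have h := DFunLike.congr_fun key z
  rw [AddMonoidHom.comp_apply, hz, map_zero] at h
  exact (QuotientAddGroup.eq_zero_iff _).1 h.symm

end Exactness

/-! ### Right module structures on tensor products -/

section RightAction

variable {K : Type*} [Ring K] {M N : Type*}
  [AddCommGroup M] [Module Kᵐᵒᵖ M] [AddCommGroup N] [Module K N]

/-- The right action on the tensor product coming from a right action on the second factor. -/
def rightAct {B : Type*} [Ring B] [Module Bᵐᵒᵖ N] [SMulCommClass K Bᵐᵒᵖ N] (b : Bᵐᵒᵖ) :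
    BTensor K M N →+ BTensor K M N :=
  BTensor.map (AddMonoidHom.id M) (DistribSMul.toAddMonoidHom N b) (fun _ _ => rfl)
    (fun k n => (smul_comm k b n).symm)

/-- This makes `M ⊗_K T` a right `T`-module and `M ⊗_K A` a right `A`-module, the actions for which
the maps of the resolution of `A⁰` are linear. -/
instance BTensor.rightModule {B : Type*} [Ring B] [Module Bᵐᵒᵖ N] [SMulCommClass K Bᵐᵒᵖ N] :
    Module Bᵐᵒᵖ (BTensor K M N) where
  smul b z := rightAct b z
  one_smul z := DFunLike.congr_fun (f := rightAct (1 : Bᵐᵒᵖ)) (g := AddMonoidHom.id _)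
    (BTensor.hom_ext fun m n => congrArg (BTensor.tmul K m) (one_smul Bᵐᵒᵖ n)) z
  mul_smul b c z := DFunLike.congr_fun (f := rightAct (b * c))
    (g := (rightAct b).comp (rightAct c))
    (BTensor.hom_ext fun m n => congrArg (BTensor.tmul K m) (mul_smul b c n)) z
  smul_zero b := (rightAct b).map_zero
  smul_add b := (rightAct b).map_add
  add_smul b c z := DFunLike.congr_fun (f := rightAct (b + c)) (g := rightAct b + rightAct c)
    (BTensor.hom_ext fun m n =>
      (congrArg (BTensor.tmul K m) (add_smul b c n)).trans (BTensor.tmul_add _ _ _)) z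
  zero_smul z := DFunLike.congr_fun (f := rightAct (0 : Bᵐᵒᵖ)) (g := (0 : BTensor K M N →+ BTensor K M N))
    (BTensor.hom_ext fun m n =>
      (congrArg (BTensor.tmul K m) (zero_smul Bᵐᵒᵖ n)).trans (BTensor.tmul_zero _)) z

theorem BTensor.op_smul_tmul {B : Type*} [Ring B] [Module Bᵐᵒᵖ N] [SMulCommClass K Bᵐᵒᵖ N]
    (b : Bᵐᵒᵖ) (m : M) (n : N) : b • tmul K m n = tmul K m (b • n) := rfl

instance RingOver.smulCommMul {B : Type*} [Ring B] [RingOver K B] : SMulCommClass K Bᵐᵒᵖ B where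
  smul_comm k b c := by
    rw [RingOver.smul_eq, RingOver.smul_eq]
    exact (mul_assoc _ _ _).symm

end RightAction

/-! ### Dual bases of projective modules and their base change -/

/-- Generators with coordinate functions: every element `m` of the right module
`M` is the sum of the `e i · f m i`. -/
structure DualBasis (K : Type u) [Ring K] (M : Type v) [AddCommGroup M] [Module Kᵐᵒᵖ M] where
  /-- the index set -/
  ι : Type x
  /-- the generators -/
  e : ι → M
  /-- the coordinates -/
  f : M →+ ι →₀ K
  f_smul : ∀ (k : K) m i, f (op k • m) i = f m i * k
  sum_eq : ∀ m, ((f m).sum fun i k => op k • e i) = m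

/-- The dual basis of a projective module. -/
noncomputable def DualBasis.ofProjective (K : Type u) [Ring K] (M : Type v) [AddCommGroup M]
    [Module Kᵐᵒᵖ M] [h : Module.Projective Kᵐᵒᵖ M] : DualBasis.{u, v, v} K M :=
  let s : M →ₗ[Kᵐᵒᵖ] M →₀ Kᵐᵒᵖ := Classical.choose h.out
  have hs : Function.LeftInverse (Finsupp.linearCombination Kᵐᵒᵖ id) s := Classical.choose_spec h.out
  { ι := M
    e := id
    f := (Finsupp.mapRange.addMonoidHom (MulOpposite.opAddEquiv.symm.toAddMonoidHom :
      Kᵐᵒᵖ →+ K)).comp s.toAddMonoidHom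
    f_smul := fun k m i => by
      change (s (op k • m) i).unop = (s m i).unop * k
      rw [map_smul]
      rfl
    sum_eq := fun m => by
      refine Eq.trans ?_ (hs m)
      rw [Finsupp.linearCombination_apply]
      exact Finsupp.sum_mapRange_index (hf := map_zero _)
        (fun _ => by rw [op_zero, zero_smul]) }

/-- The dual basis of `M ⊗_K B` over `B`. -/
noncomputable def DualBasis.baseChange {K : Type u} [Ring K] {M : Type v} [AddCommGroup M]
    [Module Kᵐᵒᵖ M] (D : DualBasis.{u, v, x} K M) (B : Type w) [Ring B] [RingOver K B] :
    DualBasis.{w, max v w, x} B (BTensor K M B) where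
  ι := D.ι
  e i := BTensor.tmul K (D.e i) 1
  f := BTensor.lift
    (AddMonoidHom.mk' (fun m => AddMonoidHom.mk'
        (fun b => (D.f m).mapRange (fun k => (RingOver.hom k : B) * b) (by simp))
        (fun b b' => by ext i; simp [mul_add]))
      (fun m m' => by ext b i; simp [add_mul]))
    (fun m k b => by
      ext i
      simp [D.f_smul, RingOver.smul_eq, mul_assoc])
  f_smul b z i := by
    induction z using BTensor.induction with
    | h0 => simp
    | ht m c => simp [BTensor.op_smul_tmul, mul_assoc]
    | ha y z h1 h2 => simp only [smul_add, map_add, Finsupp.add_apply, h1, h2, add_mul]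
  sum_eq z := by
    induction z using BTensor.induction with
    | h0 => simp
    | ht m b =>
      simp only [BTensor.lift_tmul, AddMonoidHom.mk'_apply]
      rw [Finsupp.sum_mapRange_index (by simp)]
      conv_rhs => rw [← D.sum_eq m]
      rw [Finsupp.sum, Finsupp.sum, BTensor.sum_tmul]
      refine Finset.sum_congr rfl fun i _ => ?_
      rw [BTensor.op_smul_tmul, BTensor.smul_tmul, RingOver.smul_eq, op_smul_eq_mul, one_mul]
    | ha y z h1 h2 =>
      rw [map_add, Finsupp.sum_add_index' (by simp) (by simp [add_smul]), h1, h2]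

/-- The coordinates split the free cover given by the generators. Combined with
`DualBasis.baseChange` this shows that `M ⊗_K A` is projective over `A` if `M` is projective over
`K`. -/
theorem DualBasis.projective {K : Type u} [Ring K] {M : Type v} [AddCommGroup M]
    [Module Kᵐᵒᵖ M] (D : DualBasis.{u, v, x} K M) : Module.Projective Kᵐᵒᵖ M := by
  let s : M →ₗ[Kᵐᵒᵖ] D.ι →₀ Kᵐᵒᵖ :=
    { toFun := fun m => (D.f m).mapRange op op_zero
      map_add' := fun m m' => by ext i; simp
      map_smul' := fun k m => by
        ext i
        simpa using congrArg op (D.f_smul k.unop m i) }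
  refine Module.Projective.of_split s (Finsupp.linearCombination Kᵐᵒᵖ D.e) ?_
  ext m
  refine Eq.trans ?_ (D.sum_eq m)
  change Finsupp.linearCombination Kᵐᵒᵖ D.e ((D.f m).mapRange op op_zero) = _
  rw [Finsupp.linearCombination_apply, Finsupp.sum_mapRange_index (by simp)]

namespace TensorRing

/-! ### The grading of the tensor ring and its projections -/

section Basic

variable {K : Type u} [Ring K] {V : Type v} [AddCommGroup V] [Module K V] [Module Kᵐᵒᵖ V]

theorem smul_eq' (k : K) (x : TensorRing K V) : k • x = ofBase K V k * x := rfl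

theorem op_smul_eq' (k : K) (x : TensorRing K V) : op k • x = x * ofBase K V k := rfl

theorem ofBase_mem_gr (k : K) : ofBase K V k ∈ gr K V 0 := ⟨k, rfl⟩

theorem ι_mul_mem_gr {m : ℕ} (v : V) {y : TensorRing K V} (hy : y ∈ gr K V m) :
    ι K v * y ∈ gr K V (m + 1) :=
  AddSubgroup.subset_closure ⟨v, y, hy, rfl⟩

theorem one_mem_gr : (1 : TensorRing K V) ∈ gr K V 0 := ⟨1, map_one (ofBase K V)⟩

theorem ι_mem_gr (v : V) : ι K v ∈ gr K V 1 := by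
  simpa using ι_mul_mem_gr v (one_mem_gr (K := K) (V := V))

/-- Induction on homogeneous elements. -/
theorem gr_succ_induction {m : ℕ} {p : ∀ x, x ∈ gr K V (m + 1) → Prop}
    (hι : ∀ v, ∀ y, ∀ hy : y ∈ gr K V m, p (ι K v * y) (ι_mul_mem_gr v hy))
    (h0 : p 0 (zero_mem _))
    (hadd : ∀ a b ha hb, p a ha → p b hb → p (a + b) (add_mem ha hb))
    (hneg : ∀ a ha, p a ha → p (-a) (neg_mem ha)) {x : TensorRing K V}
    (hx : x ∈ gr K V (m + 1)) : p x hx := by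
  induction hx using AddSubgroup.closure_induction with
  | mem x hx =>
    obtain ⟨v, y, hy, rfl⟩ := hx
    exact hι v y hy
  | zero => exact h0
  | add a b ha hb h1 h2 => exact hadd a b ha hb h1 h2
  | neg a ha h => exact hneg a ha h

theorem mul_mem_gr {i j : ℕ} {x y : TensorRing K V} (hx : x ∈ gr K V i) (hy : y ∈ gr K V j) :
    x * y ∈ gr K V (i + j) := by
  induction i generalizing x with
  | zero =>
    obtain ⟨k, rfl⟩ := hx
    rw [zero_add]
    change ofBase K V k * y ∈ _
    cases j with
    | zero =>
      obtain ⟨l, rfl⟩ := hy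
      exact ⟨k * l, map_mul (ofBase K V) k l⟩
    | succ j =>
      induction hy using gr_succ_induction with
      | hι v y hy => rw [← mul_assoc, ← ι_smul]; exact ι_mul_mem_gr _ hy
      | h0 => rw [mul_zero]; exact zero_mem _
      | hadd a b _ _ h1 h2 => rw [mul_add]; exact add_mem h1 h2
      | hneg a _ h => rw [mul_neg]; exact neg_mem h
  | succ i ih =>
    rw [add_right_comm]
    induction hx using gr_succ_induction with
    | hι v x hx => rw [mul_assoc]; exact ι_mul_mem_gr _ (ih hx)
    | h0 => rw [zero_mul]; exact zero_mem _
    | hadd a b _ _ h1 h2 => rw [add_mul]; exact add_mem h1 h2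
    | hneg a _ h => rw [neg_mul]; exact neg_mem h

theorem mul_ι_mem_gr {m : ℕ} (v : V) {y : TensorRing K V} (hy : y ∈ gr K V m) :
    y * ι K v ∈ gr K V (m + 1) := mul_mem_gr hy (ι_mem_gr v)

theorem iSup_gr : ⨆ i, gr K V i = ⊤ := by
  suffices h : ∀ x, x ∈ ⨆ i, gr K V i from eq_top_iff.2 fun x _ => h x
  intro x
  have hle : ∀ i, gr K V i ≤ ⨆ i, gr K V i := le_iSup _
  induction x using TensorRing.induction with
  | hK k => exact hle 0 (ofBase_mem_gr k)
  | hV v => exact hle 1 (ι_mem_gr v)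
  | hmul a b h1 h2 =>
    induction h1 using AddSubgroup.iSup_induction' with
    | hp i a ha =>
      induction h2 using AddSubgroup.iSup_induction' with
      | hp j b hb => exact hle _ (mul_mem_gr ha hb)
      | h1 => rw [mul_zero]; exact zero_mem _
      | hadd b c _ _ h1 h2 => rw [mul_add]; exact add_mem h1 h2
    | h1 => rw [zero_mul]; exact zero_mem _
    | hadd b c _ _ h1 h2 => rw [add_mul]; exact add_mem h1 h2
  | hadd a b h1 h2 => exact add_mem h1 h2

@[elab_as_elim]
theorem gr_induction {p : TensorRing K V → Prop} (x : TensorRing K V)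
    (hgr : ∀ i, ∀ a ∈ gr K V i, p a) (hadd : ∀ a b, p a → p b → p (a + b)) : p x := by
  have hx : x ∈ ⨆ i, gr K V i := by rw [iSup_gr]; trivial
  exact AddSubgroup.iSup_induction _ (C := p) hx hgr (hgr 0 0 (zero_mem _)) hadd

theorem homog_ofBase (k : K) : homog K V (ofBase K V k) = Polynomial.C (ofBase K V k) :=
  lift_ofBase _ _ _ _ k

theorem homog_ι (v : V) : homog K V (ι K v) = Polynomial.C (ι K v) * Polynomial.X :=
  lift_ι _ _ _ _ v

/-- `homog` is multiplicative, so degrees can be read off as exponents. This makes the sum of the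
components direct without identifying them with tensor powers. -/
theorem homog_of_mem_gr {m : ℕ} {x : TensorRing K V} (hx : x ∈ gr K V m) :
    homog K V x = Polynomial.monomial m x := by
  induction m generalizing x with
  | zero =>
    obtain ⟨k, rfl⟩ := hx
    exact homog_ofBase k
  | succ m ih =>
    induction hx using gr_succ_induction with
    | hι v y hy =>
      rw [map_mul, homog_ι, ih hy, Polynomial.C_mul_X_eq_monomial,
        Polynomial.monomial_mul_monomial, add_comm]
    | h0 => simp
    | hadd a b _ _ h1 h2 => rw [map_add, h1, h2, map_add]
    | hneg a _ h => rw [map_neg, h, map_neg]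

theorem proj_apply (m : ℕ) (x : TensorRing K V) : proj K V m x = (homog K V x).coeff m := rfl

theorem proj_of_mem_gr {m : ℕ} {x : TensorRing K V} (hx : x ∈ gr K V m) (k : ℕ) :
    proj K V k x = if m = k then x else 0 := by
  rw [proj_apply, homog_of_mem_gr hx, Polynomial.coeff_monomial]

theorem proj_self {m : ℕ} {x : TensorRing K V} (hx : x ∈ gr K V m) : proj K V m x = x := by
  rw [proj_of_mem_gr hx, if_pos rfl]

theorem proj_of_ne {m k : ℕ} {x : TensorRing K V} (hx : x ∈ gr K V m) (h : m ≠ k) :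
    proj K V k x = 0 := by
  rw [proj_of_mem_gr hx, if_neg h]

theorem proj_mem_gr (m : ℕ) (x : TensorRing K V) : proj K V m x ∈ gr K V m := by
  induction x using gr_induction with
  | hgr i a ha =>
    rw [proj_of_mem_gr ha]
    split_ifs with h
    · exact h ▸ ha
    · exact zero_mem _
  | hadd a b h1 h2 => rw [map_add]; exact add_mem h1 h2

theorem proj_add_left_mul {i : ℕ} {x : TensorRing K V} (hx : x ∈ gr K V i) (m : ℕ)
    (y : TensorRing K V) : proj K V (m + i) (x * y) = x * proj K V m y := by
  rw [proj_apply, map_mul, homog_of_mem_gr hx, Polynomial.coeff_monomial_mul, proj_apply]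

theorem proj_add_mul_right {i : ℕ} {y : TensorRing K V} (hy : y ∈ gr K V i) (m : ℕ)
    (x : TensorRing K V) : proj K V (m + i) (x * y) = proj K V m x * y := by
  rw [proj_apply, map_mul, homog_of_mem_gr hy, Polynomial.coeff_mul_monomial, proj_apply]

/-- The sum of the homogeneous components is the element. -/
theorem eval_homog (x : TensorRing K V) : (homog K V x).eval 1 = x := by
  induction x using gr_induction with
  | hgr i a ha => rw [homog_of_mem_gr ha, Polynomial.eval_monomial, one_pow, mul_one]
  | hadd a b h1 h2 => rw [map_add, Polynomial.eval_add, h1, h2]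

theorem sum_proj {x : TensorRing K V} {N : ℕ} (h : ∀ m, N ≤ m → proj K V m x = 0) :
    ∑ m ∈ Finset.range N, proj K V m x = x := by
  conv_rhs => rw [← eval_homog x]
  rw [Polynomial.eval_eq_sum, Polynomial.sum_def]
  simp only [one_pow, mul_one]
  refine (Finset.sum_subset ?_ ?_).symm
  · intro m hm
    rw [Finset.mem_range]
    by_contra hN
    exact Polynomial.mem_support_iff.1 hm (h m (not_lt.1 hN))
  · intro m _ hm
    exact Polynomial.notMem_support_iff.1 hm

theorem eq_zero_of_proj {x : TensorRing K V} (h : ∀ m, proj K V m x = 0) : x = 0 := by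
  rw [← sum_proj (N := 0) (x := x) fun m _ => h m, Finset.sum_range_zero]

/-- The form in which the filtration is used below: bounds on the degree become vanishing of single
components. -/
theorem mem_filt_iff {m : ℕ} {x : TensorRing K V} :
    x ∈ filt K V m ↔ ∀ k, m < k → proj K V k x = 0 := by
  constructor
  · intro hx k hk
    have h : filt K V m ≤ (proj K V k : TensorRing K V →+ TensorRing K V).ker := by
      refine iSup₂_le fun i hi y hy => ?_
      exact proj_of_ne hy (by omega)
    exact h hx
  · intro h
    rw [← sum_proj (N := m + 1) h]
    refine sum_mem fun i hi => ?_
    exact (le_iSup₂_of_le (f := fun i (_ : i ≤ m) => gr K V i) i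
      (Nat.lt_succ_iff.1 (Finset.mem_range.1 hi)) le_rfl) (proj_mem_gr i x)

theorem exists_eq_ι {x : TensorRing K V} (hx : x ∈ gr K V 1) : ∃ v, x = ι K v := by
  induction hx using gr_succ_induction with
  | hι v y hy =>
    obtain ⟨k, rfl⟩ := hy
    exact ⟨op k • v, (ι_op_smul K k v).symm⟩
  | h0 => exact ⟨0, (map_zero _).symm⟩
  | hadd a b _ _ h1 h2 =>
    obtain ⟨v, rfl⟩ := h1
    obtain ⟨w, rfl⟩ := h2
    exact ⟨v + w, (map_add _ _ _).symm⟩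
  | hneg a _ h =>
    obtain ⟨v, rfl⟩ := h
    exact ⟨-v, (map_neg _ _).symm⟩

/-- The multiplication `V ⊗_K T → T`. -/
def mulV : BTensor K V (TensorRing K V) →+ TensorRing K V :=
  BTensor.lift (AddMonoidHom.mul.comp (ι K)) (fun v k x => by
    simp [ι_op_smul, smul_eq', mul_assoc])

@[simp]
theorem mulV_tmul (v : V) (x : TensorRing K V) : mulV (BTensor.tmul K v x) = ι K v * x := rfl

end Basic

/-! ### The decomposition of the tensor ring as `K ⊕ V ⊗_K T` -/

section Split

variable (K : Type u) [Ring K] (V : Type v) [AddCommGroup V] [Module K V] [Module Kᵐᵒᵖ V]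
  [SMulCommClass K Kᵐᵒᵖ V]

/-- The left action of `k ∈ K` on `K × V ⊗_K T`. -/
def baseEnd (k : K) : AddMonoid.End (K × BTensor K V (TensorRing K V)) :=
  AddMonoidHom.prodMap (AddMonoidHom.mulLeft k) (lsmul k)

/-- The left action of `v ∈ V` on `K × V ⊗_K T`. -/
def genEnd (v : V) : AddMonoid.End (K × BTensor K V (TensorRing K V)) :=
  (AddMonoidHom.inr K _).comp ((BTensor.tmulHom v).comp
    ((ofBase K V).toAddMonoidHom.coprod mulV))

variable {K V} in
theorem mulV_lsmul (k : K) (z : BTensor K V (TensorRing K V)) :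
    mulV (lsmul k z) = ofBase K V k * mulV z := by
  induction z using BTensor.induction with
  | h0 => simp
  | ht v x => simp [ι_smul, mul_assoc]
  | ha a b h1 h2 => simp [h1, h2, mul_add]

/-- The left action of `T` on `K × V ⊗_K T`. -/
def splitAct : TensorRing K V →+* AddMonoid.End (K × BTensor K V (TensorRing K V)) :=
  lift
    { toFun := baseEnd K V
      map_one' := by
        refine AddMonoidHom.ext fun z => Prod.ext (one_mul _) ?_
        change lsmul 1 z.2 = z.2
        induction z.2 using BTensor.induction with
        | h0 => simp
        | ht v x => simp
        | ha a b h1 h2 => simp [h1, h2]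
      map_mul' := fun k l => by
        refine AddMonoidHom.ext fun z => Prod.ext (mul_assoc _ _ _) ?_
        change lsmul (k * l) z.2 = lsmul k (lsmul l z.2)
        induction z.2 using BTensor.induction with
        | h0 => simp
        | ht v x => simp [mul_smul]
        | ha a b h1 h2 => simp [h1, h2]
      map_zero' := by
        refine AddMonoidHom.ext fun z => Prod.ext (zero_mul _) ?_
        change lsmul 0 z.2 = 0
        induction z.2 using BTensor.induction with
        | h0 => simp
        | ht v x => simp [BTensor.zero_tmul]
        | ha a b h1 h2 => simp [h1, h2]
      map_add' := fun k l => by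
        refine AddMonoidHom.ext fun z => Prod.ext (add_mul _ _ _) ?_
        change lsmul (k + l) z.2 = lsmul k z.2 + lsmul l z.2
        induction z.2 using BTensor.induction with
        | h0 => simp
        | ht v x => simp [add_smul, BTensor.add_tmul]
        | ha a b h1 h2 => simp only [map_add, h1, h2]; abel }
    (AddMonoidHom.mk' (genEnd K V) (fun v w => AddMonoidHom.ext fun z =>
      Prod.ext (add_zero 0).symm (BTensor.add_tmul _ _ _)))
    (fun k v => AddMonoidHom.ext fun z => Prod.ext (mul_zero k).symm rfl)
    -- The relation for `v k` holds because `genEnd` first joins its argument to an element of `T`,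
    -- and the joining map commutes with the left action of `k`.
    (fun k v => AddMonoidHom.ext fun z => Prod.ext rfl (by
      change BTensor.tmul K (op k • v) (ofBase K V z.1 + mulV z.2) =
        BTensor.tmul K v (ofBase K V (k * z.1) + mulV (lsmul k z.2))
      rw [BTensor.smul_tmul, smul_eq', map_mul, mulV_lsmul, mul_add]))

theorem splitAct_ofBase (k : K) (z) : splitAct K V (ofBase K V k) z = (k * z.1, lsmul k z.2) :=
  DFunLike.congr_fun (lift_ofBase _ _ _ _ k) z

theorem splitAct_ι (v : V) (z) :
    splitAct K V (ι K v) z = (0, BTensor.tmul K v (ofBase K V z.1 + mulV z.2)) :=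
  DFunLike.congr_fun (lift_ι _ _ _ _ v) z

/-- The decomposition `T = K ⊕ V ⊗_K T`. -/
def split : TensorRing K V →+ K × BTensor K V (TensorRing K V) :=
  AddMonoidHom.mk' (fun x => splitAct K V x (1, 0)) (fun x y => by rw [map_add]; rfl)

/-- The inverse `T⁺ → V ⊗_K T` of the multiplication, extended by zero to `K`. -/
def tail : TensorRing K V →+ BTensor K V (TensorRing K V) :=
  (AddMonoidHom.snd _ _).comp (split K V)

variable {K V}

/-- The joining map `(k, z) ↦ k + mulV z` is equivariant for the action of `T`. Evaluated at `(1,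
0)`, it shows that joining the two parts of `x` gives back `x`, and this determines the
decomposition of a product `v x`. -/
theorem join_splitAct (x : TensorRing K V) (z) :
    ofBase K V (splitAct K V x z).1 + mulV (splitAct K V x z).2 =
      x * (ofBase K V z.1 + mulV z.2) := by
  induction x using TensorRing.induction generalizing z with
  | hK k => rw [splitAct_ofBase, map_mul, mulV_lsmul, mul_add]
  | hV v => rw [splitAct_ι, map_zero, zero_add, mulV_tmul]
  | hmul a b h1 h2 =>
    rw [map_mul]
    change ofBase K V (splitAct K V a (splitAct K V b z)).1 +
      mulV (splitAct K V a (splitAct K V b z)).2 = _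
    rw [h1, h2, mul_assoc]
  | hadd a b h1 h2 =>
    rw [map_add, add_mul, ← h1, ← h2]
    change ofBase K V ((splitAct K V a z).1 + (splitAct K V b z).1) +
      mulV ((splitAct K V a z).2 + (splitAct K V b z).2) = _
    rw [map_add, map_add]
    abel

theorem split_ι_mul (v : V) (x : TensorRing K V) :
    split K V (ι K v * x) = (0, BTensor.tmul K v x) := by
  change splitAct K V (ι K v * x) (1, 0) = _
  rw [map_mul]
  change splitAct K V (ι K v) (splitAct K V x (1, 0)) = _
  rw [splitAct_ι, join_splitAct, map_one, map_zero, add_zero, mul_one]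

theorem tail_ι_mul (v : V) (x : TensorRing K V) : tail K V (ι K v * x) = BTensor.tmul K v x :=
  congrArg Prod.snd (split_ι_mul v x)

/-- In particular the multiplication `V ⊗_K T → T` is injective, which allows relations in `V ⊗_K A`
to be tested inside `T`. -/
theorem tail_mulV (z : BTensor K V (TensorRing K V)) : tail K V (mulV z) = z := by
  induction z using BTensor.induction with
  | h0 => simp
  | ht v x => rw [mulV_tmul, tail_ι_mul]
  | ha a b h1 h2 => rw [map_add, map_add, h1, h2]

theorem mulV_tail_of_mem_gr {m : ℕ} {x : TensorRing K V} (hx : x ∈ gr K V (m + 1)) :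
    mulV (tail K V x) = x := by
  induction hx using gr_succ_induction with
  | hι v y hy => rw [tail_ι_mul, mulV_tmul]
  | h0 => simp
  | hadd a b _ _ h1 h2 => rw [map_add, map_add, h1, h2]
  | hneg a _ h => rw [map_neg, map_neg, h]

end Split

end TensorRing

theorem exists_addEquiv_of_ker_eq {G H H' : Type*} [AddCommGroup G] [AddCommGroup H]
    [AddCommGroup H'] (f : G →+ H) (g : G →+ H') (hf : Function.Surjective f)
    (hg : Function.Surjective g) (h : ∀ x, f x = 0 ↔ g x = 0) :
    ∃ Φ : H ≃+ H', ∀ x, Φ (f x) = g x := by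
  have hk : f.ker = g.ker := by
    ext x
    exact h x
  refine ⟨(QuotientAddGroup.quotientKerEquivOfSurjective f hf).symm.trans
    ((QuotientAddGroup.quotientAddEquivOfEq hk).trans
      (QuotientAddGroup.quotientKerEquivOfSurjective g hg)), fun x => ?_⟩
  have : (QuotientAddGroup.quotientKerEquivOfSurjective f hf).symm (f x) =
      (QuotientAddGroup.mk x : G ⧸ f.ker) := by
    rw [AddEquiv.symm_apply_eq]
    rfl
  rw [AddEquiv.trans_apply, this]
  rfl

theorem QuotRing.mk_eq_zero_iff {B : Type*} [Ring B] {X : Set B} {b : B} :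
    QuotRing.mk X b = 0 ↔ b ∈ TwoSidedIdeal.span X :=
  RingCon.eq _

theorem mem_closure_of_mem_span {B : Type*} [Ring B] {X : Set B} {x : B}
    (hx : x ∈ TwoSidedIdeal.span X) :
    x ∈ AddSubgroup.closure {z : B | ∃ a, ∃ r ∈ X, ∃ b, z = a * r * b} := by
  rw [TwoSidedIdeal.mem_span_iff_mem_addSubgroup_closure] at hx
  refine AddSubgroup.closure_mono ?_ hx
  rintro _ h
  rw [Set.mem_mul] at h
  obtain ⟨_, h, b, _, rfl⟩ := h
  rw [Set.mem_mul] at h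
  obtain ⟨a, _, r, hr, rfl⟩ := h
  exact ⟨a, r, hr, b, rfl⟩

/-! ### Ideals generated by homogeneous elements -/

namespace TensorRing

variable {K : Type u} [Ring K] {V : Type v} [AddCommGroup V] [Module K V] [Module Kᵐᵒᵖ V]

/-- The component of degree `m` of the ideal generated by a set of elements of degree `n`. -/
def idealGr (X : Set (TensorRing K V)) (n m : ℕ) : AddSubgroup (TensorRing K V) :=
  AddSubgroup.closure {z | ∃ i j, i + j + n = m ∧ ∃ a ∈ gr K V i, ∃ r ∈ X, ∃ b ∈ gr K V j,
    z = a * r * b}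

/-- The generators are homogeneous, so splitting the outer factors into components splits an element
of the ideal within the ideal. -/
theorem proj_mem_idealGr {X : Set (TensorRing K V)} {n : ℕ} (hX : ∀ r ∈ X, r ∈ gr K V n)
    {x : TensorRing K V} (hx : x ∈ TwoSidedIdeal.span X) (m : ℕ) :
    proj K V m x ∈ idealGr X n m := by
  replace hx := mem_closure_of_mem_span hx
  induction hx using AddSubgroup.closure_induction with
  | mem x hx =>
    obtain ⟨a, r, hr, b, rfl⟩ := hx
    induction a using gr_induction with
    | hgr i a ha =>
      induction b using gr_induction with
      | hgr j b hb =>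
        have h := mul_mem_gr (mul_mem_gr ha (hX r hr)) hb
        rw [proj_of_mem_gr h]
        split_ifs with hm
        · exact AddSubgroup.subset_closure ⟨i, j, by omega, a, ha, r, hr, b, hb, rfl⟩
        · exact zero_mem _
      | hadd b c h1 h2 => rw [mul_add, map_add]; exact add_mem h1 h2
    | hadd b c h1 h2 => rw [add_mul, add_mul, map_add]; exact add_mem h1 h2
  | zero => rw [map_zero]; exact zero_mem _
  | add a b _ _ h1 h2 => rw [map_add]; exact add_mem h1 h2
  | neg a _ h => rw [map_neg]; exact neg_mem h

theorem idealGr_eq_zero {X : Set (TensorRing K V)} {n m : ℕ} (hm : m < n) {x : TensorRing K V}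
    (hx : x ∈ idealGr X n m) : x = 0 := by
  have h : idealGr X n m ≤ ⊥ := by
    rw [idealGr, AddSubgroup.closure_le]
    rintro _ ⟨i, j, h, -⟩
    omega
  exact h hx

/-- In degree `n` both outer factors have degree zero, hence come from `K`, and `R` is a
subbimodule. -/
theorem mem_of_mem_idealGr_self {R : SubBimodule K (TensorRing K V)} {n : ℕ}
    {x : TensorRing K V} (hx : x ∈ idealGr (R : Set (TensorRing K V)) n n) : x ∈ R := by
  induction hx using AddSubgroup.closure_induction with
  | mem x hx =>
    obtain ⟨i, j, h, a, ha, r, hr, b, hb, rfl⟩ := hx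
    obtain ⟨rfl, rfl⟩ : i = 0 ∧ j = 0 := by omega
    obtain ⟨k, rfl⟩ := ha
    obtain ⟨l, rfl⟩ := hb
    exact R.right_mem l (R.left_mem k hr)
  | zero => exact zero_mem _
  | add a b _ _ h1 h2 => exact add_mem h1 h2
  | neg a _ h => exact neg_mem h

theorem mem_idealGr_of_mem_span {X : Set (TensorRing K V)} {n m : ℕ}
    (hX : ∀ r ∈ X, r ∈ gr K V n) {x : TensorRing K V} (hx : x ∈ TwoSidedIdeal.span X)
    (hm : x ∈ gr K V m) : x ∈ idealGr X n m := by
  rw [← proj_self hm]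
  exact proj_mem_idealGr hX hx m

end TensorRing

open TensorRing

/-! ### The PBW property as a condition on leading components -/

section PBW

variable {K : Type u} [Ring K] {V : Type v} [AddCommGroup V] [Module K V] [Module Kᵐᵒᵖ V]

/-- Asking for vanishing in the degrees `m ≤ k` describes the step `m - 1` of the filtration
uniformly, including the zero step for `m = 0`. -/
theorem mem_quotFiltPred_iff {X : Set (TensorRing K V)} {m : ℕ} {y : QuotRing X} :
    y ∈ quotFiltPred X m ↔ ∃ t, (∀ k, m ≤ k → proj K V k t = 0) ∧ QuotRing.mk X t = y := by
  cases m with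
  | zero =>
    constructor
    · intro h
      exact ⟨0, fun _ _ => map_zero _, (map_zero _).trans (AddSubgroup.mem_bot.1 h).symm⟩
    · rintro ⟨t, ht, rfl⟩
      rw [eq_zero_of_proj fun k => ht k (Nat.zero_le k), map_zero]
      exact zero_mem _
  | succ m =>
    constructor
    · rintro ⟨t, ht, rfl⟩
      exact ⟨t, mem_filt_iff.1 ht, rfl⟩
    · rintro ⟨t, ht, rfl⟩
      exact ⟨t, mem_filt_iff.2 ht, rfl⟩

/-- PBW-deformations in terms of leading components of the elements of the ideal. -/
theorem isPBWDeformation_iff {R P : Set (TensorRing K V)} :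
    IsPBWDeformation R P ↔ ∀ m, ∀ t ∈ gr K V m, (t ∈ TwoSidedIdeal.span R ↔
      ∃ t', (∀ k, m ≤ k → proj K V k t' = 0) ∧ t - t' ∈ TwoSidedIdeal.span P) := by
  have hinit : ∀ m (t : gr K V m), initClass P m t = 0 ↔
      ∃ t', (∀ k, m ≤ k → proj K V k t' = 0) ∧
        (t : TensorRing K V) - t' ∈ TwoSidedIdeal.span P := by
    intro m t
    rw [initClass, QuotientAddGroup.eq_zero_iff, AddSubgroup.mem_addSubgroupOf,
      mem_quotFiltPred_iff]
    refine exists_congr fun t' => and_congr_right fun _ => ?_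
    rw [← QuotRing.mk_eq_zero_iff, map_sub, sub_eq_zero]
    exact eq_comm
  refine forall_congr' fun m => ?_
  constructor
  · rintro ⟨Φ, hΦ⟩ t ht
    rw [← hinit m ⟨t, ht⟩, ← hΦ, map_eq_zero_iff Φ Φ.injective, ← QuotRing.mk_eq_zero_iff]
    exact ⟨fun h => Subtype.ext h, fun h => congrArg Subtype.val h⟩
  · intro h
    let f : gr K V m →+ quotGr R m :=
      AddMonoidHom.mk' (fun t => ⟨QuotRing.mk R t, AddSubgroup.mem_map_of_mem _ t.2⟩)
        (fun t t' => Subtype.ext (map_add (QuotRing.mk R) (t : TensorRing K V) t'))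
    let g : gr K V m →+ AssocGr P m :=
      AddMonoidHom.mk' (initClass P m) (fun t t' => congrArg QuotientAddGroup.mk
        (Subtype.ext (map_add (QuotRing.mk P) (t : TensorRing K V) t')))
    -- Both sides are quotients of `T^m`, so an isomorphism compatible with the two projections
    -- exists as soon as the kernels agree.
    refine exists_addEquiv_of_ker_eq f g ?_ ?_ ?_
    · rintro ⟨_, t, ht, rfl⟩
      exact ⟨⟨t, ht⟩, rfl⟩
    · intro y
      obtain ⟨⟨_, t, ht, rfl⟩, rfl⟩ := QuotientAddGroup.mk_surjective y
      -- A class in `gr^m U` is represented by the component of degree `m`, since the other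
      -- components of `t` have lower degree.
      refine ⟨⟨proj K V m t, proj_mem_gr m t⟩, ?_⟩
      refine (QuotientAddGroup.eq).2 ?_
      rw [AddSubgroup.mem_addSubgroupOf, mem_quotFiltPred_iff]
      refine ⟨t - proj K V m t, fun k hk => ?_, ?_⟩
      · rw [map_sub, proj_of_mem_gr (proj_mem_gr m t)]
        split_ifs with hmk
        · rw [hmk, sub_self]
        · rw [sub_zero]
          exact mem_filt_iff.1 ht k (by omega)
      · rw [map_sub, sub_eq_neg_add]
        rfl
    · intro t
      change f t = 0 ↔ initClass P m t = 0
      rw [hinit, ← h t t.2, ← QuotRing.mk_eq_zero_iff]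
      exact ⟨fun h => congrArg Subtype.val h, fun h => Subtype.ext h⟩

end PBW

open TensorRing

/-! ### The Jacobi conditions, and their necessity -/

section Jacobi

variable {S : Type u} [Ring S] {W : Type v} [AddCommGroup W] [Module S W] [Module Sᵐᵒᵖ W]
  {R : SubBimodule S (TensorRing S W)}

theorem proj_zero_leftTensor (f : BimoduleHom S R (TensorRing S W)) (y : BTensor S W R) :
    proj S W 0 (leftTensor f y) = 0 := by
  induction y using BTensor.induction with
  | h0 => simp
  | ht w r => rw [leftTensor_tmul, proj_apply, map_mul, homog_ι]; simp [mul_assoc]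
  | ha a b h1 h2 => rw [map_add, map_add, h1, h2, add_zero]

theorem proj_zero_rightTensor (f : BimoduleHom S R (TensorRing S W)) (z : BTensor S R W) :
    proj S W 0 (rightTensor f z) = 0 := by
  induction z using BTensor.induction with
  | h0 => simp
  | ht r w => rw [rightTensor_tmul, proj_apply, map_mul, homog_ι]; simp [← mul_assoc]
  | ha a b h1 h2 => rw [map_add, map_add, h1, h2, add_zero]

/-- `W` has degree one, which causes the shift by one: as `α_i` takes values in degree `n - i`, the
element `ϑ_i` lies in degree `n + 1 - i`. -/
theorem proj_succ_leftTensor {f g : BimoduleHom S R (TensorRing S W)} {k : ℕ}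
    (h : ∀ r, proj S W k (f r) = g r) (y : BTensor S W R) :
    proj S W (k + 1) (leftTensor f y) = leftTensor g y := by
  induction y using BTensor.induction with
  | h0 => simp
  | ht w r => rw [leftTensor_tmul, proj_add_left_mul (ι_mem_gr w), h, leftTensor_tmul]
  | ha a b h1 h2 => rw [map_add, map_add, map_add, h1, h2]

theorem proj_succ_rightTensor {f g : BimoduleHom S R (TensorRing S W)} {k : ℕ}
    (h : ∀ r, proj S W k (f r) = g r) (z : BTensor S R W) :
    proj S W (k + 1) (rightTensor f z) = rightTensor g z := by
  induction z using BTensor.induction with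
  | h0 => simp
  | ht r w => rw [rightTensor_tmul, proj_add_mul_right (ι_mem_gr w), h, rightTensor_tmul]
  | ha a b h1 h2 => rw [map_add, map_add, map_add, h1, h2]

theorem proj_succ_leftTensor_eq_zero {f : BimoduleHom S R (TensorRing S W)} {k : ℕ}
    (h : ∀ r, proj S W k (f r) = 0) (y : BTensor S W R) :
    proj S W (k + 1) (leftTensor f y) = 0 := by
  induction y using BTensor.induction with
  | h0 => simp
  | ht w r => rw [leftTensor_tmul, proj_add_left_mul (ι_mem_gr w), h, mul_zero]
  | ha a b h1 h2 => rw [map_add, map_add, h1, h2, add_zero]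

theorem proj_succ_rightTensor_eq_zero {f : BimoduleHom S R (TensorRing S W)} {k : ℕ}
    (h : ∀ r, proj S W k (f r) = 0) (z : BTensor S R W) :
    proj S W (k + 1) (rightTensor f z) = 0 := by
  induction z using BTensor.induction with
  | h0 => simp
  | ht r w => rw [rightTensor_tmul, proj_add_mul_right (ι_mem_gr w), h, zero_mul]
  | ha a b h1 h2 => rw [map_add, map_add, h1, h2, add_zero]

/-- The Jacobi conditions say that `(W ⊗ α)(y) - (α ⊗ W)(z)` lies in the image of `α`. -/
theorem satisfiesJacobi_iff {n : ℕ} (hn : 1 ≤ n) {α : BimoduleHom S R (TensorRing S W)}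
    (hRn : ∀ r ∈ R, r ∈ gr S W n) (hα : IsFilteredMorphism α) :
    SatisfiesJacobi n α ↔ ∀ (y : BTensor S W R) (z : BTensor S R W),
      leftTensor R.incl y = rightTensor R.incl z →
        ∃ ρ : R, leftTensor α y - rightTensor α z = α ρ := by
  have h0 : ∀ r : R, proj S W n (α r) = r := fun r => hα.comp_zero n r (hRn r r.2)
  have hbig : ∀ k, n < k → ∀ r : R, proj S W k (α r) = 0 := fun k hk r =>
    mem_filt_iff.1 (hα.filtered n r (hRn r r.2)) k hk
  have hc : ∀ (i k : ℕ), k + i = n → ∀ r : R, proj S W k (α r) = component n α i r := by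
    rintro i k rfl r
    change _ = proj S W (k + i - i) (α r)
    rw [Nat.add_sub_cancel]
  refine forall_congr' fun y => forall_congr' fun z => forall_congr' fun e => ?_
  set T := leftTensor α y - rightTensor α z with hT
  have p0 : proj S W 0 T = 0 := by
    rw [hT, map_sub, proj_zero_leftTensor, proj_zero_rightTensor, sub_zero]
  -- The leading terms cancel because `y` and `z` have the same image in `T`.
  have ptop : proj S W (n + 1) T = 0 := by
    rw [hT, map_sub, proj_succ_leftTensor (g := R.incl) h0, proj_succ_rightTensor (g := R.incl) h0,
      e, sub_self]
  have pbig : ∀ k, n < k → proj S W k T = 0 := by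
    intro k hk
    rcases (show k = n + 1 ∨ ∃ j, k = j + 1 ∧ n < j by
      rcases k with _ | k
      · omega
      · rcases Nat.lt_or_ge n k with h | h
        · exact Or.inr ⟨k, rfl, h⟩
        · exact Or.inl (by omega)) with rfl | ⟨j, rfl, hj⟩
    · exact ptop
    · rw [hT, map_sub, proj_succ_leftTensor_eq_zero (hbig j hj),
        proj_succ_rightTensor_eq_zero (hbig j hj), sub_zero]
  -- The component of degree `n + 1 - i` of `T` is `ϑ_i`; in particular `ϑ₁` is its component of
  -- degree `n`.
  have pi : ∀ i k, k + i = n → proj S W (k + 1) T =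
      leftTensor (component n α i) y - rightTensor (component n α i) z := by
    intro i k h
    rw [hT, map_sub, proj_succ_leftTensor (hc i k h), proj_succ_rightTensor (hc i k h)]
  have p1 := pi 1 (n - 1) (by omega)
  rw [Nat.sub_add_cancel hn] at p1
  constructor
  · rintro ⟨h, hi, hlast⟩
    refine ⟨⟨_, h⟩, ?_⟩
    rw [← sub_eq_zero]
    refine eq_zero_of_proj fun k => ?_
    rw [map_sub, sub_eq_zero]
    -- Here `ρ = ϑ₁`. Degree zero is the last Jacobi condition, degrees `0 < k < n` are the
    -- condition with index `n - k`, degree `n` holds as `p^n ∘ α` is the inclusion, and above `n`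
    -- both sides vanish.
    rcases lt_trichotomy k n with hk | rfl | hk
    · rcases k with _ | k
      · rw [p0, hc n 0 (by omega), hlast]
      · rw [hc (n - (k + 1)) (k + 1) (by omega), hi _ (by omega) (by omega)]
        exact pi _ _ (by omega)
    · rw [h0, p1]
    · rw [pbig k hk, hbig k hk]
  · rintro ⟨ρ, hρ⟩
    -- Comparing the components of degree `n` forces `ρ = ϑ₁`. The remaining components then give
    -- the Jacobi conditions.
    have hρ1 : leftTensor (component n α 1) y - rightTensor (component n α 1) z = ρ := by
      rw [← p1, hρ, h0]
    have hmem : leftTensor (component n α 1) y - rightTensor (component n α 1) z ∈ R :=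
      hρ1 ▸ ρ.2
    have hsub : (⟨_, hmem⟩ : R) = ρ := Subtype.ext hρ1
    refine ⟨hmem, ?_, ?_⟩
    · intro i hi hin
      rw [hsub, ← hc i (n - i) (by omega), ← hρ, ← pi (i + 1) (n - (i + 1)) (by omega)]
      congr 2
      omega
    · rw [hsub, ← hc n 0 (by omega), ← hρ, p0]

theorem leftTensor_mem_span {P : SubBimodule S (TensorRing S W)}
    {α : BimoduleHom S R (TensorRing S W)} (h : ∀ r, α r ∈ P) (y : BTensor S W R) :
    leftTensor α y ∈ TwoSidedIdeal.span (P : Set (TensorRing S W)) := by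
  induction y using BTensor.induction with
  | h0 => rw [map_zero]; exact zero_mem _
  | ht w r => exact TwoSidedIdeal.mul_mem_left _ _ _ (TwoSidedIdeal.subset_span (h r))
  | ha a b h1 h2 => rw [map_add]; exact add_mem h1 h2

theorem rightTensor_mem_span {P : SubBimodule S (TensorRing S W)}
    {α : BimoduleHom S R (TensorRing S W)} (h : ∀ r, α r ∈ P) (z : BTensor S R W) :
    rightTensor α z ∈ TwoSidedIdeal.span (P : Set (TensorRing S W)) := by
  induction z using BTensor.induction with
  | h0 => rw [map_zero]; exact zero_mem _
  | ht w r => exact TwoSidedIdeal.mul_mem_right _ _ _ (TwoSidedIdeal.subset_span (h w))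
  | ha a b h1 h2 => rw [map_add]; exact add_mem h1 h2

/-- The leading components of elements of `⟨P⟩` lie in `⟨R⟩`, which vanishes below degree `n` and is
`R` in degree `n`. So `p^n` is injective on `P` and `α` is its inverse; moreover every element of
`⟨P⟩` of degree at most `n` lies in `P`. The element `(W ⊗ α)(y) - (α ⊗ W)(z)` is of this kind, its
terms of degree `n + 1` having cancelled. -/
theorem exists_jacobi_of_isPBWDeformation {n : ℕ} (hn : 1 ≤ n) (hRn : ∀ r ∈ R, r ∈ gr S W n)
    (P : SubBimodule S (TensorRing S W)) (hP : ∀ p ∈ P, p ∈ filt S W n)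
    (hPR : ∀ y, y ∈ R ↔ ∃ p ∈ P, proj S W n p = y)
    (h : IsPBWDeformation (R : Set (TensorRing S W)) (P : Set (TensorRing S W))) :
    ∃ α : BimoduleHom S R (TensorRing S W), IsFilteredMorphism α ∧ SatisfiesJacobi n α ∧
      ∀ y, y ∈ P ↔ ∃ r, α r = y := by
  rw [isPBWDeformation_iff] at h
  have hlead : ∀ m x, x ∈ TwoSidedIdeal.span (P : Set (TensorRing S W)) →
      (∀ k, m < k → proj S W k x = 0) →
      proj S W m x ∈ idealGr (R : Set (TensorRing S W)) n m := by
    intro m x hx hk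
    -- The criterion is applied with `t' = p^m(x) - x`, which has degree less than `m` and differs
    -- from `p^m(x)` by the element `x` of the ideal.
    refine mem_idealGr_of_mem_span hRn ((h m _ (proj_mem_gr m x)).2
      ⟨proj S W m x - x, fun k hmk => ?_, by rwa [sub_sub_cancel]⟩) (proj_mem_gr m x)
    rw [map_sub, proj_of_mem_gr (proj_mem_gr m x)]
    split_ifs with e
    · rw [e, sub_self]
    · rw [hk k (by omega), sub_zero]
  have hlow : ∀ m ≤ n, ∀ x ∈ TwoSidedIdeal.span (P : Set (TensorRing S W)),
      (∀ k, m ≤ k → proj S W k x = 0) → x = 0 := by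
    intro m
    induction m with
    | zero => exact fun _ x _ hk => eq_zero_of_proj fun k => hk k (Nat.zero_le k)
    | succ m ih =>
      intro hm x hx hk
      refine ih (by omega) x hx fun k hmk => ?_
      rcases hmk.eq_or_lt with rfl | hlt
      · exact idealGr_eq_zero hm (hlead m x hx fun k h => hk k h)
      · exact hk k hlt
  have hmem : ∀ x ∈ TwoSidedIdeal.span (P : Set (TensorRing S W)),
      (∀ k, n < k → proj S W k x = 0) → x ∈ P := by
    intro x hx hk
    obtain ⟨p, hp, hpx⟩ := (hPR _).1 (mem_of_mem_idealGr_self (hlead n x hx hk))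
    have : x - p = 0 := by
      refine hlow n le_rfl _ (sub_mem hx (TwoSidedIdeal.subset_span hp)) fun k hnk => ?_
      rw [map_sub]
      rcases hnk.eq_or_lt with rfl | hlt
      · rw [hpx, sub_self]
      · rw [hk k hlt, mem_filt_iff.1 (hP p hp) k hlt, sub_zero]
    rw [sub_eq_zero.1 this]
    exact hp
  have hinj : ∀ p ∈ P, ∀ q ∈ P, proj S W n p = proj S W n q → p = q := by
    intro p hp q hq e
    rw [← sub_eq_zero]
    refine hlow n le_rfl _ (TwoSidedIdeal.subset_span (sub_mem hp hq)) fun k hnk => ?_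
    rw [map_sub]
    rcases hnk.eq_or_lt with rfl | hlt
    · rw [e, sub_self]
    · rw [mem_filt_iff.1 (hP p hp) k hlt, mem_filt_iff.1 (hP q hq) k hlt, sub_zero]
  choose a ha hpa using fun r : R => (hPR r).1 r.2
  let α : BimoduleHom S R (TensorRing S W) :=
    { toFun := a
      map_zero' := hinj _ (ha 0) _ (zero_mem P) (by rw [hpa, map_zero]; rfl)
      map_add' := fun r r' => hinj _ (ha _) _ (add_mem (ha r) (ha r'))
        (by rw [map_add, hpa, hpa, hpa]; rfl)
      map_smul' := fun k r => hinj _ (ha _) _ (P.left_mem k (ha r))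
        (by rw [BimoduleHom.map_smul, hpa, hpa]; rfl)
      map_op_smul' := fun k r => hinj _ (ha _) _ (P.right_mem k (ha r))
        (by rw [BimoduleHom.map_op_smul, hpa, hpa]; rfl) }
  have hαa : ∀ r, α r = a r := fun _ => rfl
  have himage : ∀ y, y ∈ P ↔ ∃ r, α r = y := by
    intro y
    constructor
    · intro hy
      exact ⟨⟨proj S W n y, (hPR _).2 ⟨y, hy, rfl⟩⟩, hinj _ (ha _) _ hy (hpa _)⟩
    · rintro ⟨r, rfl⟩
      exact ha r
  have hfil : IsFilteredMorphism α := by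
    -- `R` sits in degree `n`, so for any other `m` the conditions on a filtered morphism concern
    -- only zero.
    have hdeg : ∀ (m : ℕ) (r : R), (r : TensorRing S W) ∈ gr S W m → m = n ∨ r = 0 := by
      intro m r hr
      by_contra! hne
      exact hne.2 (Subtype.ext ((proj_self (hRn r r.2)).symm.trans (proj_of_ne hr hne.1)))
    constructor
    · intro m r hr
      rcases hdeg m r hr with rfl | rfl
      · exact hP _ (ha r)
      · rw [map_zero]; exact zero_mem _
    · intro m r hr
      rcases hdeg m r hr with rfl | rfl
      · exact hpa r
      · rw [map_zero, map_zero]; rfl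
  refine ⟨α, hfil, (satisfiesJacobi_iff hn hRn hfil).2 fun y z e => ?_, himage⟩
  have hdeg : ∀ k, n < k → proj S W k (leftTensor α y - rightTensor α z) = 0 := by
    intro k hk
    obtain ⟨j, rfl⟩ : ∃ j, k = j + 1 := ⟨k - 1, by omega⟩
    rcases (Nat.lt_succ_iff.1 hk).eq_or_lt with rfl | hj
    · rw [map_sub, proj_succ_leftTensor (g := R.incl) hpa,
        proj_succ_rightTensor (g := R.incl) hpa, e, sub_self]
    · have hz : ∀ r, proj S W j (α r) = 0 := fun r => mem_filt_iff.1 (hP _ (ha r)) j hj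
      rw [map_sub, proj_succ_leftTensor_eq_zero hz, proj_succ_rightTensor_eq_zero hz, sub_zero]
  obtain ⟨ρ, hρ⟩ := (himage _).1 (hmem _
    (sub_mem (leftTensor_mem_span ha y) (rightTensor_mem_span ha z)) hdeg)
  exact ⟨ρ, hρ.symm⟩

end Jacobi

open TensorRing

/-! ### Degree bounds for products -/

section Degrees

variable {S : Type u} [Ring S] {W : Type v} [AddCommGroup W] [Module S W] [Module Sᵐᵒᵖ W]

theorem proj_left_mul_eq_zero {i c : ℕ} {a y : TensorRing S W} (ha : a ∈ gr S W i)
    (hy : ∀ k, c ≤ k → proj S W k y = 0) {k : ℕ} (hk : c + i ≤ k) : proj S W k (a * y) = 0 := by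
  obtain ⟨l, rfl⟩ : ∃ l, k = l + i := ⟨k - i, by omega⟩
  rw [proj_add_left_mul ha, hy l (by omega), mul_zero]

theorem proj_mul_right_eq_zero {i c : ℕ} {a y : TensorRing S W} (ha : a ∈ gr S W i)
    (hy : ∀ k, c ≤ k → proj S W k y = 0) {k : ℕ} (hk : c + i ≤ k) : proj S W k (y * a) = 0 := by
  obtain ⟨l, rfl⟩ : ∃ l, k = l + i := ⟨k - i, by omega⟩
  rw [proj_add_mul_right ha, hy l (by omega), zero_mul]

end Degrees

/-! ### Syzygies of the relations -/

section Syzygies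

variable {S : Type u} [Ring S] {W : Type v} [AddCommGroup W] [Module S W] [Module Sᵐᵒᵖ W]
  (R : SubBimodule S (TensorRing S W))

/-- For `f : R → T`, the map `R ⊗_S T → T`, `r ⊗ x ↦ f(r) x`. -/
def mulR {R : SubBimodule S (TensorRing S W)} (f : BimoduleHom S R (TensorRing S W)) :
    BTensor S R (TensorRing S W) →+ TensorRing S W :=
  BTensor.lift (AddMonoidHom.mul.comp (f : R →+ TensorRing S W)) (fun r s x => by
    change f (op s • r) * x = f r * (s • x)
    rw [BimoduleHom.map_op_smul, smul_eq', op_smul_eq', mul_assoc])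

@[simp]
theorem mulR_tmul {R : SubBimodule S (TensorRing S W)} (f : BimoduleHom S R (TensorRing S W))
    (r : R) (x : TensorRing S W) : mulR f (BTensor.tmul S r x) = f r * x := rfl

/-- Multiplication of `R ⊗_S W` by an element of `T` from the right, with values in `R ⊗_S T`. -/
def extendR (x : TensorRing S W) : BTensor S R W →+ BTensor S R (TensorRing S W) :=
  BTensor.map (AddMonoidHom.id _) ((AddMonoidHom.mulRight x).comp (ι S)) (fun _ _ => rfl)
    (fun s w => by
      change ι S (s • w) * x = ofBase S W s * (ι S w * x)
      rw [ι_smul, mul_assoc])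

@[simp]
theorem extendR_tmul (x : TensorRing S W) (r : R) (w : W) :
    extendR R x (BTensor.tmul S r w) = BTensor.tmul S r (ι S w * x) := rfl

theorem mulR_extendR {R : SubBimodule S (TensorRing S W)}
    (f : BimoduleHom S R (TensorRing S W)) (x : TensorRing S W) (z : BTensor S R W) :
    mulR f (extendR R x z) = rightTensor f z * x := by
  induction z using BTensor.induction with
  | h0 => simp
  | ht r w => simp [mul_assoc]
  | ha a b h1 h2 => simp only [map_add, h1, h2, add_mul]

/-- The projection of `R ⊗_S T` to `R ⊗_S T^k`. -/
noncomputable def projR (k : ℕ) : BTensor S R (TensorRing S W) →+ BTensor S R (TensorRing S W) :=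
  BTensor.map (AddMonoidHom.id _) (proj S W k : TensorRing S W →+ TensorRing S W)
    (fun _ _ => rfl) (fun s x => (proj S W k).map_smul s x)

@[simp]
theorem projR_tmul (k : ℕ) (r : R) (x : TensorRing S W) :
    projR R k (BTensor.tmul S r x) = BTensor.tmul S r (proj S W k x) := rfl

theorem projR_succ_extendR (k : ℕ) (x : TensorRing S W) (z : BTensor S R W) :
    projR R (k + 1) (extendR R x z) = extendR R (proj S W k x) z := by
  induction z using BTensor.induction with
  | h0 => simp
  | ht r w => rw [extendR_tmul, projR_tmul, proj_add_left_mul (ι_mem_gr w), extendR_tmul]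
  | ha a b h1 h2 => simp only [map_add, h1, h2]

theorem projR_zero_extendR (x : TensorRing S W) (z : BTensor S R W) :
    projR R 0 (extendR R x z) = 0 := by
  induction z using BTensor.induction with
  | h0 => simp
  | ht r w =>
    have h : proj S W 0 (ι S w * x) = 0 := by
      rw [proj_apply, map_mul, homog_ι]; simp [mul_assoc]
    rw [extendR_tmul, projR_tmul, h, BTensor.tmul_zero]
  | ha a b h1 h2 => rw [map_add, map_add, h1, h2, add_zero]

/-- `W · ⟨R⟩ ⊆ T`. -/
def idealV : AddSubgroup (TensorRing S W) :=
  AddSubgroup.closure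
    {z | ∃ w : W, ∃ x ∈ TwoSidedIdeal.span (R : Set (TensorRing S W)), z = ι S w * x}

/-- The obvious syzygies in `R ⊗_S T`. -/
def syzygies : AddSubgroup (BTensor S R (TensorRing S W)) :=
  AddSubgroup.closure
    ({σ | ∃ (y : BTensor S W R) (z : BTensor S R W), leftTensor R.incl y = rightTensor R.incl z ∧
      ∃ b, σ = extendR R b z} ∪
    {σ | ∃ r : R, ∃ x ∈ TwoSidedIdeal.span (R : Set (TensorRing S W)), σ = BTensor.tmul S r x})

/-- The kernel of `R ⊗ T → T / W⟨R⟩` consists of the obvious syzygies. -/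
def HasLinearSyzygies : Prop :=
  ∀ σ : BTensor S R (TensorRing S W), mulR R.incl σ ∈ idealV R → σ ∈ syzygies R

end Syzygies

/-! ### Lifting the ideal `⟨R⟩` along `α` -/

section Deformation

variable {S : Type u} [Ring S] {W : Type v} [AddCommGroup W] [Module S W] [Module Sᵐᵒᵖ W]
  {R : SubBimodule S (TensorRing S W)} (α : BimoduleHom S R (TensorRing S W))

/-- The relation between `⟨R⟩ ∩ T^m` and its lift by `α`, generated by the pairs
`(a r b, a α(r) b)`. -/
def liftRel (n m : ℕ) : AddSubgroup (TensorRing S W × TensorRing S W) :=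
  AddSubgroup.closure {z | ∃ i j, i + j + n = m ∧ ∃ a ∈ gr S W i, ∃ r : R, ∃ b ∈ gr S W j,
    z = (a * r * b, a * α r * b)}

/-- The elements of the ideal `⟨α(R)⟩` which are visibly of degree less than `m`. -/
def lowerIdeal (n m : ℕ) : AddSubgroup (TensorRing S W) :=
  AddSubgroup.closure {z | ∃ i j, i + j + n < m ∧ ∃ a ∈ gr S W i, ∃ r : R, ∃ b ∈ gr S W j,
    z = a * α r * b}

/-- The pairs `(w u, w v)`, `(u, v) ∈ G`. -/
def shiftRel (G : AddSubgroup (TensorRing S W × TensorRing S W)) :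
    AddSubgroup (TensorRing S W × TensorRing S W) :=
  AddSubgroup.closure {z | ∃ w : W, ∃ g ∈ G, z = (ι S w * g.1, ι S w * g.2)}

variable {α} {n : ℕ}

theorem lowerIdeal_mono {m m' : ℕ} (h : m ≤ m') : lowerIdeal α n m ≤ lowerIdeal α n m' := by
  refine AddSubgroup.closure_mono ?_
  rintro _ ⟨i, j, hij, hz⟩
  exact ⟨i, j, by omega, hz⟩

theorem mul_α_mul_mem_lowerIdeal {c j m : ℕ} {y b : TensorRing S W}
    (hy : ∀ k, c ≤ k → proj S W k y = 0) (hb : b ∈ gr S W j) (r : R) (h : c + j + n ≤ m) :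
    y * α r * b ∈ lowerIdeal α n m := by
  rw [← sum_proj hy, Finset.sum_mul, Finset.sum_mul]
  refine sum_mem fun i hi => AddSubgroup.subset_closure
    ⟨i, j, ?_, _, proj_mem_gr i y, r, b, hb, rfl⟩
  have := Finset.mem_range.1 hi
  omega

theorem α_mul_mem_lowerIdeal {c m : ℕ} {y : TensorRing S W}
    (hy : ∀ k, c ≤ k → proj S W k y = 0) (r : R) (h : c + n ≤ m) :
    α r * y ∈ lowerIdeal α n m := by
  rw [← sum_proj hy, Finset.mul_sum]
  refine sum_mem fun i hi => AddSubgroup.subset_closure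
    ⟨0, i, ?_, 1, one_mem_gr, r, _, proj_mem_gr i y, by rw [one_mul]⟩
  have := Finset.mem_range.1 hi
  omega

theorem ι_mul_mem_lowerIdeal {m : ℕ} (w : W) {y : TensorRing S W} (hy : y ∈ lowerIdeal α n m) :
    ι S w * y ∈ lowerIdeal α n (m + 1) := by
  induction hy using AddSubgroup.closure_induction with
  | mem y hy =>
    obtain ⟨i, j, h, a, ha, r, b, hb, rfl⟩ := hy
    exact AddSubgroup.subset_closure
      ⟨i + 1, j, by omega, _, ι_mul_mem_gr w ha, r, b, hb, by simp only [mul_assoc]⟩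
  | zero => rw [mul_zero]; exact zero_mem _
  | add a b _ _ h1 h2 => rw [mul_add]; exact add_mem h1 h2
  | neg a _ h => rw [mul_neg]; exact neg_mem h

/-- The coordinates of `w x` are left multiples of `x` by elements of `S`; this stability is what
`mem_of_mem_shiftRel` asks of the relation. -/
theorem base_mul_mem_liftRel {m : ℕ} (s : S) {g : TensorRing S W × TensorRing S W}
    (hg : g ∈ liftRel α n m) :
    (ofBase S W s * g.1, ofBase S W s * g.2) ∈ liftRel α n m := by
  induction hg using AddSubgroup.closure_induction with
  | mem y hy =>
    obtain ⟨i, j, h, a, ha, r, b, hb, rfl⟩ := hy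
    have hsa := mul_mem_gr (ofBase_mem_gr (V := W) s) ha
    rw [zero_add] at hsa
    exact AddSubgroup.subset_closure ⟨i, j, h, _, hsa, r, b, hb, by simp only [mul_assoc]⟩
  | zero =>
    simp only [Prod.fst_zero, Prod.snd_zero, mul_zero]
    exact zero_mem _
  | add a b _ _ h1 h2 => simpa [mul_add] using add_mem h1 h2
  | neg a _ h => simpa using neg_mem h

theorem ι_mul_mem_shiftRel {G : AddSubgroup (TensorRing S W × TensorRing S W)} (w : W)
    {u v : TensorRing S W} (h : (u, v) ∈ G) : (ι S w * u, ι S w * v) ∈ shiftRel G :=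
  AddSubgroup.subset_closure ⟨w, _, h, rfl⟩

theorem α_sub_proj (hRn : ∀ r ∈ R, r ∈ gr S W n) (hα : IsFilteredMorphism α) (r : R) (k : ℕ)
    (hk : n ≤ k) : proj S W k ((r : TensorRing S W) - α r) = 0 := by
  rw [map_sub]
  rcases hk.eq_or_lt with rfl | hlt
  · rw [hα.comp_zero _ r (hRn r r.2), proj_self (hRn r r.2), sub_self]
  · rw [proj_of_ne (hRn r r.2) hlt.ne,
      mem_filt_iff.1 (hα.filtered n r (hRn r r.2)) k hlt, sub_zero]

/-- The difference `r - α(r)` has degree less than `n`. Hence replacing `r` by `α(r)` changes only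
lower degrees, and the first member of a pair is the leading component of the second. -/
theorem proj_liftRel (hRn : ∀ r ∈ R, r ∈ gr S W n) (hα : IsFilteredMorphism α) {m : ℕ}
    {g : TensorRing S W × TensorRing S W} (hg : g ∈ liftRel α n m) :
    g.1 ∈ TwoSidedIdeal.span (R : Set (TensorRing S W)) ∧ g.1 ∈ gr S W m ∧
      ∀ k, m ≤ k → proj S W k (g.1 - g.2) = 0 := by
  induction hg using AddSubgroup.closure_induction with
  | mem y hy =>
    obtain ⟨i, j, rfl, a, ha, r, b, hb, rfl⟩ := hy
    refine ⟨TwoSidedIdeal.mul_mem_right _ _ _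
      (TwoSidedIdeal.mul_mem_left _ _ _ (TwoSidedIdeal.subset_span r.2)), ?_, fun k hk => ?_⟩
    · have := mul_mem_gr (mul_mem_gr ha (hRn r r.2)) hb
      rwa [add_right_comm] at this
    · have h : a * r * b - a * α r * b = a * ((r : TensorRing S W) - α r) * b := by
        rw [mul_sub, sub_mul]
      rw [h]
      exact proj_mul_right_eq_zero hb (fun k hk => proj_left_mul_eq_zero ha
        (α_sub_proj hRn hα r) hk) (by omega)
  | zero => exact ⟨zero_mem _, zero_mem _, fun k _ => by simp⟩
  | add a b _ _ h1 h2 =>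
    refine ⟨add_mem h1.1 h2.1, add_mem h1.2.1 h2.2.1, fun k hk => ?_⟩
    rw [Prod.fst_add, Prod.snd_add, add_sub_add_comm, map_add, h1.2.2 k hk, h2.2.2 k hk, add_zero]
  | neg a _ h =>
    refine ⟨neg_mem h.1, neg_mem h.2.1, fun k hk => ?_⟩
    rw [Prod.fst_neg, Prod.snd_neg, ← neg_sub', map_neg, h.2.2 k hk, neg_zero]

theorem proj_lowerIdeal (hRn : ∀ r ∈ R, r ∈ gr S W n) (hα : IsFilteredMorphism α) {m : ℕ}
    {y : TensorRing S W} (hy : y ∈ lowerIdeal α n m) {k : ℕ} (hk : m ≤ k) :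
    proj S W k y = 0 := by
  induction hy using AddSubgroup.closure_induction with
  | mem y hy =>
    obtain ⟨i, j, h, a, ha, r, b, hb, rfl⟩ := hy
    refine proj_mul_right_eq_zero hb (c := n + 1 + i) (fun k hk => proj_left_mul_eq_zero ha
      (c := n + 1) (fun k hk => ?_) hk) (by omega)
    exact mem_filt_iff.1 (hα.filtered n r (hRn r r.2)) k (by omega)
  | zero => exact map_zero _
  | add a b _ _ h1 h2 => rw [map_add, h1, h2, add_zero]
  | neg a _ h => rw [map_neg, h, neg_zero]

/-- Generators of visible degree exactly `m` are second members of pairs in the relation; all others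
already belong to the lower step. -/
theorem exists_liftRel_add {m : ℕ} {x : TensorRing S W} (hx : x ∈ lowerIdeal α n (m + 1)) :
    ∃ g ∈ liftRel α n m, ∃ f ∈ lowerIdeal α n m, x = g.2 + f := by
  induction hx using AddSubgroup.closure_induction with
  | mem y hy =>
    obtain ⟨i, j, h, a, ha, r, b, hb, rfl⟩ := hy
    rcases (Nat.lt_succ_iff.1 h).eq_or_lt with h | h
    · exact ⟨_, AddSubgroup.subset_closure ⟨i, j, h, a, ha, r, b, hb, rfl⟩, 0, zero_mem _,
        (add_zero _).symm⟩
    · exact ⟨0, zero_mem _, _, AddSubgroup.subset_closure ⟨i, j, h, a, ha, r, b, hb, rfl⟩,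
        (zero_add _).symm⟩
  | zero => exact ⟨0, zero_mem _, 0, zero_mem _, (add_zero _).symm⟩
  | add a b _ _ h1 h2 =>
    obtain ⟨g, hg, f, hf, rfl⟩ := h1
    obtain ⟨g', hg', f', hf', rfl⟩ := h2
    exact ⟨g + g', add_mem hg hg', f + f', add_mem hf hf', add_add_add_comm _ _ _ _⟩
  | neg a _ h =>
    obtain ⟨g, hg, f, hf, rfl⟩ := h
    exact ⟨-g, neg_mem hg, -f, neg_mem hf, neg_add _ _⟩

theorem exists_mem_lowerIdeal {X : Set (TensorRing S W)} (hX : ∀ p ∈ X, ∃ r, α r = p)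
    {x : TensorRing S W} (hx : x ∈ TwoSidedIdeal.span X) : ∃ m, x ∈ lowerIdeal α n m := by
  replace hx := mem_closure_of_mem_span hx
  have hadd : ∀ a b, (∃ m, a ∈ lowerIdeal α n m) → (∃ m, b ∈ lowerIdeal α n m) →
      ∃ m, a + b ∈ lowerIdeal α n m := by
    rintro a b ⟨m, hm⟩ ⟨m', hm'⟩
    exact ⟨max m m', add_mem (lowerIdeal_mono (le_max_left _ _) hm)
      (lowerIdeal_mono (le_max_right _ _) hm')⟩
  induction hx using AddSubgroup.closure_induction with
  | mem x hx =>
    obtain ⟨a, p, hp, b, rfl⟩ := hx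
    obtain ⟨r, rfl⟩ := hX p hp
    induction a using gr_induction with
    | hgr i a ha =>
      induction b using gr_induction with
      | hgr j b hb =>
        exact ⟨i + j + n + 1, AddSubgroup.subset_closure
          ⟨i, j, Nat.lt_succ_self _, a, ha, r, b, hb, rfl⟩⟩
      | hadd b c h1 h2 => rw [mul_add]; exact hadd _ _ h1 h2
    | hadd b c h1 h2 => rw [add_mul, add_mul]; exact hadd _ _ h1 h2
  | zero => exact ⟨0, zero_mem _⟩
  | add a b _ _ h1 h2 => exact hadd _ _ h1 h2
  | neg a _ h => exact h.imp fun _ => neg_mem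

theorem liftRel_snd_mem_span {X : Set (TensorRing S W)} (hX : ∀ r, α r ∈ X) {m : ℕ}
    {g : TensorRing S W × TensorRing S W} (hg : g ∈ liftRel α n m) :
    g.2 ∈ TwoSidedIdeal.span X := by
  induction hg using AddSubgroup.closure_induction with
  | mem y hy =>
    obtain ⟨i, j, -, a, -, r, b, -, rfl⟩ := hy
    exact TwoSidedIdeal.mul_mem_right _ _ _
      (TwoSidedIdeal.mul_mem_left _ _ _ (TwoSidedIdeal.subset_span (hX r)))
  | zero => exact zero_mem _
  | add a b _ _ h1 h2 => exact add_mem h1 h2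
  | neg a _ h => exact neg_mem h

theorem exists_mem_liftRel {m : ℕ} {x : TensorRing S W}
    (hx : x ∈ idealGr (R : Set (TensorRing S W)) n m) : ∃ v, (x, v) ∈ liftRel α n m := by
  induction hx using AddSubgroup.closure_induction with
  | mem y hy =>
    obtain ⟨i, j, h, a, ha, r, hr, b, hb, rfl⟩ := hy
    exact ⟨_, AddSubgroup.subset_closure ⟨i, j, h, a, ha, ⟨r, hr⟩, b, hb, rfl⟩⟩
  | zero => exact ⟨0, zero_mem _⟩
  | add a b _ _ h1 h2 =>
    obtain ⟨v, hv⟩ := h1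
    obtain ⟨v', hv'⟩ := h2
    exact ⟨v + v', add_mem hv hv'⟩
  | neg a _ h =>
    obtain ⟨v, hv⟩ := h
    exact ⟨-v, neg_mem hv⟩

/-- If the lift by `α` is well-defined modulo elements of lower degree, one has a
PBW-deformation. -/
theorem isPBWDeformation_of_liftRel (hRn : ∀ r ∈ R, r ∈ gr S W n) (hα : IsFilteredMorphism α)
    {X : Set (TensorRing S W)} (hX : ∀ y, y ∈ X ↔ ∃ r, α r = y)
    (hlift : ∀ m v, (0, v) ∈ liftRel α n m → v ∈ lowerIdeal α n m) :
    IsPBWDeformation (R : Set (TensorRing S W)) X := by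
  -- If the component of degree `m` of `g.2 + f` vanishes, then so does `g.1`, the leading component
  -- of `g.2`, and `hlift` applies.
  have hstep : ∀ m x, x ∈ lowerIdeal α n (m + 1) → proj S W m x = 0 → x ∈ lowerIdeal α n m := by
    intro m x hx h0
    obtain ⟨⟨u, v⟩, hg, f, hf, rfl⟩ := exists_liftRel_add hx
    obtain ⟨-, h1, h2⟩ := proj_liftRel hRn hα hg
    have h3 := h2 m le_rfl
    rw [map_sub, proj_self h1, sub_eq_zero] at h3
    rw [map_add, proj_lowerIdeal hRn hα hf le_rfl, add_zero] at h0
    have hu : u = 0 := h3.trans h0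
    subst hu
    exact add_mem (hlift m v hg) hf
  -- By iteration, an element whose actual degree is less than `m` can be rewritten with visible
  -- degree less than `m`.
  have hdesc : ∀ d m x, x ∈ lowerIdeal α n (m + d) → (∀ k, m ≤ k → proj S W k x = 0) →
      x ∈ lowerIdeal α n m := by
    intro d
    induction d with
    | zero => exact fun m x hx _ => hx
    | succ d ih =>
      intro m x hx hk
      exact ih m x (hstep _ x hx (hk _ (by omega))) hk
  rw [isPBWDeformation_iff]
  intro m t ht
  constructor
  · intro h
    obtain ⟨v, hv⟩ := exists_mem_liftRel (α := α) (mem_idealGr_of_mem_span hRn h ht)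
    refine ⟨t - v, (proj_liftRel hRn hα hv).2.2, ?_⟩
    rw [sub_sub_cancel]
    exact liftRel_snd_mem_span (fun r => (hX _).2 ⟨r, rfl⟩) hv
  · rintro ⟨t', ht', h⟩
    obtain ⟨M, hM⟩ := exists_mem_lowerIdeal (α := α) (n := n) (fun p hp => (hX p).1 hp) h
    have h1 : t - t' ∈ lowerIdeal α n (m + 1) := by
      refine hdesc M (m + 1) _ (lowerIdeal_mono (by omega) hM) fun k hk => ?_
      rw [map_sub, proj_of_ne ht (by omega), ht' k (by omega), sub_zero]
    obtain ⟨g, hg, f, hf, hgf⟩ := exists_liftRel_add h1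
    obtain ⟨hs, h2, h3⟩ := proj_liftRel hRn hα hg
    have h4 := h3 m le_rfl
    rw [map_sub, proj_self h2, sub_eq_zero] at h4
    have h5 := congrArg (proj S W m) hgf
    rw [map_sub, map_add, proj_self ht, ht' m le_rfl, proj_lowerIdeal hRn hα hf le_rfl, sub_zero,
      add_zero, ← h4] at h5
    rw [h5]
    exact hs

end Deformation

open TensorRing

/-! ### Coordinates with respect to a dual basis of `W` -/

section Coordinates

variable {S : Type u} [Ring S] {W : Type v} [AddCommGroup W] [Module S W] [Module Sᵐᵒᵖ W]
  [SMulCommClass S Sᵐᵒᵖ W] (D : DualBasis.{u, v, x} S W)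

/-- The coordinates of an element of `T⁺ = W ⊗_S T` with respect to a dual basis of `W`. -/
noncomputable def coord : TensorRing S W →+ D.ι →₀ TensorRing S W :=
  (BTensor.lift
    (AddMonoidHom.mk' (fun w => AddMonoidHom.mk'
        (fun x => (D.f w).mapRange (fun s => ofBase S W s * x) (by simp))
        (fun x x' => by ext i; simp [mul_add]))
      (fun w w' => by ext x i; simp [add_mul]))
    (fun w s x => by
      ext i
      simp [D.f_smul, smul_eq', mul_assoc])).comp (tail S W)

theorem coord_ι_mul (w : W) (x : TensorRing S W) (i : D.ι) :
    coord D (ι S w * x) i = ofBase S W (D.f w i) * x := by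
  rw [coord, AddMonoidHom.comp_apply, tail_ι_mul]
  rfl

theorem sum_coord (w : W) (x : TensorRing S W) :
    ((coord D (ι S w * x)).sum fun i y => ι S (D.e i) * y) = ι S w * x := by
  have h : coord D (ι S w * x) = (D.f w).mapRange (fun s => ofBase S W s * x) (by simp) := by
    ext i
    rw [coord_ι_mul]
    rfl
  rw [h, Finsupp.sum_mapRange_index (by simp)]
  conv_rhs => rw [← D.sum_eq w]
  rw [Finsupp.sum, Finsupp.sum, map_sum, Finset.sum_mul]
  refine Finset.sum_congr rfl fun i _ => ?_
  rw [ι_op_smul, mul_assoc]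

/-- Coordinates undo the multiplication by `W`: those of `(w u, w v)` are the pairs `(s u, s v)`
with `s` a coordinate of `w`, so they stay in `G`. Thus if `(0, v)` is in the shifted relation, `v`
is a sum of terms `e_i v_i` with `(0, v_i) ∈ G`. -/
theorem mem_of_mem_shiftRel {G : AddSubgroup (TensorRing S W × TensorRing S W)}
    (hG : ∀ s, ∀ g ∈ G, (ofBase S W s * g.1, ofBase S W s * g.2) ∈ G)
    {z : TensorRing S W × TensorRing S W} (hz : z ∈ shiftRel G) :
    (∀ i, (coord D z.1 i, coord D z.2 i) ∈ G) ∧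
      ((coord D z.2).sum fun i y => ι S (D.e i) * y) = z.2 := by
  induction hz using AddSubgroup.closure_induction with
  | mem z hz =>
    obtain ⟨w, g, hg, rfl⟩ := hz
    refine ⟨fun i => ?_, sum_coord D w g.2⟩
    rw [coord_ι_mul, coord_ι_mul]
    exact hG _ g hg
  | zero =>
    refine ⟨fun i => ?_, by simp⟩
    simp only [Prod.fst_zero, Prod.snd_zero, map_zero, Finsupp.coe_zero, Pi.zero_apply]
    exact zero_mem _
  | add a b _ _ h1 h2 =>
    refine ⟨fun i => ?_, ?_⟩
    · simp only [Prod.fst_add, Prod.snd_add, map_add, Finsupp.add_apply]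
      exact add_mem (h1.1 i) (h2.1 i)
    · rw [Prod.snd_add, map_add, Finsupp.sum_add_index' (by simp) (by simp [mul_add]), h1.2, h2.2]
  | neg a _ h =>
    refine ⟨fun i => ?_, ?_⟩
    · simp only [Prod.fst_neg, Prod.snd_neg, map_neg, Finsupp.neg_apply]
      exact neg_mem (h.1 i)
    · rw [Prod.snd_neg, map_neg, Finsupp.sum_neg_index (by simp)]
      simp only [mul_neg, Finsupp.sum, Finset.sum_neg_distrib] at h ⊢
      rw [h.2]

end Coordinates

/-! ### Sufficiency of the Jacobi conditions in the presence of linear syzygies -/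

section Lifting

variable {S : Type u} [Ring S] {W : Type v} [AddCommGroup W] [Module S W] [Module Sᵐᵒᵖ W]
  {R : SubBimodule S (TensorRing S W)} {α : BimoduleHom S R (TensorRing S W)} {n : ℕ}

theorem shiftRel_fst_mem_idealV (hRn : ∀ r ∈ R, r ∈ gr S W n) (hα : IsFilteredMorphism α) {m : ℕ}
    {z : TensorRing S W × TensorRing S W} (hz : z ∈ shiftRel (liftRel α n m)) :
    z.1 ∈ idealV R := by
  induction hz using AddSubgroup.closure_induction with
  | mem z hz =>
    obtain ⟨w, g, hg, rfl⟩ := hz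
    exact AddSubgroup.subset_closure ⟨w, g.1, (proj_liftRel hRn hα hg).1, rfl⟩
  | zero => exact zero_mem _
  | add a b _ _ h1 h2 => exact add_mem h1 h2
  | neg a _ h => exact neg_mem h

theorem mul_mem_shiftRel {q m : ℕ} {a u v : TensorRing S W} (ha : a ∈ gr S W (q + 1))
    (h : ∀ c ∈ gr S W q, (c * u, c * v) ∈ liftRel α n m) :
    (a * u, a * v) ∈ shiftRel (liftRel α n m) := by
  induction ha using gr_succ_induction with
  | hι w c hc =>
    rw [mul_assoc, mul_assoc]
    exact ι_mul_mem_shiftRel w (h c hc)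
  | h0 => rw [zero_mul, zero_mul]; exact zero_mem _
  | hadd a b _ _ h1 h2 => rw [add_mul, add_mul]; exact add_mem h1 h2
  | hneg a _ h => rw [neg_mul, neg_mul]; exact neg_mem h

/-- The elements of the relation are sums of elements of `R T` and of `W ⟨R⟩`. -/
theorem exists_mulR_add_shiftRel {m : ℕ} {g : TensorRing S W × TensorRing S W}
    (hg : g ∈ liftRel α n (m + 1)) :
    ∃ k, ∃ σ, ∃ g' ∈ shiftRel (liftRel α n m), (k + n = m + 1 ∨ σ = 0) ∧ projR R k σ = σ ∧
      g = (mulR R.incl σ, mulR α σ) + g' := by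
  -- `σ` is kept homogeneous of degree `m + 1 - n`; the alternative `σ = 0` covers the case in which
  -- this subtraction is truncated.
  suffices h : ∃ σ, ∃ g' ∈ shiftRel (liftRel α n m), (n ≤ m + 1 ∨ σ = 0) ∧
      projR R (m + 1 - n) σ = σ ∧ g = (mulR R.incl σ, mulR α σ) + g' by
    obtain ⟨σ, g', hg', h1, h2, h3⟩ := h
    exact ⟨m + 1 - n, σ, g', hg', h1.imp_left (by omega), h2, h3⟩
  induction hg using AddSubgroup.closure_induction with
  | mem y hy =>
    obtain ⟨i, j, h, a, ha, r, b, hb, rfl⟩ := hy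
    -- A left factor of degree zero is absorbed into `r`; one of positive degree is a sum of
    -- products beginning with a factor in `W`.
    cases i with
    | zero =>
      obtain ⟨s, rfl⟩ := ha
      refine ⟨BTensor.tmul S (s • r) b, 0, zero_mem _, Or.inl (by omega), ?_, ?_⟩
      · rw [projR_tmul, show m + 1 - n = j by omega, proj_self hb]
      · rw [add_zero, mulR_tmul, mulR_tmul, BimoduleHom.map_smul, BimoduleHom.map_smul]
        rfl
    | succ q =>
      refine ⟨0, (a * ((r : TensorRing S W) * b), a * (α r * b)), ?_, Or.inr rfl, map_zero _, ?_⟩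
      · exact mul_mem_shiftRel ha fun c hc => AddSubgroup.subset_closure
          ⟨q, j, by omega, c, hc, r, b, hb, by simp only [mul_assoc]⟩
      · rw [map_zero, map_zero, Prod.mk_zero_zero, zero_add, mul_assoc, mul_assoc]
  | zero => exact ⟨0, 0, zero_mem _, Or.inr rfl, map_zero _, by rw [map_zero, map_zero, add_zero]; rfl⟩
  | add a b _ _ h1 h2 =>
    obtain ⟨σ, g, hg, h, hp, rfl⟩ := h1
    obtain ⟨σ', g', hg', h', hp', rfl⟩ := h2
    refine ⟨σ + σ', g + g', add_mem hg hg', ?_, by rw [map_add, hp, hp'], ?_⟩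
    · rcases h with h | rfl
      · exact Or.inl h
      · rw [zero_add]; exact h'
    · rw [map_add, map_add, ← Prod.mk_add_mk, add_add_add_comm]
  | neg a _ h =>
    obtain ⟨σ, g, hg, h, hp, rfl⟩ := h
    refine ⟨-σ, -g, neg_mem hg, h.imp_right (by rintro rfl; exact neg_zero),
      by rw [map_neg, hp], ?_⟩
    rw [map_neg, map_neg, neg_add, Prod.neg_mk]

/-- The obvious syzygies can be lifted. -/
theorem exists_shiftRel_of_mem_syzygies (hn : 1 ≤ n) (hRn : ∀ r ∈ R, r ∈ gr S W n)
    (hα : IsFilteredMorphism α) (hJ : SatisfiesJacobi n α) {k m : ℕ} (hk : k + n = m + 1)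
    {σ : BTensor S R (TensorRing S W)} (hσ : σ ∈ syzygies R) :
    ∃ g ∈ shiftRel (liftRel α n m), ∃ f ∈ lowerIdeal α n (m + 1),
      (mulR R.incl (projR R k σ), mulR α (projR R k σ)) = g + (0, f) := by
  have hadd : ∀ σ τ : BTensor S R (TensorRing S W),
      (∃ g ∈ shiftRel (liftRel α n m), ∃ f ∈ lowerIdeal α n (m + 1),
        (mulR R.incl σ, mulR α σ) = g + (0, f)) →
      (∃ g ∈ shiftRel (liftRel α n m), ∃ f ∈ lowerIdeal α n (m + 1),
        (mulR R.incl τ, mulR α τ) = g + (0, f)) →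
      ∃ g ∈ shiftRel (liftRel α n m), ∃ f ∈ lowerIdeal α n (m + 1),
        (mulR R.incl (σ + τ), mulR α (σ + τ)) = g + (0, f) := by
    rintro σ τ ⟨g, hg, f, hf, h⟩ ⟨g', hg', f', hf', h'⟩
    refine ⟨g + g', add_mem hg hg', f + f', add_mem hf hf', ?_⟩
    rw [map_add, map_add, ← Prod.mk_add_mk, h, h', add_add_add_comm g (0, f) g' (0, f'),
      Prod.mk_add_mk 0 0 f f', add_zero]
  have hneg : ∀ σ : BTensor S R (TensorRing S W),
      (∃ g ∈ shiftRel (liftRel α n m), ∃ f ∈ lowerIdeal α n (m + 1),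
        (mulR R.incl σ, mulR α σ) = g + (0, f)) →
      ∃ g ∈ shiftRel (liftRel α n m), ∃ f ∈ lowerIdeal α n (m + 1),
        (mulR R.incl (-σ), mulR α (-σ)) = g + (0, f) := by
    rintro σ ⟨g, hg, f, hf, h⟩
    refine ⟨-g, neg_mem hg, -f, neg_mem hf, ?_⟩
    rw [map_neg, map_neg, ← Prod.neg_mk, h, neg_add g (0, f), Prod.neg_mk 0 f, neg_zero]
  have hzero : ∃ g ∈ shiftRel (liftRel α n m), ∃ f ∈ lowerIdeal α n (m + 1),
      (mulR R.incl (0 : BTensor S R (TensorRing S W)), mulR α 0) = g + (0, f) :=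
    ⟨0, zero_mem _, 0, zero_mem _, by simp⟩
  -- In this form the conditions supply `ρ` with `(W ⊗ α)(y) - (α ⊗ W)(z) = α(ρ)`. So `(α ⊗ W)(z) b`
  -- agrees with `(W ⊗ α)(y) b`, which begins with a factor in `W`, up to the term `α(ρ) b` of
  -- visible degree `m`.
  rw [satisfiesJacobi_iff hn hRn hα] at hJ
  induction hσ using AddSubgroup.closure_induction with
  | mem σ hσ =>
    rcases hσ with ⟨y, z, e, b, rfl⟩ | ⟨r, x, hx, rfl⟩
    · cases k with
      | zero => rw [projR_zero_extendR]; exact hzero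
      | succ l =>
        obtain ⟨ρ, hρ⟩ := hJ y z e
        have hb := proj_mem_gr l b
        rw [projR_succ_extendR, mulR_extendR, mulR_extendR]
        generalize proj S W l b = b at hb
        refine ⟨(leftTensor R.incl y * b, leftTensor α y * b), ?_, -(α ρ * b), neg_mem ?_, ?_⟩
        · clear hρ e
          induction y using BTensor.induction with
          | h0 => simp only [map_zero, zero_mul]; exact zero_mem _
          | ht w r =>
            simp only [leftTensor_tmul, mul_assoc]
            exact ι_mul_mem_shiftRel w (AddSubgroup.subset_closure
              ⟨0, l, by omega, 1, one_mem_gr, r, b, hb, by rw [one_mul, one_mul]; rfl⟩)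
          | ha y y' h1 h2 => simp only [map_add, add_mul]; exact add_mem h1 h2
        · exact AddSubgroup.subset_closure
            ⟨0, l, by omega, 1, one_mem_gr, ρ, b, hb, by rw [one_mul]⟩
        · rw [← hρ, e, Prod.mk_add_mk, add_zero, sub_mul, neg_sub, add_sub_cancel]
    · rw [projR_tmul]
      have hx' := proj_mem_idealGr hRn hx k
      generalize proj S W k x = x at hx'
      induction hx' using AddSubgroup.closure_induction with
      | mem x hx' =>
        obtain ⟨i, j, hij, a, ha, r', hr', b, hb, rfl⟩ := hx'
        -- As `n ≥ 1`, the product `r a` has positive degree, so a factor in `W` can be split off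
        -- from `(r a r' b, r a α(r') b)`.
        have hra : (r : TensorRing S W) * a ∈ gr S W (n - 1 + i + 1) := by
          have := mul_mem_gr (hRn r r.2) ha
          rwa [show n - 1 + i + 1 = n + i by omega]
        lift r' to R using hr'
        -- The correction term comes from `α(r) a r' b - r a α(r') b = α(r) a (r' - α(r')) b - (r -
        -- α(r)) a α(r') b`, where each difference in parentheses has lost its leading term.
        refine ⟨_, mul_mem_shiftRel (u := (r' : TensorRing S W) * b) (v := α r' * b) hra fun c hc =>
            AddSubgroup.subset_closure ⟨n - 1 + i, j, by omega, c, hc, r', b, hb,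
              by simp only [mul_assoc]⟩,
          α r * (a * ((r' : TensorRing S W) - α r') * b) -
            ((r : TensorRing S W) - α r) * a * α r' * b, sub_mem ?_ ?_, ?_⟩
        · refine α_mul_mem_lowerIdeal (c := n + i + j) (fun k hk => ?_) r (by omega)
          exact proj_mul_right_eq_zero hb (fun k hk => proj_left_mul_eq_zero ha
            (α_sub_proj hRn hα r') hk) hk
        · refine mul_α_mul_mem_lowerIdeal (c := n + i) (fun k hk => ?_) hb r' (by omega)
          exact proj_mul_right_eq_zero ha (α_sub_proj hRn hα r) hk
        · rw [mulR_tmul, mulR_tmul, Prod.mk_add_mk, add_zero]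
          refine Prod.ext ?_ ?_
          · change (r : TensorRing S W) * _ = _
            simp only [mul_assoc]
          · simp only [mul_assoc, mul_sub, sub_mul]
            abel
      | zero => rw [BTensor.tmul_zero]; exact hzero
      | add a b _ _ h1 h2 => rw [BTensor.tmul_add]; exact hadd _ _ h1 h2
      | neg a _ h => rw [BTensor.tmul_neg]; exact hneg _ h
  | zero => rw [map_zero]; exact hzero
  | add a b _ _ h1 h2 => rw [map_add]; exact hadd _ _ h1 h2
  | neg a _ h => rw [map_neg]; exact hneg _ h

variable [SMulCommClass S Sᵐᵒᵖ W]

/-- Induction on the degree. A pair `(0, v)` is the sum of a pair coming from `σ ∈ R ⊗ T` and one in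
the shifted relation. Its first member being zero, `σ` lies in the kernel of `R ⊗ T → T / W⟨R⟩`,
hence is an obvious syzygy, and its pair also lies in the shifted relation up to a lower term `f`.
The pair `(0, v - f)` is then treated coordinate by coordinate. -/
theorem mem_lowerIdeal_of_mem_liftRel (D : DualBasis.{u, v, x} S W) (hn : 1 ≤ n)
    (hRn : ∀ r ∈ R, r ∈ gr S W n) (hR : HasLinearSyzygies R) (hα : IsFilteredMorphism α)
    (hJ : SatisfiesJacobi n α) (m : ℕ) (v : TensorRing S W) (hv : (0, v) ∈ liftRel α n m) :
    v ∈ lowerIdeal α n m := by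
  induction m generalizing v with
  | zero =>
    have h : liftRel α n 0 ≤ ⊥ := by
      rw [liftRel, AddSubgroup.closure_le]
      rintro _ ⟨i, j, h, -⟩
      omega
    have h0 : v = 0 := congrArg Prod.snd (AddSubgroup.mem_bot.1 (h hv))
    rw [h0]
    exact zero_mem _
  | succ m ih =>
    obtain ⟨k, σ, g', hg', hk, hp, hg⟩ := exists_mulR_add_shiftRel hv
    have hshift : ∀ v, (0, v) ∈ shiftRel (liftRel α n m) → v ∈ lowerIdeal α n (m + 1) := by
      intro v hv
      obtain ⟨h1, h2⟩ := mem_of_mem_shiftRel D (fun s g hg => base_mul_mem_liftRel s hg) hv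
      rw [← show _ = v from h2]
      refine sum_mem fun i _ => ι_mul_mem_lowerIdeal _ (ih _ ?_)
      have := h1 i
      rwa [map_zero] at this
    have hσ : ∃ g ∈ shiftRel (liftRel α n m), ∃ f ∈ lowerIdeal α n (m + 1),
        (mulR R.incl σ, mulR α σ) = g + (0, f) := by
      rcases hk with hk | rfl
      · rw [← hp]
        refine exists_shiftRel_of_mem_syzygies hn hRn hα hJ hk (hR σ ?_)
        have h1 : mulR R.incl σ = -g'.1 := eq_neg_of_add_eq_zero_left (congrArg Prod.fst hg).symm
        rw [h1]
        exact neg_mem (shiftRel_fst_mem_idealV hRn hα hg')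
      · exact ⟨0, zero_mem _, 0, zero_mem _, by simp⟩
    obtain ⟨g, hgm, f, hf, e⟩ := hσ
    rw [e, add_right_comm] at hg
    have h1 : g + g' = (0, v - f) := by
      rw [eq_sub_of_add_eq hg.symm, Prod.mk_sub_mk, sub_zero]
    have h2 := hshift (v - f) (h1 ▸ add_mem hgm hg')
    rw [← sub_add_cancel v f]
    exact add_mem h2 hf

/-- The Jacobi conditions imply that the deformation has the PBW-property. -/
theorem isPBWDeformation_of_satisfiesJacobi (D : DualBasis.{u, v, x} S W) (hn : 1 ≤ n)
    (hRn : ∀ r ∈ R, r ∈ gr S W n) (hR : HasLinearSyzygies R) (hα : IsFilteredMorphism α)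
    (hJ : SatisfiesJacobi n α) {X : Set (TensorRing S W)} (hX : ∀ y, y ∈ X ↔ ∃ r, α r = y) :
    IsPBWDeformation (R : Set (TensorRing S W)) X :=
  isPBWDeformation_of_liftRel hRn hα hX (mem_lowerIdeal_of_mem_liftRel D hn hRn hR hα hJ)

end Lifting

open TensorRing

/-! ### The bijection between `T ⊗_K S` and the tensor ring of `V ⊗_t S` -/

section FromTbar

variable {K : Type u} [Ring K] {S : Type w} [Ring S] [RingOver K S]
  {V : Type v} [AddCommGroup V] [Module K V] [Module Kᵐᵒᵖ V] [SMulCommClass K Kᵐᵒᵖ V]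

theorem TwistingMap.mulHom_one_tmul {B : Type x} [Ring B] [RingOver K B] (τ : TwistingMap K S B)
    (z : BTensor K B S) (s : S) : τ.mulHom z (BTensor.tmul K 1 s) = rmul s z := by
  rw [τ.mulHom_tmul_right]
  congr 1
  induction z using BTensor.induction with
  | h0 => simp
  | ht b u => simp [τ.map_unit]
  | ha a b h1 h2 => simp only [map_add, h1, h2]

/-- The ring homomorphism `S → B ⊗_τ S`. -/
def TwistingMap.inS {B : Type x} [Ring B] [RingOver K B] (τ : TwistingMap K S B) :
    S →+* τ.Tensor where
  toFun s := τ.tmul 1 s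
  map_one' := rfl
  map_mul' s s' := (τ.mulHom_one_tmul (BTensor.tmul K 1 s) s').symm
  map_zero' := BTensor.tmul_zero _
  map_add' _ _ := BTensor.tmul_add _ _ _

variable (t : Twisting K S V) {B : Type x} [Ring B] [RingOver K B] (τ : TwistingMap K S B)
  (π : TensorRing K V →+* B) (hπ : ∀ k, π (ofBase K V k) = RingOver.hom k)
  (hτ : ∀ (s : S) (v : V), τ.toHom (BTensor.tmul K s (π (ι K v))) =
    Twisting.emb π hπ (t.toHom (BTensor.tmul K s v)))

theorem Twisting.emb_act
    (hτ : ∀ (s : S) (v : V), τ.toHom (BTensor.tmul K s (π (ι K v))) =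
      Twisting.emb π hπ (t.toHom (BTensor.tmul K s v))) (s : S) (z : BTensor K V S) :
    Twisting.emb π hπ (t.act s z) = τ.act s (Twisting.emb π hπ z) := by
  induction z using BTensor.induction with
  | h0 => simp
  | ht v u => rw [emb_tmul, PreTwisting.act_tmul, PreTwisting.act_tmul, hτ, emb_rmul]
  | ha a b h1 h2 => simp only [map_add, h1, h2]

/-- The ring homomorphism `T_S(V ⊗_t S) → B ⊗_τ S` which extends `π`. -/
def Twisting.fromTbar : t.Tbar →+* τ.Tensor :=
  TensorRing.lift τ.inS
    (show t.Bimod →+ τ.Tensor from Twisting.emb (K := K) (S := S) (V := V) π hπ)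
    (fun s z => (t.emb_act τ π hπ hτ s z).trans (lmul_one _).symm)
    (fun s z => (Twisting.emb_rmul π hπ s z).trans (τ.mulHom_one_tmul _ s).symm)

theorem Twisting.fromTbar_ofBase (s : S) :
    t.fromTbar τ π hπ hτ (ofBase S t.Bimod s) = τ.tmul 1 s := lift_ofBase _ _ _ _ s

theorem Twisting.fromTbar_ι (z : BTensor K V S) :
    t.fromTbar τ π hπ hτ (ι S (show t.Bimod from z)) = Twisting.emb π hπ z :=
  lift_ι _ _ _ _ (show t.Bimod from z)

theorem TwistingMap.tmul_one_mul (a b : B) (s : S) :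
    τ.tmul a 1 * τ.tmul b s = τ.tmul (a * b) s := by
  rw [τ.tmul_mul_tmul, τ.one_twist]
  simp only [rmul_tmul, one_mul, lmul_tmul]
  rfl

theorem Twisting.fromTbar_j (x : TensorRing K V) :
    t.fromTbar τ π hπ hτ (t.j x) = τ.tmul (π x) 1 := by
  induction x using TensorRing.induction with
  | hK k =>
    rw [t.j_ofBase, fromTbar_ofBase, hπ]
    have h := BTensor.smul_tmul (K := K) (1 : B) k (1 : S)
    rw [RingOver.op_smul_eq, one_mul, RingOver.smul_eq, mul_one] at h
    exact h.symm
  | hV v =>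
    rw [t.j_ι]
    exact t.fromTbar_ι τ π hπ hτ _
  | hmul x y hx hy => rw [map_mul t.j, map_mul, hx, hy, τ.tmul_one_mul, map_mul π]
  | hadd x y hx hy =>
    rw [map_add t.j, map_add, hx, hy, map_add π]
    exact (BTensor.add_tmul _ _ _).symm

/-- Composed with `psi`, the homomorphism becomes `π ⊗ S`. It is used twice: `B = T` gives the
injectivity of `psi`, and `B = A` computes the kernel of `T̄ → A ⊗_t S`. -/
theorem Twisting.fromTbar_psi (z : BTensor K (TensorRing K V) S) :
    t.fromTbar τ π hπ hτ (t.psi z) = BTensor.map π.toAddMonoidHom (AddMonoidHom.id S)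
      (fun k x => (map_mul π x (ofBase K V k)).trans (by rw [hπ]; rfl)) (fun _ _ => rfl) z := by
  induction z using BTensor.induction with
  | h0 => simp only [map_zero]; rfl
  | ht x s =>
    rw [t.psi_tmul, map_mul, fromTbar_j, fromTbar_ofBase, τ.tmul_one_mul, mul_one]
    rfl
  | ha a b h1 h2 => rw [map_add, map_add, h1, h2, map_add]; rfl

theorem Twisting.star_compat (s : S) (v : V) : t.star.toHom (BTensor.tmul K s (ι K v)) =
    Twisting.emb (RingHom.id _) (fun _ => rfl) (t.toHom (BTensor.tmul K s v)) := by
  change ev (t.rho (RingHom.id _) (fun _ => rfl) (ι K v)) (BTensor.tmul K 1 s) = _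
  rw [rho_ι, rhoV_tmul, lmul_one]

theorem Twisting.quot_compat (R : SubBimodule K (TensorRing K V)) (hR : t.IsInvariant R)
    (s : S) (v : V) : (t.quot R hR).toHom (BTensor.tmul K s (QuotRing.mk _ (ι K v))) =
      Twisting.emb (QuotRing.mk (R : Set (TensorRing K V))) (fun _ => rfl)
        (t.toHom (BTensor.tmul K s v)) := by
  change ev (t.rho (QuotRing.mk _) (fun _ => rfl) (ι K v)) (BTensor.tmul K 1 s) = _
  rw [rho_ι, rhoV_tmul, lmul_one]

theorem Twisting.psi_injective : Function.Injective t.psi := by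
  intro z z' h
  have h' := congrArg (t.fromTbar t.star (RingHom.id _) (fun _ => rfl) t.star_compat) h
  rw [fromTbar_psi, fromTbar_psi] at h'
  have hid : ∀ z : BTensor K (TensorRing K V) S,
      BTensor.map (RingHom.id (TensorRing K V)).toAddMonoidHom (AddMonoidHom.id S)
        (fun _ _ => rfl) (fun _ _ => rfl) z = z := by
    intro z
    induction z using BTensor.induction with
    | h0 => simp
    | ht x s => rfl
    | ha a b h1 h2 => rw [map_add, h1, h2]
  rw [hid, hid] at h'
  exact h'

/-- An element of `S` standing to the left of `j(y)` is moved to its right by the twisting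
(`psi_rho`), so the image of `psi` is closed under products. As it contains `S` and `W`, it is all
of `T̄`. -/
theorem Twisting.psi_mul_mem (z z' : BTensor K (TensorRing K V) S) :
    ∃ z'', t.psi z'' = t.psi z * t.psi z' := by
  induction z using BTensor.induction with
  | h0 => exact ⟨0, by simp⟩
  | ht x s =>
    induction z' using BTensor.induction with
    | h0 => exact ⟨0, by simp⟩
    | ht y u =>
      refine ⟨rmul u (ev (t.rho (RingHom.id _) (fun _ => rfl) y) (BTensor.tmul K x s)), ?_⟩
      rw [psi_rmul, psi_rho, psi_tmul, psi_tmul, mul_assoc]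
    | ha a b h1 h2 =>
      obtain ⟨a', ha⟩ := h1
      obtain ⟨b', hb⟩ := h2
      exact ⟨a' + b', by rw [map_add, ha, hb, map_add, mul_add]⟩
  | ha a b h1 h2 =>
    obtain ⟨a', ha⟩ := h1
    obtain ⟨b', hb⟩ := h2
    exact ⟨a' + b', by rw [map_add, ha, hb, map_add, add_mul]⟩

theorem Twisting.ι_eq_psi (z : BTensor K V S) :
    t.psi (Twisting.emb (RingHom.id _) (fun _ => rfl) z) = ι S (show t.Bimod from z) := by
  induction z using BTensor.induction with
  | h0 => exact (map_zero t.psi).trans (map_zero (ι S : t.Bimod →+ t.Tbar)).symm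
  | ht v s =>
    rw [emb_tmul, psi_tmul, RingHom.id_apply, j_ι, ← ι_op_smul, op_smul_pure, one_mul]
    rfl
  | ha a b h1 h2 =>
    rw [map_add, map_add, h1, h2]
    exact (map_add (ι S : t.Bimod →+ t.Tbar) _ _).symm

theorem Twisting.psi_surjective : Function.Surjective t.psi := by
  intro x
  induction x using TensorRing.induction with
  | hK s => exact ⟨BTensor.tmul K 1 s, by rw [psi_tmul, map_one, one_mul]⟩
  | hV z => exact ⟨_, t.ι_eq_psi z⟩
  | hmul a b h1 h2 =>
    obtain ⟨a, rfl⟩ := h1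
    obtain ⟨b, rfl⟩ := h2
    exact t.psi_mul_mem a b
  | hadd a b h1 h2 =>
    obtain ⟨a, rfl⟩ := h1
    obtain ⟨b, rfl⟩ := h2
    exact ⟨a + b, map_add _ _ _⟩

end FromTbar

/-! ### The twisted tensor product as a quotient of the tensor ring over `S` -/

namespace Twisting

variable {K : Type u} [Ring K] {S : Type w} [Ring S] [RingOver K S]
  {V : Type v} [AddCommGroup V] [Module K V] [Module Kᵐᵒᵖ V] [SMulCommClass K Kᵐᵒᵖ V]
  (t : Twisting K S V) (R : SubBimodule K (TensorRing K V)) (hR : t.IsInvariant R)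

theorem j_mem_Rbar {r : TensorRing K V} (hr : r ∈ R) : t.j r ∈ t.Rbar R hR :=
  ⟨BTensor.tmul K r 1, AddSubgroup.subset_closure ⟨r, hr, 1, rfl⟩, by
    rw [psi_tmul, map_one, mul_one]⟩

/-- The ring homomorphism `T_S(V ⊗_t S) → A ⊗_t S`. -/
def toQuot : t.Tbar →+* (t.quot R hR).Tensor :=
  t.fromTbar (t.quot R hR) (QuotRing.mk _) (fun _ => rfl) (t.quot_compat R hR)

theorem toQuot_Rbar {y : t.Tbar} (hy : y ∈ t.Rbar R hR) : t.toQuot R hR y = 0 := by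
  obtain ⟨z, hz, rfl⟩ := hy
  induction hz using AddSubgroup.closure_induction with
  | mem z hz =>
    obtain ⟨r, hr, s, rfl⟩ := hz
    rw [toQuot, fromTbar_psi]
    have h : QuotRing.mk (R : Set (TensorRing K V)) r = 0 :=
      QuotRing.mk_eq_zero_iff.2 (TwoSidedIdeal.subset_span hr)
    exact (congrArg (fun a => BTensor.tmul K a s) h).trans (BTensor.zero_tmul s)
  | zero => rw [map_zero, map_zero]
  | add a b _ _ h1 h2 => rw [map_add, map_add, h1, h2, add_zero]
  | neg a _ h => rw [map_neg, map_neg, h, neg_zero]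

theorem j_mem_span {x : TensorRing K V} (hx : x ∈ TwoSidedIdeal.span (R : Set (TensorRing K V))) :
    t.j x ∈ TwoSidedIdeal.span (t.Rbar R hR : Set t.Tbar) := by
  replace hx := mem_closure_of_mem_span hx
  induction hx using AddSubgroup.closure_induction with
  | mem x hx =>
    obtain ⟨a, r, hr, b, rfl⟩ := hx
    rw [map_mul, map_mul]
    exact TwoSidedIdeal.mul_mem_right _ _ _ (TwoSidedIdeal.mul_mem_left _ _ _
      (TwoSidedIdeal.subset_span (t.j_mem_Rbar R hR hr)))
  | zero => rw [map_zero]; exact zero_mem _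
  | add a b _ _ h1 h2 => rw [map_add]; exact add_mem h1 h2
  | neg a _ h => rw [map_neg]; exact neg_mem h

/-- The ring isomorphism `A ⊗_t S ≅ T_S(V ⊗_t S) / ⟨R̄⟩`. -/
theorem exists_ringEquiv :
    ∃ e : (t.quot R hR).Tensor ≃+* QuotRing (t.Rbar R hR : Set t.Tbar),
      ∀ (a : TensorRing K V) (s : S), e ((t.quot R hR).tmul (QuotRing.mk _ a) s) =
        QuotRing.mk _ (t.j a * ofBase S t.Bimod s) := by
  let F : QuotRing (t.Rbar R hR : Set t.Tbar) →+* (t.quot R hR).Tensor :=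
    QuotRing.lift (t.toQuot R hR) fun y hy => t.toQuot_Rbar R hR hy
  have hF : ∀ z, F (QuotRing.mk _ (t.psi z)) = _ := fun z => t.fromTbar_psi _ _ _ _ z
  have hsurj : Function.Surjective F := by
    intro y
    obtain ⟨z, hz⟩ := BTensor.map_surjective
      (QuotRing.mk (R : Set (TensorRing K V))).toAddMonoidHom (AddMonoidHom.id S)
      (fun k x => map_mul (QuotRing.mk _) x (ofBase K V k)) (fun _ _ => rfl)
      (QuotRing.mk_surjective _) Function.surjective_id y
    exact ⟨_, (hF z).trans hz⟩
  have hinj : Function.Injective F := by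
    rw [injective_iff_map_eq_zero]
    intro y hy
    obtain ⟨x, rfl⟩ := QuotRing.mk_surjective _ y
    obtain ⟨z, rfl⟩ := t.psi_surjective x
    rw [hF] at hy
    -- By right exactness the kernel of `T ⊗_K S → A ⊗_K S` is the image of `⟨R⟩ ⊗_K S`, and `psi`
    -- maps this into `⟨R̄⟩`.
    have h := BTensor.mem_closure_of_map_eq_zero _ _ _ _
      (QuotRing.mk_surjective (R : Set (TensorRing K V))) Function.surjective_id z hy
    rw [QuotRing.mk_eq_zero_iff]
    clear hy
    induction h using AddSubgroup.closure_induction with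
    | mem z hz =>
      obtain ⟨x, s, hx | hs, rfl⟩ := hz
      · rw [psi_tmul]
        exact TwoSidedIdeal.mul_mem_right _ _ _ (t.j_mem_span R hR (QuotRing.mk_eq_zero_iff.1 hx))
      · rw [show s = 0 from hs, BTensor.tmul_zero, map_zero]
        exact zero_mem _
    | zero => rw [map_zero]; exact zero_mem _
    | add a b _ _ h1 h2 => rw [map_add]; exact add_mem h1 h2
    | neg a _ h => rw [map_neg]; exact neg_mem h
  let e := RingEquiv.ofBijective F ⟨hinj, hsurj⟩
  refine ⟨e.symm, fun a s => ?_⟩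
  rw [RingEquiv.symm_apply_eq]
  exact (hF (BTensor.tmul K a s)).symm

/-- The ideal `⟨R̄⟩` is the image of `⟨R⟩ ⊗ S`. -/
theorem exists_psi_of_mem_span {y : t.Tbar}
    (hy : y ∈ TwoSidedIdeal.span (t.Rbar R hR : Set t.Tbar)) :
    ∃ z ∈ AddSubgroup.closure {z : BTensor K (TensorRing K V) S |
      ∃ x ∈ TwoSidedIdeal.span (R : Set (TensorRing K V)), ∃ s, z = BTensor.tmul K x s},
      t.psi z = y := by
  obtain ⟨z, rfl⟩ := t.psi_surjective y
  have h0 : t.toQuot R hR (t.psi z) = 0 := by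
    have h := TwoSidedIdeal.span_le.2 (fun b hb =>
      (TwoSidedIdeal.mem_ker (t.toQuot R hR)).2 (t.toQuot_Rbar R hR hb)) hy
    exact (TwoSidedIdeal.mem_ker _).1 h
  rw [toQuot, fromTbar_psi] at h0
  refine ⟨z, AddSubgroup.closure_le _ |>.2 ?_ (BTensor.mem_closure_of_map_eq_zero _ _ _ _
      (QuotRing.mk_surjective (R : Set (TensorRing K V))) Function.surjective_id z h0), rfl⟩
  rintro _ ⟨x, s, hx | hs, rfl⟩
  · exact AddSubgroup.subset_closure ⟨x, QuotRing.mk_eq_zero_iff.1 hx, s, rfl⟩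
  · rw [show s = 0 from hs, BTensor.tmul_zero]
    exact zero_mem _

end Twisting

open TensorRing

/-! ### Kernels and flat base change -/

section Kernel

variable {K : Type u} [Ring K]

/-- For a flat left module `S`, the kernel of `g ⊗ S` is the image of `ker g ⊗ S`. -/
theorem IsLeftFlat.mem_closure {S : Type w} [AddCommGroup S] [Module K S]
    (hS : IsLeftFlat.{u, w, v} K S) {M E : Type (max u v)} [AddCommGroup M] [AddCommGroup E]
    [Module Kᵐᵒᵖ M] [Module Kᵐᵒᵖ E] (g : M →ₗ[Kᵐᵒᵖ] E) (z : BTensor K M S)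
    (hz : BTensor.map g.toAddMonoidHom (AddMonoidHom.id S) (fun k m => g.map_smul (op k) m)
      (fun _ _ => rfl) z = 0) :
    z ∈ AddSubgroup.closure {y : BTensor K M S | ∃ m, g m = 0 ∧ ∃ s, y = BTensor.tmul K m s} := by
  -- `g` factors as the quotient map followed by the injection `f`. Flatness keeps `f` injective
  -- after tensoring, so only the quotient map matters, to which right exactness applies.
  let f : (M ⧸ LinearMap.ker g) →ₗ[Kᵐᵒᵖ] E := (LinearMap.ker g).liftQ g le_rfl
  have hf : Function.Injective f := by
    rw [← LinearMap.ker_eq_bot]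
    exact Submodule.ker_liftQ_eq_bot _ _ _ le_rfl
  have hinj := hS _ _ f hf
  let q : M →ₗ[Kᵐᵒᵖ] M ⧸ LinearMap.ker g := (LinearMap.ker g).mkQ
  have hq : BTensor.map q.toAddMonoidHom (AddMonoidHom.id S) (fun k m => q.map_smul (op k) m)
      (fun _ _ => rfl) z = 0 := by
    apply hinj
    rw [map_zero, ← hz, ← AddMonoidHom.comp_apply]
    congr 1
    exact BTensor.hom_ext fun _ _ => rfl
  refine AddSubgroup.closure_le _ |>.2 ?_ (BTensor.mem_closure_of_map_eq_zero _ _ _ _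
    (Submodule.mkQ_surjective _) Function.surjective_id z hq)
  rintro _ ⟨m, s, hm | hs, rfl⟩
  · exact AddSubgroup.subset_closure ⟨m, (Submodule.Quotient.mk_eq_zero _).1 hm, s, rfl⟩
  · rw [show s = 0 from hs, BTensor.tmul_zero]
    exact zero_mem _

variable {V : Type v} [AddCommGroup V] [Module K V] [Module Kᵐᵒᵖ V]

/-- `V · ⟨R⟩` as a right `K`-module. -/
def idealVSubmodule (R : SubBimodule K (TensorRing K V)) : Submodule Kᵐᵒᵖ (TensorRing K V) :=
  { idealV R with
    smul_mem' := fun k x hx => by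
      change x ∈ idealV R at hx
      change k • x ∈ idealV R
      induction hx using AddSubgroup.closure_induction with
      | mem x hx =>
        obtain ⟨v, x, hx, rfl⟩ := hx
        refine AddSubgroup.subset_closure ⟨v, k • x, ?_, mul_assoc _ _ _⟩
        exact TwoSidedIdeal.mul_mem_right _ _ _ hx
      | zero => rw [smul_zero]; exact zero_mem _
      | add a b _ _ h1 h2 => rw [smul_add]; exact add_mem h1 h2
      | neg a _ h => rw [smul_neg]; exact neg_mem h }

theorem mulR_incl_op_smul {R : SubBimodule K (TensorRing K V)} (k : Kᵐᵒᵖ)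
    (z : BTensor K R (TensorRing K V)) : mulR R.incl (k • z) = k • mulR R.incl z := by
  induction z using BTensor.induction with
  | h0 => simp
  | ht r x => exact (mul_assoc _ _ _).symm
  | ha a b h1 h2 => rw [smul_add, map_add, h1, h2, map_add, smul_add]

/-- The map `R ⊗_K T → T / V⟨R⟩`. -/
def mulRQuot (R : SubBimodule K (TensorRing K V)) :
    BTensor K R (TensorRing K V) →ₗ[Kᵐᵒᵖ] TensorRing K V ⧸ idealVSubmodule R where
  toFun z := (idealVSubmodule R).mkQ (mulR R.incl z)
  map_add' z z' := by rw [map_add, map_add]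
  map_smul' k z := by rw [mulR_incl_op_smul, map_smul]; rfl

theorem mulRQuot_eq_zero_iff {R : SubBimodule K (TensorRing K V)}
    {z : BTensor K R (TensorRing K V)} : mulRQuot R z = 0 ↔ mulR R.incl z ∈ idealV R :=
  Submodule.Quotient.mk_eq_zero (idealVSubmodule R)

end Kernel

/-! ### Passage of the syzygies from `K` to `S` -/

namespace Twisting

variable {K : Type u} [Ring K] {S : Type w} [Ring S] [RingOver K S]
  {V : Type v} [AddCommGroup V] [Module K V] [Module Kᵐᵒᵖ V] [SMulCommClass K Kᵐᵒᵖ V]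
  (t : Twisting K S V) (R : SubBimodule K (TensorRing K V)) (hR : t.IsInvariant R)

/-- The map `R → R̄`. -/
def jR : R →+ t.Rbar R hR :=
  AddMonoidHom.mk' (fun r => ⟨t.j r, t.j_mem_Rbar R hR r.2⟩)
    (fun r r' => Subtype.ext (map_add t.j (r : TensorRing K V) r'))

theorem jR_op_smul (k : K) (r : R) : t.jR R hR (op k • r) = op (RingOver.hom k : S) • t.jR R hR r :=
  Subtype.ext ((map_mul t.j (r : TensorRing K V) (ofBase K V k)).trans (by rw [j_ofBase]; rfl))

theorem jR_smul (k : K) (r : R) : t.jR R hR (k • r) = (RingOver.hom k : S) • t.jR R hR r :=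
  Subtype.ext ((map_mul t.j (ofBase K V k) (r : TensorRing K V)).trans (by rw [j_ofBase]; rfl))

/-- The map `V → V ⊗_t S`. -/
def pureHom : V →+ t.Bimod := AddMonoidHom.mk' (fun v => t.pure v 1)
  (fun v v' => BTensor.add_tmul v v' 1)

theorem pureHom_smul (k : K) (v : V) : t.pureHom (k • v) = (RingOver.hom k : S) • t.pureHom v := by
  change BTensor.tmul K (k • v) 1 = t.act (RingOver.hom k) (BTensor.tmul K v 1)
  have h1 := t.act_smul k 1 (BTensor.tmul K v 1)
  rw [RingOver.smul_eq, mul_one, t.act_one] at h1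
  exact h1.symm

theorem pureHom_op_smul (k : K) (v : V) :
    t.pureHom (op k • v) = op (RingOver.hom k : S) • t.pureHom v := by
  change _ = t.pure v (1 * RingOver.hom k)
  rw [one_mul]
  exact (BTensor.smul_tmul v k (1 : S)).trans (by rw [RingOver.smul_eq, mul_one]; rfl)

/-- For maps of bimodules over `K → S`, the map `M ⊗_K N → M' ⊗_S N'`. -/
def _root_.NCPBW.BTensor.mapRing {M N M' N' : Type*} [AddCommGroup M] [Module Kᵐᵒᵖ M]
    [AddCommGroup N] [Module K N] [AddCommGroup M'] [Module Sᵐᵒᵖ M'] [AddCommGroup N']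
    [Module S N'] (f : M →+ M') (g : N →+ N')
    (hf : ∀ (k : K) m, f (op k • m) = op (RingOver.hom k : S) • f m)
    (hg : ∀ (k : K) n, g (k • n) = (RingOver.hom k : S) • g n) :
    BTensor K M N →+ BTensor S M' N' :=
  BTensor.lift (((AddMonoidHom.compHom' g).comp BTensor.tmulHom).comp f)
    (fun m k n => by simp [hf, hg, BTensor.smul_tmul])

/-- The map `R ⊗_K T → R̄ ⊗_S T̄`, `r ⊗ x ↦ j(r) ⊗ j(x) s`. -/
def jRT (s : S) : BTensor K R (TensorRing K V) →+ BTensor S (t.Rbar R hR) t.Tbar :=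
  BTensor.mapRing (t.jR R hR)
    ((AddMonoidHom.mulRight (ofBase S t.Bimod s)).comp t.j.toAddMonoidHom) (t.jR_op_smul R hR)
    (fun k x => by
      change t.j (ofBase K V k * x) * ofBase S t.Bimod s =
        ofBase S t.Bimod (RingOver.hom k) * (t.j x * ofBase S t.Bimod s)
      rw [map_mul, j_ofBase, mul_assoc])

theorem jRT_tmul (s : S) (r : R) (x : TensorRing K V) :
    t.jRT R hR s (BTensor.tmul K r x) =
      BTensor.tmul S (t.jR R hR r) (t.j x * ofBase S t.Bimod s) := rfl

/-- The map `(R ⊗_K T) ⊗_K S → R̄ ⊗_S T̄`. -/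
def jRTS : BTensor K (BTensor K R (TensorRing K V)) S →+ BTensor S (t.Rbar R hR) t.Tbar :=
  BTensor.lift
    (AddMonoidHom.mk' (fun σ => AddMonoidHom.mk' (fun s => t.jRT R hR s σ) (fun s s' => by
      induction σ using BTensor.induction with
      | h0 => simp
      | ht r x => simp only [jRT_tmul, map_add, mul_add, BTensor.tmul_add]
      | ha a b h1 h2 => simp only [map_add, h1, h2]; abel))
      (fun σ σ' => by ext s; exact map_add (t.jRT R hR s) σ σ'))
    (fun σ k s => by
      change t.jRT R hR s (op k • σ) = t.jRT R hR (k • s) σ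
      induction σ using BTensor.induction with
      | h0 => simp
      | ht r x =>
        rw [BTensor.op_smul_tmul, jRT_tmul, jRT_tmul, op_smul_eq', map_mul, j_ofBase,
          RingOver.smul_eq, map_mul, mul_assoc]
      | ha a b h1 h2 => rw [smul_add, map_add, h1, h2, map_add])

theorem jRTS_tmul (σ : BTensor K R (TensorRing K V)) (s : S) :
    t.jRTS R hR (BTensor.tmul K σ s) = t.jRT R hR s σ := rfl

/-- Elements of `R̄` are sums of `j(r) s`; the scalar `s` passes over to the factor in `T̄`, which
is `psi(T ⊗_K S)`. -/
theorem jRTS_surjective : Function.Surjective (t.jRTS R hR) := by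
  intro z
  induction z using BTensor.induction with
  | h0 => exact ⟨0, map_zero _⟩
  | ht r x =>
    obtain ⟨_, z, hz, rfl⟩ := r
    -- Quantifying over the elements `r` with value `psi z` lets the induction run on `z`,
    -- independently of proofs of membership.
    suffices h : ∀ r : t.Rbar R hR, (r : t.Tbar) = t.psi z →
        ∃ a, t.jRTS R hR a = BTensor.tmul S r x from h _ rfl
    induction hz using AddSubgroup.closure_induction with
    | mem z hz =>
      obtain ⟨r, hr, s, rfl⟩ := hz
      intro r' hr'
      have h1 : r' = op s • t.jR R hR ⟨r, hr⟩ := Subtype.ext hr'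
      rw [h1, BTensor.smul_tmul]
      generalize s • x = x
      obtain ⟨y, rfl⟩ := t.psi_surjective x
      induction y using BTensor.induction with
      | h0 => exact ⟨0, by rw [map_zero, map_zero, BTensor.tmul_zero]⟩
      | ht x s => exact ⟨BTensor.tmul K (BTensor.tmul K ⟨r, hr⟩ x) s, rfl⟩
      | ha a b h1 h2 =>
        obtain ⟨a', ha⟩ := h1
        obtain ⟨b', hb⟩ := h2
        exact ⟨a' + b', by rw [map_add, ha, hb, map_add, BTensor.tmul_add]⟩
    | zero =>
      intro r hr
      rw [map_zero] at hr
      rw [show r = 0 from Subtype.ext hr]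
      exact ⟨0, by rw [map_zero, BTensor.zero_tmul]⟩
    | add a b ha hb h1 h2 =>
      intro r hr
      obtain ⟨a', ha'⟩ := h1 ⟨_, a, ha, rfl⟩ rfl
      obtain ⟨b', hb'⟩ := h2 ⟨_, b, hb, rfl⟩ rfl
      refine ⟨a' + b', ?_⟩
      rw [map_add, ha', hb', ← BTensor.add_tmul]
      congr 1
      exact Subtype.ext (hr.trans (map_add _ _ _)).symm
    | neg a ha h1 =>
      intro r hr
      obtain ⟨a', ha'⟩ := h1 ⟨_, a, ha, rfl⟩ rfl
      refine ⟨-a', ?_⟩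
      rw [map_neg, ha', ← BTensor.neg_tmul]
      congr 1
      exact Subtype.ext (hr.trans (map_neg _ _)).symm
  | ha a b h1 h2 =>
    obtain ⟨a, rfl⟩ := h1
    obtain ⟨b, rfl⟩ := h2
    exact ⟨a + b, map_add _ _ _⟩

theorem mulR_jRT (s : S) (σ : BTensor K R (TensorRing K V)) :
    mulR (t.Rbar R hR).incl (t.jRT R hR s σ) = t.psi (BTensor.tmul K (mulR R.incl σ) s) := by
  induction σ using BTensor.induction with
  | h0 => rw [map_zero, map_zero, map_zero, BTensor.zero_tmul, map_zero]
  | ht r x =>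
    rw [jRT_tmul, mulR_tmul, mulR_tmul, psi_tmul]
    change t.j r * (t.j x * _) = t.j (r * x) * _
    rw [map_mul, mul_assoc]
  | ha a b h1 h2 => rw [map_add, map_add, h1, h2, map_add, BTensor.add_tmul, map_add]

/-- The kernel of `T ⊗_K S → (T / V⟨R⟩) ⊗_K S`. -/
def idealVTensor : AddSubgroup (BTensor K (TensorRing K V) S) :=
  AddSubgroup.closure {z | ∃ x ∈ idealV R, ∃ s, z = BTensor.tmul K x s}

/-- A factor `v ⊗ s` of `W` equals `j(v) s`, and `s` is absorbed by the ideal `⟨R̄⟩`, which comes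
from `⟨R⟩ ⊗_K S`. -/
theorem exists_psi_of_mem_idealV {y : t.Tbar} (hy : y ∈ idealV (t.Rbar R hR)) :
    ∃ z ∈ idealVTensor (S := S) R, t.psi z = y := by
  have hadd : ∀ a b : t.Tbar, (∃ z ∈ idealVTensor (S := S) R, t.psi z = a) →
      (∃ z ∈ idealVTensor (S := S) R, t.psi z = b) →
      ∃ z ∈ idealVTensor (S := S) R, t.psi z = a + b := by
    rintro _ _ ⟨a, ha, rfl⟩ ⟨b, hb, rfl⟩
    exact ⟨a + b, add_mem ha hb, map_add _ _ _⟩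
  have hneg : ∀ a : t.Tbar, (∃ z ∈ idealVTensor (S := S) R, t.psi z = a) →
      ∃ z ∈ idealVTensor (S := S) R, t.psi z = -a := by
    rintro _ ⟨a, ha, rfl⟩
    exact ⟨-a, neg_mem ha, map_neg _ _⟩
  have hzero : ∃ z ∈ idealVTensor (S := S) R, t.psi z = 0 := ⟨0, zero_mem _, map_zero _⟩
  have key : ∀ (v : V) (x : t.Tbar), x ∈ TwoSidedIdeal.span (t.Rbar R hR : Set t.Tbar) →
      ∃ z ∈ idealVTensor (S := S) R, t.psi z = t.j (ι K v) * x := by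
    intro v x hx
    obtain ⟨z, hz, rfl⟩ := t.exists_psi_of_mem_span R hR hx
    clear hx
    induction hz using AddSubgroup.closure_induction with
    | mem z hz =>
      obtain ⟨x, hx, s, rfl⟩ := hz
      refine ⟨BTensor.tmul K (ι K v * x) s, AddSubgroup.subset_closure
        ⟨_, AddSubgroup.subset_closure ⟨v, x, hx, rfl⟩, s, rfl⟩, ?_⟩
      rw [psi_tmul, psi_tmul, map_mul, mul_assoc]
    | zero => rw [map_zero, mul_zero]; exact hzero
    | add a b _ _ h1 h2 => rw [map_add, mul_add]; exact hadd _ _ h1 h2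
    | neg a _ h => rw [map_neg, mul_neg]; exact hneg _ h
  induction hy using AddSubgroup.closure_induction with
  | mem y hy =>
    obtain ⟨w, x, hx, rfl⟩ := hy
    rw [← t.ι_eq_psi w]
    induction (show BTensor K V S from w) using BTensor.induction with
    | h0 => rw [map_zero, map_zero, zero_mul]; exact hzero
    | ht v s =>
      rw [emb_tmul, psi_tmul, mul_assoc]
      exact key v _ (TwoSidedIdeal.mul_mem_left _ _ _ hx)
    | ha a b h1 h2 => rw [map_add, map_add, add_mul]; exact hadd _ _ h1 h2
  | zero => exact hzero
  | add a b _ _ h1 h2 => exact hadd _ _ h1 h2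
  | neg a _ h => exact hneg _ h

theorem jRT_extendR (s : S) (b : TensorRing K V) (z : BTensor K R V) :
    t.jRT R hR s (extendR R b z) = extendR (t.Rbar R hR) (t.j b * ofBase S t.Bimod s)
      (BTensor.mapRing (t.jR R hR) t.pureHom (t.jR_op_smul R hR) t.pureHom_smul z) := by
  induction z using BTensor.induction with
  | h0 => simp
  | ht r v =>
    rw [extendR_tmul, jRT_tmul, map_mul, j_ι, mul_assoc]
    rfl
  | ha a b h1 h2 => simp only [map_add, h1, h2]

theorem leftTensor_mapRing (y : BTensor K V R) :
    leftTensor (t.Rbar R hR).incl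
      (BTensor.mapRing t.pureHom (t.jR R hR) t.pureHom_op_smul (t.jR_smul R hR) y) =
      t.j (leftTensor R.incl y) := by
  induction y using BTensor.induction with
  | h0 => simp
  | ht v r =>
    rw [leftTensor_tmul, map_mul, j_ι]
    rfl
  | ha a b h1 h2 => simp only [map_add, h1, h2]

theorem rightTensor_mapRing (z : BTensor K R V) :
    rightTensor (t.Rbar R hR).incl
      (BTensor.mapRing (t.jR R hR) t.pureHom (t.jR_op_smul R hR) t.pureHom_smul z) =
      t.j (rightTensor R.incl z) := by
  induction z using BTensor.induction with
  | h0 => simp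
  | ht v r =>
    rw [rightTensor_tmul, map_mul, j_ι]
    rfl
  | ha a b h1 h2 => simp only [map_add, h1, h2]

/-- `j` is a ring homomorphism mapping `⟨R⟩` into `⟨R̄⟩`, so a coincidence of images in `T` persists
in `T̄`, and both kinds of generators go to generators of the same kind. -/
theorem jRT_mem_syzygies (s : S) {σ : BTensor K R (TensorRing K V)} (hσ : σ ∈ syzygies R) :
    t.jRT R hR s σ ∈ syzygies (t.Rbar R hR) := by
  induction hσ using AddSubgroup.closure_induction with
  | mem σ hσ =>
    refine AddSubgroup.subset_closure ?_
    rcases hσ with ⟨y, z, e, b, rfl⟩ | ⟨r, x, hx, rfl⟩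
    · refine Or.inl
        ⟨BTensor.mapRing t.pureHom (t.jR R hR) t.pureHom_op_smul (t.jR_smul R hR) y, _, ?_, _,
          t.jRT_extendR R hR s b z⟩
      rw [leftTensor_mapRing, rightTensor_mapRing, e]
    · exact Or.inr ⟨_, _, TwoSidedIdeal.mul_mem_right _ _ _ (t.j_mem_span R hR hx),
        t.jRT_tmul R hR s r x⟩
  | zero => rw [map_zero]; exact zero_mem _
  | add a b _ _ h1 h2 => rw [map_add]; exact add_mem h1 h2
  | neg a _ h => rw [map_neg]; exact neg_mem h

/-- The condition on the syzygies passes from `R` to `R̄`, if `S` is flat. -/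
theorem hasLinearSyzygies_Rbar (hS : IsLeftFlat.{u, w, v} K S) (h : HasLinearSyzygies R) :
    HasLinearSyzygies (t.Rbar R hR) := by
  intro σ hσ
  obtain ⟨τ, rfl⟩ := t.jRTS_surjective R hR σ
  obtain ⟨ζ, hζ, e⟩ := t.exists_psi_of_mem_idealV R hR hσ
  let m : BTensor K (BTensor K R (TensorRing K V)) S →+ BTensor K (TensorRing K V) S :=
    BTensor.map (mulR R.incl) (AddMonoidHom.id S) (fun k z => mulR_incl_op_smul (op k) z)
      (fun _ _ => rfl)
  have hm : ∀ τ, mulR (t.Rbar R hR).incl (t.jRTS R hR τ) = t.psi (m τ) := by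
    intro τ
    induction τ using BTensor.induction with
    | h0 => simp
    | ht σ s => rw [jRTS_tmul, mulR_jRT]; rfl
    | ha a b h1 h2 => rw [map_add, map_add, h1, h2, map_add, map_add]
  have hmτ : m τ = ζ := t.psi_injective (by rw [← hm, e])
  let q : BTensor K (TensorRing K V) S →+ BTensor K (TensorRing K V ⧸ idealVSubmodule R) S :=
    BTensor.map (idealVSubmodule R).mkQ.toAddMonoidHom (AddMonoidHom.id S)
      (fun k x => (idealVSubmodule R).mkQ.map_smul (op k) x) (fun _ _ => rfl)
  have hq : q ζ = 0 := by
    clear hmτ e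
    induction hζ using AddSubgroup.closure_induction with
    | mem z hz =>
      obtain ⟨x, hx, s, rfl⟩ := hz
      have h0 : (idealVSubmodule R).mkQ x = 0 := (Submodule.Quotient.mk_eq_zero _).2 hx
      exact (congrArg (fun a => BTensor.tmul K a s) h0).trans (BTensor.zero_tmul s)
    | zero => exact map_zero _
    | add a b _ _ h1 h2 => rw [map_add, h1, h2, add_zero]
    | neg a _ h => rw [map_neg, h, neg_zero]
  -- By flatness, the kernel of `(R ⊗_K T) ⊗_K S → (T / V⟨R⟩) ⊗_K S` is spanned by elements `σ ⊗ s`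
  -- with `σ` in the kernel over `K`, and these `σ` are obvious syzygies by `h`.
  have hτ := hS.mem_closure (mulRQuot R) τ (by
    rw [← hq, ← hmτ, ← AddMonoidHom.comp_apply]
    congr 1
    refine BTensor.hom_ext fun z s => ?_
    rfl)
  clear hσ e hmτ
  induction hτ using AddSubgroup.closure_induction with
  | mem τ hτ =>
    obtain ⟨σ, hσ, s, rfl⟩ := hτ
    exact t.jRT_mem_syzygies R hR s (h σ (mulRQuot_eq_zero_iff.1 hσ))
  | zero => rw [map_zero]; exact zero_mem _
  | add a b _ _ h1 h2 => rw [map_add]; exact add_mem h1 h2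
  | neg a _ h => rw [map_neg]; exact neg_mem h

end Twisting

/-! ### Graded modules described by families of projections -/

section Graded

/-- The homogeneous elements of degree `p` for a family of projections. -/
def homogeneous {X : Type*} [AddCommGroup X] (pr : ℕ → X →+ X) (p : ℕ) : AddSubgroup X where
  carrier := {x | ∀ k, pr k x = if p = k then x else 0}
  zero_mem' k := by simp
  add_mem' {x y} hx hy k := by
    rw [map_add, hx, hy]
    split_ifs <;> simp
  neg_mem' {x} hx k := by
    rw [map_neg, hx]
    split_ifs <;> simp

variable {A : Type u} [Ring A] (𝒜 : ℕ → AddSubgroup A)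

/-- A grading of the ring `A` with components `𝒜 m`, given by projections. -/
structure RingGrading where
  /-- the projections -/
  pr : ℕ → A →+ A
  pr_of_mem : ∀ p, 𝒜 p ≤ homogeneous pr p
  gen : ∀ a, a ∈ ⨆ p, 𝒜 p
  one_mem : 1 ∈ 𝒜 0
  mul_mem : ∀ {p q a b}, a ∈ 𝒜 p → b ∈ 𝒜 q → a * b ∈ 𝒜 (p + q)

/-- A graded projective right `A`-module. -/
structure GrMod where
  /-- the module -/
  X : Type w
  [group : AddCommGroup X]
  [module : Module Aᵐᵒᵖ X]
  /-- the projections onto the components -/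
  pr : ℕ → X →+ X
  gen : ∀ y, y ∈ ⨆ p, homogeneous pr p
  smul_mem : ∀ p q (y : X) (a : A), y ∈ homogeneous pr p → a ∈ 𝒜 q →
    op a • y ∈ homogeneous pr (p + q)
  projective : Module.Projective Aᵐᵒᵖ X

attribute [instance] GrMod.group GrMod.module

variable {𝒜}

/-- Homogeneous maps of degree zero. -/
structure GrHom (M N : GrMod.{u, w} 𝒜) where
  /-- the linear map -/
  lin : M.X →ₗ[Aᵐᵒᵖ] N.X
  mem : ∀ p y, y ∈ homogeneous M.pr p → lin y ∈ homogeneous N.pr p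

theorem pr_self {X : Type*} [AddCommGroup X] {pr : ℕ → X →+ X} {p : ℕ} {x : X}
    (hx : x ∈ homogeneous pr p) : pr p x = x := by rw [hx p, if_pos rfl]

theorem pr_of_ne {X : Type*} [AddCommGroup X] {pr : ℕ → X →+ X} {p k : ℕ} {x : X}
    (hx : x ∈ homogeneous pr p) (h : p ≠ k) : pr k x = 0 := by rw [hx k, if_neg h]

theorem pr_mem_homogeneous {X : Type*} [AddCommGroup X] {pr : ℕ → X →+ X}
    (hgen : ∀ y, y ∈ ⨆ p, homogeneous pr p) (p : ℕ) (x : X) : pr p x ∈ homogeneous pr p := by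
  induction hgen x using AddSubgroup.iSup_induction' with
  | hp i y hy =>
    by_cases h : i = p
    · subst h; rw [pr_self hy]; exact hy
    · rw [pr_of_ne hy h]; exact zero_mem _
  | h1 => rw [map_zero]; exact zero_mem _
  | hadd a b _ _ h1 h2 => rw [map_add]; exact add_mem h1 h2

theorem exists_sum_pr {X : Type*} [AddCommGroup X] {pr : ℕ → X →+ X}
    (hgen : ∀ y, y ∈ ⨆ p, homogeneous pr p) (x : X) :
    ∃ N, ∀ M, N ≤ M → ∑ p ∈ Finset.range M, pr p x = x := by
  induction hgen x using AddSubgroup.iSup_induction' with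
  | hp i y hy =>
    refine ⟨i + 1, fun M hM => ?_⟩
    rw [Finset.sum_congr rfl fun k _ => hy k, Finset.sum_ite_eq, if_pos]
    exact Finset.mem_range.2 (by omega)
  | h1 => exact ⟨0, fun M _ => by simp⟩
  | hadd a b _ _ h1 h2 =>
    obtain ⟨N, hN⟩ := h1
    obtain ⟨N', hN'⟩ := h2
    refine ⟨max N N', fun M hM => ?_⟩
    simp only [map_add, Finset.sum_add_distrib]
    rw [hN M (by omega), hN' M (by omega)]

/-- The projection `pr q` reads off the summand of index `q`, so the sum of the components is
direct; `hgen` says that they span. -/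
theorem isInternal_homogeneous {X : Type*} [AddCommGroup X] {pr : ℕ → X →+ X}
    (hgen : ∀ y, y ∈ ⨆ p, homogeneous pr p) : DirectSum.IsInternal (homogeneous pr) := by
  have key : ∀ (z : DirectSum ℕ fun p => homogeneous pr p) (q : ℕ),
      pr q (DirectSum.coeAddMonoidHom (homogeneous pr) z) = z q := by
    intro z q
    induction z using DirectSum.induction_on with
    | zero => simp
    | of p y =>
      rw [DirectSum.coeAddMonoidHom_of, y.2 q]
      split_ifs with h
      · subst h; rw [DirectSum.of_eq_same]
      · rw [DirectSum.of_eq_of_ne _ _ _ (Ne.symm h)]; rfl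
    | add a b h1 h2 => rw [map_add, map_add, h1, h2]; rfl
  constructor
  · rw [injective_iff_map_eq_zero]
    intro z hz
    refine DFinsupp.ext fun q => Subtype.ext ?_
    rw [← key z q, hz, map_zero]
    rfl
  · intro x
    change x ∈ (DirectSum.coeAddMonoidHom (homogeneous pr)).range
    have hle : ⨆ p, homogeneous pr p ≤ (DirectSum.coeAddMonoidHom (homogeneous pr)).range :=
      iSup_le fun p y hy => ⟨DirectSum.of _ p ⟨y, hy⟩, DirectSum.coeAddMonoidHom_of _ _ _⟩
    exact hle (hgen x)

theorem GrHom.lin_pr {M N : GrMod.{u, w} 𝒜} (f : GrHom M N) (p : ℕ) (y : M.X) :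
    f.lin (M.pr p y) = N.pr p (f.lin y) := by
  induction M.gen y using AddSubgroup.iSup_induction' with
  | hp i y hy =>
    rw [hy p, f.mem i y hy p]
    split_ifs
    · rfl
    · exact map_zero _
  | h1 => simp
  | hadd a b _ _ h1 h2 => simp only [map_add, h1, h2]

/-- Criterion for compatibility of the projections with the action. -/
theorem smul_mem_of_gen {X : Type*} [AddCommGroup X] [Module Aᵐᵒᵖ X] {pr : ℕ → X →+ X}
    (G : Set X) (hgen : AddSubgroup.closure G = ⊤) {q : ℕ} {a : A}
    (hG : ∀ x ∈ G, ∃ p, x ∈ homogeneous pr p ∧ op a • x ∈ homogeneous pr (p + q))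
    {p : ℕ} {y : X} (hy : y ∈ homogeneous pr p) : op a • y ∈ homogeneous pr (p + q) := by
  -- Shifting degrees by `q` is stated for `k + q` and separately for `k < q`, which avoids
  -- truncated subtraction. Both statements are additive in `x` and so are checked on the
  -- generators.
  have key : ∀ x : X, (∀ k, pr (k + q) (op a • x) = op a • pr k x) ∧
      ∀ k, k < q → pr k (op a • x) = 0 := by
    intro x
    have hx : x ∈ AddSubgroup.closure G := by rw [hgen]; trivial
    induction hx using AddSubgroup.closure_induction with
    | mem x hx =>
      obtain ⟨p, h1, h2⟩ := hG x hx
      refine ⟨fun k => ?_, fun k hk => pr_of_ne h2 (by omega)⟩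
      by_cases h : p = k
      · subst h; rw [pr_self h1, pr_self h2]
      · rw [pr_of_ne h1 h, pr_of_ne h2 (by omega), smul_zero]
    | zero => simp
    | add a b _ _ h1 h2 =>
      refine ⟨fun k => ?_, fun k hk => ?_⟩
      · rw [smul_add, map_add, map_add, smul_add, h1.1, h2.1]
      · rw [smul_add, map_add, h1.2 k hk, h2.2 k hk, add_zero]
    | neg a _ h =>
      refine ⟨fun k => ?_, fun k hk => ?_⟩
      · rw [smul_neg, map_neg, map_neg, smul_neg, h.1]
      · rw [smul_neg, map_neg, h.2 k hk, neg_zero]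
  intro k
  by_cases hk : k < q
  · rw [(key y).2 k hk, if_neg (by omega)]
  · obtain ⟨l, rfl⟩ : ∃ l, k = l + q := ⟨k - q, by omega⟩
    rw [(key y).1, hy l]
    by_cases h : p = l
    · rw [if_pos h, if_pos (by omega)]
    · rw [if_neg h, if_neg (by omega), smul_zero]

theorem gen_of_closure {X : Type*} [AddCommGroup X] {pr : ℕ → X →+ X}
    (G : Set X) (hgen : AddSubgroup.closure G = ⊤) (hG : ∀ x ∈ G, ∃ p, x ∈ homogeneous pr p)
    (y : X) : y ∈ ⨆ p, homogeneous pr p := by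
  have hle : AddSubgroup.closure G ≤ ⨆ p, homogeneous pr p := by
    rw [AddSubgroup.closure_le]
    intro x hx
    obtain ⟨p, hp⟩ := hG x hx
    exact (le_iSup (homogeneous pr) p) hp
  exact hle (by rw [hgen]; trivial)

namespace RingGrading

variable (g : RingGrading 𝒜)

theorem gen' (a : A) : a ∈ ⨆ p, homogeneous g.pr p :=
  (iSup_mono g.pr_of_mem) (g.gen a)

/-- Homogeneous elements lie in the components. -/
theorem mem_of_mem_homogeneous {p : ℕ} {a : A} (ha : a ∈ homogeneous g.pr p) : a ∈ 𝒜 p := by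
  have h : ∀ a, g.pr p a ∈ 𝒜 p := by
    intro a
    induction g.gen a using AddSubgroup.iSup_induction' with
    | hp i y hy =>
      rw [g.pr_of_mem i hy p]
      split_ifs with h
      · subst h; exact hy
      · exact zero_mem _
    | h1 => rw [map_zero]; exact zero_mem _
    | hadd a b _ _ h1 h2 => rw [map_add]; exact add_mem h1 h2
  rw [← pr_self ha]
  exact h a

/-- Factors of degree zero commute with the projections; this makes `inducedPr` balanced over `K`.
-/
theorem pr_mul {b : A} (hb : b ∈ 𝒜 0) (k : ℕ) (a : A) : g.pr k (b * a) = b * g.pr k a := by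
  induction g.gen a using AddSubgroup.iSup_induction' with
  | hp i y hy =>
    have h := g.mul_mem hb hy
    rw [zero_add] at h
    rw [g.pr_of_mem i hy k, g.pr_of_mem i h k]
    split_ifs
    · rfl
    · rw [mul_zero]
  | h1 => simp
  | hadd a b _ _ h1 h2 => rw [mul_add, map_add, map_add, h1, h2, mul_add]

/-- The free module of rank one. -/
def self : GrMod.{u, u} 𝒜 where
  X := A
  pr := g.pr
  gen := g.gen'
  smul_mem _ _ _ _ hy ha :=
    g.pr_of_mem _ (g.mul_mem (g.mem_of_mem_homogeneous hy) ha)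
  projective := Module.Projective.of_equiv (MulOpposite.opLinearEquiv Aᵐᵒᵖ (M := A)).symm

end RingGrading

end Graded

/-! ### Construction of a graded projective resolution by free covers of kernels -/

section Cover

variable {A : Type u} [Ring A] {𝒜 : ℕ → AddSubgroup A} (g : RingGrading 𝒜)

/-- The homogeneous elements of the kernel of a homogeneous map. -/
structure KerIndex {M N : GrMod.{u, u} 𝒜} (f : GrHom.{u, u} M N) where
  /-- the degree -/
  deg : ℕ
  /-- the element -/
  elt : M.X
  mem : elt ∈ homogeneous M.pr deg
  map_eq_zero : f.lin elt = 0

/-- The projections of the free module with generators in prescribed degrees. -/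
noncomputable def freePr {ι : Type u} (deg : ι → ℕ) (p : ℕ) : (ι →₀ A) →+ (ι →₀ A) :=
  Finsupp.liftAddHom fun i =>
    if deg i ≤ p then (Finsupp.singleAddHom i).comp (g.pr (p - deg i)) else 0

theorem single_mem_homogeneous {ι : Type u} (deg : ι → ℕ) (i : ι) {q : ℕ} {a : A} (ha : a ∈ 𝒜 q) :
    Finsupp.single i a ∈ homogeneous (freePr g deg) (deg i + q) := by
  intro k
  rw [freePr, Finsupp.liftAddHom_apply_single]
  split_ifs with h1 h2 h2
  · subst h2
    rw [AddMonoidHom.comp_apply, Nat.add_sub_cancel_left, pr_self (g.pr_of_mem _ ha)]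
    rfl
  · rw [AddMonoidHom.comp_apply, pr_of_ne (g.pr_of_mem _ ha) (by omega), map_zero]
  · omega
  · rfl

theorem closure_single (g : RingGrading 𝒜) {ι : Type u} :
    AddSubgroup.closure {x : ι →₀ A | ∃ i q, ∃ a ∈ 𝒜 q, x = Finsupp.single i a} = ⊤ := by
  suffices h : ∀ x : ι →₀ A, x ∈ AddSubgroup.closure
      {x : ι →₀ A | ∃ i q, ∃ a ∈ 𝒜 q, x = Finsupp.single i a} from eq_top_iff.2 fun x _ => h x
  intro x
  induction x using Finsupp.induction_linear with
  | zero => exact zero_mem _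
  | add a b h1 h2 => exact add_mem h1 h2
  | single i a =>
    have ha := g.gen a
    induction ha using AddSubgroup.iSup_induction' with
    | hp q y hy => exact AddSubgroup.subset_closure ⟨i, q, y, hy, rfl⟩
    | h1 => rw [Finsupp.single_zero]; exact zero_mem _
    | hadd a b _ _ h1 h2 => rw [Finsupp.single_add]; exact add_mem h1 h2

/-- The free graded module on generators in prescribed degrees. -/
noncomputable def freeGrMod {ι : Type u} (deg : ι → ℕ) : GrMod.{u, u} 𝒜 where
  X := ι →₀ A
  pr := freePr g deg
  gen := gen_of_closure _ (closure_single g) (by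
    rintro _ ⟨i, q, a, ha, rfl⟩
    exact ⟨_, single_mem_homogeneous g deg i ha⟩)
  smul_mem p q y b hy hb := smul_mem_of_gen _ (closure_single g) (by
    rintro _ ⟨i, q', a, ha, rfl⟩
    refine ⟨_, single_mem_homogeneous g deg i ha, ?_⟩
    rw [Finsupp.smul_single, op_smul_eq_mul, add_assoc]
    exact single_mem_homogeneous g deg i (g.mul_mem ha hb)) hy
  projective := by
    have : Module.Free Aᵐᵒᵖ A :=
      Module.Free.of_equiv (MulOpposite.opLinearEquiv Aᵐᵒᵖ (M := A)).symm
    exact Module.Projective.of_free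

/-- The free graded module which covers the kernel of a homogeneous map. -/
noncomputable def cover {M N : GrMod.{u, u} 𝒜} (f : GrHom.{u, u} M N) : GrMod.{u, u} 𝒜 :=
  freeGrMod g (ι := KerIndex f) KerIndex.deg

/-- The linear map `ι →₀ A → M` given by elements of a right module `M`. -/
noncomputable def freeLift {ι M : Type*} [AddCommGroup M] [Module Aᵐᵒᵖ M] (e : ι → M) :
    (ι →₀ A) →ₗ[Aᵐᵒᵖ] M :=
  Finsupp.lsum ℕ fun i =>
    { toFun := fun a => op a • e i
      map_add' := fun a b => by rw [op_add, add_smul]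
      map_smul' := fun b a => by
        rw [RingHom.id_apply, ← mul_smul]
        rfl }

theorem freeLift_single {ι M : Type*} [AddCommGroup M] [Module Aᵐᵒᵖ M] (e : ι → M) (i : ι)
    (a : A) : freeLift e (Finsupp.single i a) = op a • e i :=
  Finsupp.lsum_single _ _ _ _

theorem freeLift_pr {ι : Type u} (M : GrMod.{u, u} 𝒜) (deg : ι → ℕ) (e : ι → M.X)
    (he : ∀ i, e i ∈ homogeneous M.pr (deg i)) (p : ℕ) (y : ι →₀ A) :
    freeLift e (freePr g deg p y) = M.pr p (freeLift e y) := by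
  have hy : y ∈ AddSubgroup.closure
      {x : ι →₀ A | ∃ i q, ∃ a ∈ 𝒜 q, x = Finsupp.single i a} := by
    rw [closure_single g]; trivial
  induction hy using AddSubgroup.closure_induction with
  | mem y hy =>
    obtain ⟨i, q, a, ha, rfl⟩ := hy
    rw [single_mem_homogeneous g deg i ha p, freeLift_single, M.smul_mem _ _ _ _ (he i) ha p]
    split_ifs
    · rw [freeLift_single]
    · exact map_zero _
  | zero => simp
  | add a b _ _ h1 h2 => simp only [map_add, h1, h2]
  | neg a _ h => simp only [map_neg, h]

/-- The covering map of the kernel. -/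
noncomputable def coverHom {M N : GrMod.{u, u} 𝒜} (f : GrHom.{u, u} M N) : GrHom (cover g f) M where
  lin := freeLift (KerIndex.elt (f := f))
  mem p y hy := by
    have h := freeLift_pr g M KerIndex.deg (KerIndex.elt (f := f)) KerIndex.mem p y
    have h1 : freePr g (KerIndex.deg (f := f)) p y = y := pr_self hy
    rw [h1] at h
    change freeLift (KerIndex.elt (f := f)) y ∈ _
    rw [h]
    exact pr_mem_homogeneous M.gen p _

/-- A homogeneous map commutes with the projections, so the components of an element of the kernel
lie in the kernel and are images of basis elements. -/
theorem freeLift_exact {M N : GrMod.{u, u} 𝒜} (f : GrHom.{u, u} M N) :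
    Function.Exact (freeLift (A := A) (KerIndex.elt (f := f))) f.lin := by
  intro y
  constructor
  · intro hy
    obtain ⟨n, hn⟩ := exists_sum_pr M.gen y
    rw [← hn n le_rfl]
    change _ ∈ LinearMap.range (freeLift (A := A) (KerIndex.elt (f := f)))
    refine sum_mem fun p _ => ⟨Finsupp.single ⟨p, M.pr p y, pr_mem_homogeneous M.gen p y, ?_⟩ 1, ?_⟩
    · rw [f.lin_pr, hy, map_zero]
    · rw [freeLift_single, op_one, one_smul]
  · rintro ⟨x, rfl⟩
    induction x using Finsupp.induction_linear with
    | zero => rw [map_zero, map_zero]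
    | add a b h1 h2 => rw [map_add, map_add, h1, h2, add_zero]
    | single z a => rw [freeLift_single, map_smul, z.map_eq_zero, smul_zero]

theorem coverHom_exact {M N : GrMod.{u, u} 𝒜} (f : GrHom.{u, u} M N) :
    Function.Exact (coverHom g f).lin f.lin := freeLift_exact f

/-- Two consecutive terms of a resolution. -/
structure ResStep (𝒜 : ℕ → AddSubgroup A) where
  /-- the source -/
  src : GrMod.{u, u} 𝒜
  /-- the target -/
  tgt : GrMod.{u, u} 𝒜
  /-- the differential -/
  d : GrHom src tgt

/-- The resolution obtained by covering kernels repeatedly. -/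
noncomputable def resStep (s : ResStep 𝒜) : ℕ → ResStep 𝒜
  | 0 => s
  | i + 1 => ⟨cover g (resStep s i).d, (resStep s i).src, coverHom g (resStep s i).d⟩

/-- The modules of the resolution. -/
noncomputable def resMod (X₀ : GrMod.{u, u} 𝒜) (s : ResStep 𝒜) : ℕ → GrMod.{u, u} 𝒜
  | 0 => X₀
  | 1 => s.tgt
  | i + 2 => (resStep g s i).src

/-- The differentials of the resolution. -/
noncomputable def resD (X₀ : GrMod.{u, u} 𝒜) (s : ResStep 𝒜) (d₀ : GrHom s.tgt X₀) :
    ∀ i, GrHom (resMod g X₀ s (i + 1)) (resMod g X₀ s i)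
  | 0 => d₀
  | 1 => s.d
  | i + 2 => coverHom g (resStep g s i).d

/-- The resolution of `A⁰` which continues a given beginning. -/
noncomputable def resolution (X₀ : GrMod.{u, u} 𝒜) (s : ResStep 𝒜) (d₀ : GrHom s.tgt X₀)
    (ε : X₀.X →ₗ[Aᵐᵒᵖ] A ⧸ rightAug 𝒜)
    (hε : ∀ p y, 0 < p → y ∈ homogeneous X₀.pr p → ε y = 0) (hεs : Function.Surjective ε)
    (h₀ : Function.Exact d₀.lin ε) (h₁ : Function.Exact s.d.lin d₀.lin) :
    GradedProjectiveResolution.{u, u} 𝒜 where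
  X i := (resMod g X₀ s i).X
  comp i := homogeneous (resMod g X₀ s i).pr
  isInternal i := isInternal_homogeneous (resMod g X₀ s i).gen
  smul_mem i := (resMod g X₀ s i).smul_mem
  projective i := (resMod g X₀ s i).projective
  d i := (resD g X₀ s d₀ i).lin
  d_mem i := (resD g X₀ s d₀ i).mem
  ε := ε
  ε_comp := hε
  ε_surjective := hεs
  exact_zero := h₀
  exact_succ i := match i with
    | 0 => h₁
    | 1 => coverHom_exact g s.d
    | i + 2 => coverHom_exact g (coverHom g (resStep g s i).d)

end Cover

/-! ### Consequences of the vanishing of `Tor_3` in one degree -/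

section Tor

variable {A : Type u} [Ring A] {𝒜 : ℕ → AddSubgroup A}

/-- If `M ⊗_A A / L` kills `y ⊗ 1`, then `y ∈ M L`. -/
theorem mem_closure_of_tmul_eq_zero {M : Type*} [AddCommGroup M] [Module Aᵐᵒᵖ M]
    (L : Submodule A A) (y : M)
    (hy : BTensor.tmul A y (Submodule.Quotient.mk 1 : A ⧸ L) = 0) :
    y ∈ AddSubgroup.closure {z : M | ∃ a ∈ L, ∃ m, z = op a • m} := by
  set C := AddSubgroup.closure {z : M | ∃ a ∈ L, ∃ m, z = op a • m} with hC
  let q : M →+ M ⧸ C := QuotientAddGroup.mk' C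
  -- This is `m ⊗ a ↦ m a` from `M ⊗_A A / L` to `M / M L`; it maps `y ⊗ 1` to the class of `y`.
  let F : BTensor A M (A ⧸ L) →+ M ⧸ C := BTensor.lift
    (AddMonoidHom.mk' (fun m => QuotientAddGroup.lift L.toAddSubgroup
      (AddMonoidHom.mk' (fun a => q (op a • m)) (fun a b => by rw [op_add, add_smul, map_add]))
      (fun a ha => (QuotientAddGroup.eq_zero_iff _).2
        (AddSubgroup.subset_closure ⟨a, ha, m, rfl⟩)))
      (fun m m' => by
        ext a
        induction a using Submodule.Quotient.induction_on with
        | _ a =>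
          change q (op a • (m + m')) = q (op a • m) + q (op a • m')
          rw [smul_add, map_add]))
    (fun m b a => by
      induction a using Submodule.Quotient.induction_on with
      | _ a =>
        change q (op a • op b • m) = q (op (b * a) • m)
        rw [op_mul, mul_smul])
  have h := congrArg F hy
  rw [map_zero] at h
  have h' : q (op (1 : A) • y) = 0 := h
  rw [op_one, one_smul] at h'
  exact (QuotientAddGroup.eq_zero_iff _).1 h'

/-- If `Tor_3` vanishes in degree `q`, then the kernel of `d₁` has no generators of degree `q` in
the radical. -/
theorem GradedProjectiveResolution.mem_closure_of_subsingleton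
    (Q : GradedProjectiveResolution.{u, u} 𝒜) {q : ℕ} (hq : Subsingleton (Q.TorSucc 2 q))
    (y : Q.X 3) (hy : y ∈ Q.comp 3 q)
    (hd : BTensor.tmul A (Q.d 2 y) (Submodule.Quotient.mk 1 : A ⧸ leftAug 𝒜) = 0) :
    Q.d 2 y ∈ AddSubgroup.closure {z | ∃ a ∈ leftAug 𝒜, ∃ y', z = op a • Q.d 2 y'} := by
  have hcyc : BTensor.tmul A y (Submodule.Quotient.mk 1 : A ⧸ leftAug 𝒜) ∈ Q.cycles 2 q :=
    ⟨AddSubgroup.subset_closure ⟨y, hy, _, rfl⟩, hd⟩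
  have hb : BTensor.tmul A y (Submodule.Quotient.mk 1 : A ⧸ leftAug 𝒜) ∈ Q.boundaries 2 q := by
    have h := Subsingleton.elim (QuotientAddGroup.mk ⟨_, hcyc⟩ : Q.TorSucc 2 q) 0
    exact (QuotientAddGroup.eq_zero_iff (⟨_, hcyc⟩ : Q.cycles 2 q)).1 h
  -- `A⁰` is generated by the class of `1`, so every tensor can be written as a single `y' ⊗ 1`.
  have hform : ∀ c ∈ Q.tensorComp 4 q, ∃ y' : Q.X 4,
      c = BTensor.tmul A y' (Submodule.Quotient.mk 1 : A ⧸ leftAug 𝒜) := by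
    intro c hc
    induction hc using AddSubgroup.closure_induction with
    | mem c hc =>
      obtain ⟨y', -, c, rfl⟩ := hc
      induction c using Submodule.Quotient.induction_on with
      | _ a =>
        refine ⟨op a • y', ?_⟩
        rw [BTensor.smul_tmul, ← Submodule.Quotient.mk_smul, smul_eq_mul, mul_one]
    | zero => exact ⟨0, (BTensor.zero_tmul _).symm⟩
    | add a b _ _ h1 h2 =>
      obtain ⟨a, rfl⟩ := h1
      obtain ⟨b, rfl⟩ := h2
      exact ⟨a + b, (BTensor.add_tmul _ _ _).symm⟩
    | neg a _ h =>
      obtain ⟨a, rfl⟩ := h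
      exact ⟨-a, (BTensor.neg_tmul _ _).symm⟩
  obtain ⟨c, hc, e⟩ := hb
  obtain ⟨y', rfl⟩ := hform c hc
  have e' : BTensor.tmul A (Q.d 3 y') (Submodule.Quotient.mk 1 : A ⧸ leftAug 𝒜) =
      BTensor.tmul A y (Submodule.Quotient.mk 1 : A ⧸ leftAug 𝒜) := e
  -- Modulo the boundary of `y'`, which the next differential annihilates, `y` lies in `X₃ A⁺`.
  have h0 : BTensor.tmul A (y - Q.d 3 y') (Submodule.Quotient.mk 1 : A ⧸ leftAug 𝒜) = 0 := by
    rw [BTensor.sub_tmul, e', sub_self]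
  have hm := mem_closure_of_tmul_eq_zero _ _ h0
  have hdd : Q.d 2 (Q.d 3 y') = 0 := (Q.exact_succ 2 _).2 ⟨y', rfl⟩
  have hsub : Q.d 2 (y - Q.d 3 y') = Q.d 2 y := by rw [map_sub, hdd, sub_zero]
  rw [← hsub]
  generalize y - Q.d 3 y' = x at hm
  induction hm using AddSubgroup.closure_induction with
  | mem x hx =>
    obtain ⟨a, ha, m, rfl⟩ := hx
    exact AddSubgroup.subset_closure ⟨a, ha, m, map_smul _ _ _⟩
  | zero => rw [map_zero]; exact zero_mem _
  | add a b _ _ h1 h2 => rw [map_add]; exact add_mem h1 h2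
  | neg a _ h => rw [map_neg]; exact neg_mem h

end Tor

open TensorRing

/-! ### The grading of `A = T / ⟨X⟩` -/

section Quotient

variable {K : Type u} [Ring K] {V : Type v} [AddCommGroup V] [Module K V] [Module Kᵐᵒᵖ V]
  {X : Set (TensorRing K V)} {n : ℕ}

/-- The ring homomorphism `A → A[X]` which multiplies the elements of degree `m` by `X ^ m`. -/
noncomputable def quotHomog (hX : ∀ r ∈ X, r ∈ gr K V n) :
    QuotRing X →+* Polynomial (QuotRing X) :=
  QuotRing.lift ((Polynomial.mapRingHom (QuotRing.mk X)).comp (homog K V)) (fun r hr => by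
    rw [RingHom.comp_apply, homog_of_mem_gr (hX r hr), Polynomial.coe_mapRingHom,
      Polynomial.map_monomial, QuotRing.mk_eq_zero_iff.2 (TwoSidedIdeal.subset_span hr),
      Polynomial.monomial_zero_right])

/-- The projection of `A` onto the component of degree `k`. -/
noncomputable def quotPr (hX : ∀ r ∈ X, r ∈ gr K V n) (k : ℕ) : QuotRing X →+ QuotRing X :=
  (Polynomial.lcoeff (QuotRing X) k).toAddMonoidHom.comp (quotHomog hX).toAddMonoidHom

theorem quotPr_mk (hX : ∀ r ∈ X, r ∈ gr K V n) (k : ℕ) (x : TensorRing K V) :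
    quotPr hX k (QuotRing.mk X x) = QuotRing.mk X (proj K V k x) :=
  Polynomial.coeff_map _ _

theorem mk_mem_quotGr {m : ℕ} {x : TensorRing K V} (hx : x ∈ gr K V m) :
    QuotRing.mk X x ∈ quotGr X m := ⟨x, hx, rfl⟩

/-- The grading of `A = T / ⟨X⟩` for homogeneous `X`. -/
noncomputable def quotGrading (hX : ∀ r ∈ X, r ∈ gr K V n) : RingGrading (quotGr X) where
  pr := quotPr hX
  pr_of_mem p := by
    rintro _ ⟨x, hx, rfl⟩ k
    change quotPr hX k (QuotRing.mk X x) = if p = k then QuotRing.mk X x else 0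
    rw [quotPr_mk, proj_of_mem_gr hx]
    split_ifs
    · rfl
    · exact map_zero _
  gen a := by
    obtain ⟨x, rfl⟩ := QuotRing.mk_surjective X a
    induction x using gr_induction with
    | hgr i x hx => exact (le_iSup (quotGr X) i) (mk_mem_quotGr hx)
    | hadd a b h1 h2 => rw [map_add]; exact add_mem h1 h2
  one_mem := ⟨1, one_mem_gr, map_one (QuotRing.mk X)⟩
  mul_mem := by
    rintro p q _ _ ⟨a, ha, rfl⟩ ⟨b, hb, rfl⟩
    exact ⟨a * b, mul_mem_gr ha hb, map_mul (QuotRing.mk X) a b⟩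

end Quotient

/-! ### The graded projective modules `M ⊗_K A` -/

section Induced

variable {K : Type u} [Ring K] {A : Type w} [Ring A] [RingOver K A] {𝒜 : ℕ → AddSubgroup A}
  (g : RingGrading 𝒜) (h0 : ∀ k : K, (RingOver.hom k : A) ∈ 𝒜 0)
  (M : Type v) [AddCommGroup M] [Module Kᵐᵒᵖ M] (d : ℕ)

/-- The projections of `M ⊗_K A`, where `M` has degree `d`. -/
noncomputable def inducedPr (p : ℕ) : BTensor K M A →+ BTensor K M A :=
  if d ≤ p then BTensor.map (AddMonoidHom.id M) (g.pr (p - d)) (fun _ _ => rfl)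
    (fun k a => g.pr_mul (h0 k) _ a) else 0

variable {M} in
theorem tmul_mem_homogeneous (m : M) {q : ℕ} {a : A} (ha : a ∈ 𝒜 q) :
    BTensor.tmul K m a ∈ homogeneous (inducedPr g h0 M d) (d + q) := by
  intro k
  rw [inducedPr]
  split_ifs with h1 h2 h2
  · subst h2
    rw [BTensor.map_tmul, Nat.add_sub_cancel_left, pr_self (g.pr_of_mem _ ha)]
    rfl
  · rw [BTensor.map_tmul, pr_of_ne (g.pr_of_mem _ ha) (by omega), BTensor.tmul_zero]
  · omega
  · rfl

theorem closure_tmul (g : RingGrading 𝒜) :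
    AddSubgroup.closure {z : BTensor K M A | ∃ m q, ∃ a ∈ 𝒜 q, z = BTensor.tmul K m a} = ⊤ := by
  suffices h : ∀ z : BTensor K M A, z ∈ AddSubgroup.closure
      {z : BTensor K M A | ∃ m q, ∃ a ∈ 𝒜 q, z = BTensor.tmul K m a} from
    eq_top_iff.2 fun x _ => h x
  intro z
  induction z using BTensor.induction with
  | h0 => exact zero_mem _
  | ht m a =>
    have ha := g.gen a
    induction ha using AddSubgroup.iSup_induction' with
    | hp q y hy => exact AddSubgroup.subset_closure ⟨m, q, y, hy, rfl⟩
    | h1 => rw [BTensor.tmul_zero]; exact zero_mem _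
    | hadd a b _ _ h1 h2 => rw [BTensor.tmul_add]; exact add_mem h1 h2
  | ha a b h1 h2 => exact add_mem h1 h2

/-- The graded right module `M ⊗_K A`, where `M` is projective and has degree `d`. -/
noncomputable def induced [Module.Projective Kᵐᵒᵖ M] : GrMod.{w, max v w} 𝒜 where
  X := BTensor K M A
  pr := inducedPr g h0 M d
  gen := gen_of_closure _ (closure_tmul M g) (by
    rintro _ ⟨m, q, a, ha, rfl⟩
    exact ⟨_, tmul_mem_homogeneous g h0 d m ha⟩)
  smul_mem p q y b hy hb := smul_mem_of_gen _ (closure_tmul M g) (by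
    rintro _ ⟨m, q', a, ha, rfl⟩
    refine ⟨_, tmul_mem_homogeneous g h0 d m ha, ?_⟩
    rw [BTensor.op_smul_tmul, op_smul_eq_mul, add_assoc]
    exact tmul_mem_homogeneous g h0 d m (g.mul_mem ha hb)) hy
  projective := ((DualBasis.ofProjective K M).baseChange A).projective

end Induced

/-! ### The complex `R ⊗_K A → V ⊗_K A → A → A⁰` -/

section Complex

variable {K : Type u} [Ring K] {V : Type v} [AddCommGroup V] [Module K V] [Module Kᵐᵒᵖ V]

theorem lift_op_smul {M A N : Type*} [AddCommGroup M] [Module Kᵐᵒᵖ M] [Ring A] [RingOver K A]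
    [AddCommGroup N] [Module Aᵐᵒᵖ N] (F : BTensor K M A →+ N)
    (hF : ∀ m a b, F (BTensor.tmul K m (a * b)) = op b • F (BTensor.tmul K m a)) (b : Aᵐᵒᵖ)
    (z : BTensor K M A) : F (b • z) = b • F z := by
  induction z using BTensor.induction with
  | h0 => simp
  | ht m a => exact hF m a b.unop
  | ha x y h1 h2 => rw [smul_add, map_add, h1, h2, map_add, smul_add]

variable (R : SubBimodule K (TensorRing K V))

/-- The additive map `V ⊗_K A → A`. -/
def addD₀ : BTensor K V (QuotRing (R : Set (TensorRing K V))) →+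
    QuotRing (R : Set (TensorRing K V)) :=
  BTensor.lift (AddMonoidHom.mul.comp ((QuotRing.mk _).toAddMonoidHom.comp (ι K)))
    (fun v k a => by
      change QuotRing.mk _ (ι K (op k • v)) * a =
        QuotRing.mk _ (ι K v) * (QuotRing.mk _ (ofBase K V k) * a)
      rw [ι_op_smul, map_mul, mul_assoc])

/-- The map `V ⊗_K A → A`. -/
def d₀ : BTensor K V (QuotRing (R : Set (TensorRing K V)))
    →ₗ[(QuotRing (R : Set (TensorRing K V)))ᵐᵒᵖ] QuotRing (R : Set (TensorRing K V)) :=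
  { addD₀ R with
    map_smul' := fun b z => lift_op_smul (addD₀ R)
      (fun m a b => (mul_assoc (QuotRing.mk _ (ι K m)) a b).symm) b z }

theorem d₀_tmul (v : V) (a : QuotRing (R : Set (TensorRing K V))) :
    d₀ R (BTensor.tmul K v a) = QuotRing.mk _ (ι K v) * a := rfl

/-- The projection `M ⊗_K T → M ⊗_K A`. -/
def toQuotTensor (M : Type*) [AddCommGroup M] [Module Kᵐᵒᵖ M] :
    BTensor K M (TensorRing K V) →+ BTensor K M (QuotRing (R : Set (TensorRing K V))) :=
  BTensor.map (AddMonoidHom.id M) (QuotRing.mk (R : Set (TensorRing K V))).toAddMonoidHom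
    (fun _ _ => rfl) (fun k x => map_mul (QuotRing.mk _) (ofBase K V k) x)

theorem toQuotTensor_tmul {M : Type*} [AddCommGroup M] [Module Kᵐᵒᵖ M] (m : M)
    (x : TensorRing K V) :
    toQuotTensor R M (BTensor.tmul K m x) = BTensor.tmul K m (QuotRing.mk _ x) := rfl

theorem toQuotTensor_op_smul {M : Type*} [AddCommGroup M] [Module Kᵐᵒᵖ M]
    (x : TensorRing K V) (z : BTensor K M (TensorRing K V)) :
    toQuotTensor R M (op x • z) =
      op (QuotRing.mk (R : Set (TensorRing K V)) x) • toQuotTensor R M z := by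
  induction z using BTensor.induction with
  | h0 => simp
  | ht m y =>
    rw [BTensor.op_smul_tmul, toQuotTensor_tmul, toQuotTensor_tmul, BTensor.op_smul_tmul,
      op_smul_eq_mul, op_smul_eq_mul, map_mul]
  | ha a b h1 h2 => rw [smul_add, map_add, h1, h2, map_add, smul_add]

theorem toQuotTensor_surjective (M : Type*) [AddCommGroup M] [Module Kᵐᵒᵖ M] :
    Function.Surjective (toQuotTensor R M) :=
  BTensor.map_surjective _ _ _ _ Function.surjective_id (QuotRing.mk_surjective _)

theorem mem_closure_of_toQuotTensor_eq_zero {M : Type*} [AddCommGroup M] [Module Kᵐᵒᵖ M]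
    {z : BTensor K M (TensorRing K V)} (hz : toQuotTensor R M z = 0) :
    z ∈ AddSubgroup.closure {y : BTensor K M (TensorRing K V) | ∃ m,
      ∃ x ∈ TwoSidedIdeal.span (R : Set (TensorRing K V)), y = BTensor.tmul K m x} := by
  refine AddSubgroup.closure_le _ |>.2 ?_ (BTensor.mem_closure_of_map_eq_zero _ _ _ _
    Function.surjective_id (QuotRing.mk_surjective (R : Set (TensorRing K V))) z hz)
  rintro _ ⟨m, x, hm | hx, rfl⟩
  · rw [show m = 0 from hm, BTensor.zero_tmul]
    exact zero_mem _
  · exact AddSubgroup.subset_closure ⟨m, x, QuotRing.mk_eq_zero_iff.1 hx, rfl⟩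

theorem d₀_toQuotTensor (z : BTensor K V (TensorRing K V)) :
    d₀ R (toQuotTensor R V z) = QuotRing.mk _ (mulV z) := by
  induction z using BTensor.induction with
  | h0 => simp
  | ht v x => rw [toQuotTensor_tmul, d₀_tmul, mulV_tmul, map_mul]
  | ha a b h1 h2 => simp only [map_add, h1, h2]

theorem mulV_mem_idealV_of_closure {z : BTensor K V (TensorRing K V)}
    (hz : toQuotTensor R V z = 0) : mulV z ∈ idealV R := by
  have h := mem_closure_of_toQuotTensor_eq_zero R hz
  clear hz
  induction h using AddSubgroup.closure_induction with
  | mem z hz =>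
    obtain ⟨v, x, hx, rfl⟩ := hz
    exact AddSubgroup.subset_closure ⟨v, x, hx, rfl⟩
  | zero => rw [map_zero]; exact zero_mem _
  | add a b _ _ h1 h2 => rw [map_add]; exact add_mem h1 h2
  | neg a _ h => rw [map_neg]; exact neg_mem h

variable {R} in
/-- `⟨R⟩ = R T + V ⟨R⟩`. -/
theorem exists_mulR_add_idealV {x : TensorRing K V}
    (hx : x ∈ TwoSidedIdeal.span (R : Set (TensorRing K V))) :
    ∃ z, ∃ y ∈ idealV R, x = mulR R.incl z + y := by
  replace hx := mem_closure_of_mem_span hx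
  have hadd : ∀ a b : TensorRing K V, (∃ z, ∃ y ∈ idealV R, a = mulR R.incl z + y) →
      (∃ z, ∃ y ∈ idealV R, b = mulR R.incl z + y) →
      ∃ z, ∃ y ∈ idealV R, a + b = mulR R.incl z + y := by
    rintro _ _ ⟨z, y, hy, rfl⟩ ⟨z', y', hy', rfl⟩
    exact ⟨z + z', y + y', add_mem hy hy', by rw [map_add, add_add_add_comm]⟩
  induction hx using AddSubgroup.closure_induction with
  | mem x hx =>
    obtain ⟨a, r, hr, b, rfl⟩ := hx
    induction a using gr_induction with
    | hgr i a ha =>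
      cases i with
      | zero =>
        obtain ⟨k, rfl⟩ := ha
        exact ⟨BTensor.tmul K (k • (⟨r, hr⟩ : R)) b, 0, zero_mem _, (add_zero _).symm⟩
      | succ i =>
        refine ⟨0, _, ?_, by rw [map_zero, zero_add]⟩
        rw [mul_assoc]
        induction ha using gr_succ_induction with
        | hι v y hy =>
          refine AddSubgroup.subset_closure ⟨v, y * (r * b), ?_, mul_assoc _ _ _⟩
          exact TwoSidedIdeal.mul_mem_left _ _ _
            (TwoSidedIdeal.mul_mem_right _ _ _ (TwoSidedIdeal.subset_span hr))
        | h0 => rw [zero_mul]; exact zero_mem _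
        | hadd a b _ _ h1 h2 => rw [add_mul]; exact add_mem h1 h2
        | hneg a _ h => rw [neg_mul]; exact neg_mem h
    | hadd a b h1 h2 => rw [add_mul, add_mul]; exact hadd _ _ h1 h2
  | zero => exact ⟨0, 0, zero_mem _, by simp⟩
  | add a b _ _ h1 h2 => exact hadd _ _ h1 h2
  | neg a _ h =>
    obtain ⟨z, y, hy, rfl⟩ := h
    exact ⟨-z, -y, neg_mem hy, by rw [map_neg, neg_add]⟩

variable [SMulCommClass K Kᵐᵒᵖ V]

/-- The left factor must have positive degree: `tail` annihilates `K`, so it is not right linear on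
all of `T`. -/
theorem tail_mul {m : ℕ} {x : TensorRing K V} (hx : x ∈ gr K V (m + 1)) (y : TensorRing K V) :
    tail K V (x * y) = op y • tail K V x := by
  induction hx using gr_succ_induction with
  | hι v x hx => rw [mul_assoc, tail_ι_mul, tail_ι_mul]; rfl
  | h0 => simp
  | hadd a b _ _ h1 h2 => rw [add_mul, map_add, h1, h2, map_add, smul_add]
  | hneg a _ h => rw [neg_mul, map_neg, h, map_neg, smul_neg]

/-- The map `T → V ⊗_K A`, `v x ↦ v ⊗ x`. -/
def tailQuot : TensorRing K V →+ BTensor K V (QuotRing (R : Set (TensorRing K V))) :=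
  (toQuotTensor R V).comp (tail K V)

theorem tailQuot_mul {m : ℕ} {x : TensorRing K V} (hx : x ∈ gr K V (m + 1))
    (y : TensorRing K V) : tailQuot R (x * y) =
      op (QuotRing.mk (R : Set (TensorRing K V)) y) • tailQuot R x := by
  change toQuotTensor R V (tail K V (x * y)) = _
  rw [tail_mul hx, toQuotTensor_op_smul]
  rfl

theorem tailQuot_of_mem_idealV {x : TensorRing K V} (hx : x ∈ idealV R) : tailQuot R x = 0 := by
  induction hx using AddSubgroup.closure_induction with
  | mem x hx =>
    obtain ⟨v, x, hx, rfl⟩ := hx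
    change toQuotTensor R V (tail K V (ι K v * x)) = 0
    rw [tail_ι_mul, toQuotTensor_tmul, QuotRing.mk_eq_zero_iff.2 hx, BTensor.tmul_zero]
  | zero => exact map_zero _
  | add a b _ _ h1 h2 => rw [map_add, h1, h2, add_zero]
  | neg a _ h => rw [map_neg, h, neg_zero]

variable {R} {n : ℕ}

/-- The additive map `R ⊗_K A → V ⊗_K A`. -/
def addD₁ (hRn : ∀ r ∈ R, r ∈ gr K V (n + 1)) :
    BTensor K R (QuotRing (R : Set (TensorRing K V))) →+
    BTensor K V (QuotRing (R : Set (TensorRing K V))) :=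
  BTensor.lift
    (AddMonoidHom.mk' (fun r => AddMonoidHom.mk' (fun a => op a • tailQuot R r)
      (fun a b => by rw [op_add, add_smul]))
      (fun r r' => by
        ext a
        change op a • tailQuot R ((r : TensorRing K V) + r') = _
        rw [map_add, smul_add]
        rfl))
    (fun r k a => by
      change op a • tailQuot R ((r : TensorRing K V) * ofBase K V k) =
        op (QuotRing.mk (R : Set (TensorRing K V)) (ofBase K V k) * a) • tailQuot R r
      rw [tailQuot_mul R (hRn r r.2), op_mul, mul_smul])

/-- The map `R ⊗_K A → V ⊗_K A`. -/
def d₁ (hRn : ∀ r ∈ R, r ∈ gr K V (n + 1)) :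
    BTensor K R (QuotRing (R : Set (TensorRing K V)))
      →ₗ[(QuotRing (R : Set (TensorRing K V)))ᵐᵒᵖ]
    BTensor K V (QuotRing (R : Set (TensorRing K V))) :=
  { addD₁ hRn with
    map_smul' := fun b z => lift_op_smul (addD₁ hRn) (fun r a b => by
      change op (a * b) • tailQuot R r = op b • op a • tailQuot R r
      rw [op_mul, mul_smul]) b z }

theorem d₁_tmul (hRn : ∀ r ∈ R, r ∈ gr K V (n + 1)) (r : R)
    (a : QuotRing (R : Set (TensorRing K V))) :
    d₁ hRn (BTensor.tmul K r a) = op a • tailQuot R r := rfl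

theorem d₁_toQuotTensor (hRn : ∀ r ∈ R, r ∈ gr K V (n + 1))
    (z : BTensor K R (TensorRing K V)) :
    d₁ hRn (toQuotTensor R R z) = tailQuot R (mulR R.incl z) := by
  induction z using BTensor.induction with
  | h0 => simp
  | ht r x => rw [toQuotTensor_tmul, d₁_tmul, mulR_tmul]; exact (tailQuot_mul R (hRn r r.2) x).symm
  | ha a b h1 h2 => simp only [map_add, h1, h2]

/-- The elements of `R` have positive degree, so `tail` loses no component in `K`. -/
theorem mulV_tail_mulR (hRn : ∀ r ∈ R, r ∈ gr K V (n + 1)) (z : BTensor K R (TensorRing K V)) :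
    mulV (tail K V (mulR R.incl z)) = mulR R.incl z := by
  induction z using BTensor.induction with
  | h0 => simp
  | ht r x =>
    induction x using gr_induction with
    | hgr i x hx =>
      rw [mulR_tmul]
      have := mul_mem_gr (hRn r r.2) hx
      rw [add_right_comm] at this
      exact mulV_tail_of_mem_gr this
    | hadd a b h1 h2 => simp only [BTensor.tmul_add, map_add, h1, h2]
  | ha a b h1 h2 => simp only [map_add, h1, h2]

/-- `V ⊗_K A` is `V ⊗_K T` modulo the image of `V ⊗ ⟨R⟩`, and `V ⊗_K T` embeds in `T`. So the kernel
of `d₁` lifts to the kernel of `R ⊗_K T → T / V⟨R⟩`, the one occurring in `HasLinearSyzygies`. -/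
theorem d₁_toQuotTensor_eq_zero_iff (hRn : ∀ r ∈ R, r ∈ gr K V (n + 1))
    (z : BTensor K R (TensorRing K V)) :
    d₁ hRn (toQuotTensor R R z) = 0 ↔ mulR R.incl z ∈ idealV R := by
  rw [d₁_toQuotTensor]
  constructor
  · intro h
    rw [← mulV_tail_mulR hRn z]
    exact mulV_mem_idealV_of_closure R h
  · exact tailQuot_of_mem_idealV R

/-- A lift to `V ⊗_K T` of an element of the kernel of `d₀` has its image in `⟨R⟩ = R T + V⟨R⟩`. The
first summand accounts for the image of `d₁`, and the second vanishes in `V ⊗_K A`. -/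
theorem d₁_d₀_exact (hRn : ∀ r ∈ R, r ∈ gr K V (n + 1)) : Function.Exact (d₁ hRn) (d₀ R) := by
  intro ζ
  obtain ⟨z, rfl⟩ := toQuotTensor_surjective R V ζ
  rw [d₀_toQuotTensor, QuotRing.mk_eq_zero_iff]
  constructor
  · intro h
    obtain ⟨σ, y, hy, e⟩ := exists_mulR_add_idealV h
    refine ⟨toQuotTensor R R σ, ?_⟩
    rw [d₁_toQuotTensor, eq_sub_of_add_eq e.symm, map_sub, tailQuot_of_mem_idealV R hy, sub_zero]
    change toQuotTensor R V (tail K V (mulV z)) = _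
    rw [tail_mulV]
  · rintro ⟨ξ, hξ⟩
    obtain ⟨σ, rfl⟩ := toQuotTensor_surjective R R ξ
    rw [← QuotRing.mk_eq_zero_iff, ← d₀_toQuotTensor, ← hξ, d₁_toQuotTensor]
    change d₀ R (toQuotTensor R V (tail K V (mulR R.incl σ))) = 0
    rw [d₀_toQuotTensor, mulV_tail_mulR hRn]
    clear hξ
    rw [QuotRing.mk_eq_zero_iff]
    induction σ using BTensor.induction with
    | h0 => rw [map_zero]; exact zero_mem _
    | ht r x => exact TwoSidedIdeal.mul_mem_right _ _ _ (TwoSidedIdeal.subset_span r.2)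
    | ha a b h1 h2 => rw [map_add]; exact add_mem h1 h2

/-- `A` is generated over `K` by its elements of degree one, whence `A⁺ = V A`. -/
theorem d₀_mkQ_exact (R : SubBimodule K (TensorRing K V)) :
    Function.Exact (d₀ R) (rightAug (quotGr (R : Set (TensorRing K V)))).mkQ := by
  intro a
  rw [Submodule.mkQ_apply, Submodule.Quotient.mk_eq_zero]
  change _ ↔ a ∈ LinearMap.range (d₀ R)
  suffices h : rightAug (quotGr (R : Set (TensorRing K V))) = LinearMap.range (d₀ R) by rw [h]
  apply le_antisymm
  · rw [rightAug, Submodule.span_le]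
    rintro _ ⟨m, hm, x, hx, rfl⟩
    obtain ⟨m, rfl⟩ : ∃ k, m = k + 1 := ⟨m - 1, by omega⟩
    exact LinearMap.mem_range.2 ⟨toQuotTensor R V (tail K V x), by
      rw [d₀_toQuotTensor, mulV_tail_of_mem_gr hx]
      rfl⟩
  · rintro _ ⟨z, rfl⟩
    induction z using BTensor.induction with
    | h0 => rw [map_zero]; exact zero_mem _
    | ht v a =>
      exact Submodule.smul_mem _ (op a)
        (Submodule.subset_span (show QuotRing.mk (R : Set (TensorRing K V)) (ι K v) ∈
          {a | ∃ m, 0 < m ∧ a ∈ quotGr (R : Set (TensorRing K V)) m} from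
            ⟨1, Nat.one_pos, mk_mem_quotGr (ι_mem_gr v)⟩))
    | ha a b h1 h2 => rw [map_add]; exact add_mem h1 h2

end Complex

open TensorRing

/-! ### Generation of kernels: a graded Nakayama argument -/

section Generation

variable {A : Type u} [Ring A] {𝒜 : ℕ → AddSubgroup A}

/-- If the kernel of a homogeneous map is generated by its elements of degree `p` modulo the
radical, then it is generated by them. -/
theorem mem_closure_of_generated {M N : GrMod.{u, w} 𝒜} (f : GrHom M N) {p : ℕ}
    (h : ∀ q ζ, q ≠ p → ζ ∈ homogeneous M.pr q → f.lin ζ = 0 →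
      ζ ∈ AddSubgroup.closure {z | ∃ a ∈ leftAug 𝒜, ∃ y, f.lin y = 0 ∧ z = op a • y})
    (q : ℕ) (ζ : M.X) (hζ : ζ ∈ homogeneous M.pr q) (hf : f.lin ζ = 0) :
    ζ ∈ AddSubgroup.closure
      {z | ∃ (a : A) (y : M.X), y ∈ homogeneous M.pr p ∧ f.lin y = 0 ∧ z = op a • y} := by
  set C := AddSubgroup.closure
      {z | ∃ (a : A) (y : M.X), y ∈ homogeneous M.pr p ∧ f.lin y = 0 ∧ z = op a • y} with hC
  have hsmul : ∀ (a : A) (z : M.X), z ∈ C → op a • z ∈ C := by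
    intro a z hz
    induction hz using AddSubgroup.closure_induction with
    | mem z hz =>
      obtain ⟨b, y, hy, hfy, rfl⟩ := hz
      exact AddSubgroup.subset_closure ⟨b * a, y, hy, hfy, by rw [op_mul, mul_smul]⟩
    | zero => rw [smul_zero]; exact zero_mem _
    | add a b _ _ h1 h2 => rw [smul_add]; exact add_mem h1 h2
    | neg a _ h => rw [smul_neg]; exact neg_mem h
  induction q using Nat.strong_induction_on generalizing ζ with
  | _ q ih =>
    by_cases hq : q = p
    · subst hq
      exact AddSubgroup.subset_closure ⟨1, ζ, hζ, hf, by rw [op_one, one_smul]⟩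
    -- A factor from `A⁺` raises the degree, so only components of `y` of degree less than `q`
    -- contribute in degree `q`, and the induction hypothesis covers them.
    have key : ∀ a ∈ leftAug 𝒜, ∀ y, f.lin y = 0 → M.pr q (op a • y) ∈ C := by
      intro a ha
      induction ha using Submodule.span_induction with
      | mem a ha =>
        obtain ⟨m, hm, ha⟩ := ha
        intro y hy
        obtain ⟨N, hN⟩ := exists_sum_pr M.gen y
        rw [← hN N le_rfl, Finset.smul_sum, map_sum]
        refine sum_mem fun l _ => ?_
        have hl := pr_mem_homogeneous M.gen l y
        rw [M.smul_mem l m _ a hl ha q]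
        split_ifs with e
        · exact hsmul _ _ (ih l (by omega) _ hl (by rw [f.lin_pr, hy, map_zero]))
        · exact zero_mem _
      | zero => intro y _; rw [op_zero, zero_smul, map_zero]; exact zero_mem _
      | add a b _ _ h1 h2 =>
        intro y hy
        rw [op_add, add_smul, map_add]
        exact add_mem (h1 y hy) (h2 y hy)
      | smul b a _ h1 =>
        intro y hy
        rw [smul_eq_mul, op_mul, mul_smul]
        exact h1 _ (by rw [map_smul, hy, smul_zero])
    rw [← pr_self hζ]
    have hm := h q ζ hq hζ hf
    clear hζ hf
    induction hm using AddSubgroup.closure_induction with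
    | mem z hz =>
      obtain ⟨a, ha, y, hy, rfl⟩ := hz
      exact key a ha y hy
    | zero => rw [map_zero]; exact zero_mem _
    | add a b _ _ h1 h2 => rw [map_add]; exact add_mem h1 h2
    | neg a _ h => rw [map_neg]; exact neg_mem h

/-- If `Tor_3` is `p`-pure, then the syzygies of degree `q ≠ p` lie in the radical times the
module of syzygies. -/
theorem mem_closure_of_torSuccIsPure (g : RingGrading 𝒜) (X₀ : GrMod.{u, u} 𝒜) (s : ResStep 𝒜)
    (d₀ : GrHom s.tgt X₀) (ε : X₀.X →ₗ[Aᵐᵒᵖ] A ⧸ rightAug 𝒜)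
    (hε : ∀ p y, 0 < p → y ∈ homogeneous X₀.pr p → ε y = 0) (hεs : Function.Surjective ε)
    (h₀ : Function.Exact d₀.lin ε) (h₁ : Function.Exact s.d.lin d₀.lin) {p : ℕ}
    (hTor : TorSuccIsPure 𝒜 2 p) {q : ℕ} (hq : q ≠ p) {ζ : s.src.X}
    (hζ : ζ ∈ homogeneous s.src.pr q) (hf : s.d.lin ζ = 0)
    (h1 : BTensor.tmul A ζ (Submodule.Quotient.mk 1 : A ⧸ leftAug 𝒜) = 0) :
    ζ ∈ AddSubgroup.closure {z | ∃ a ∈ leftAug 𝒜, ∃ y, s.d.lin y = 0 ∧ z = op a • y} := by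
  let Q := resolution g X₀ s d₀ ε hε hεs h₀ h₁
  -- The term of homological degree three is free on the homogeneous elements of the kernel of
  -- `s.d`; `y` is the basis element belonging to `ζ`. It is a cycle after tensoring with `A⁰`
  -- because `ζ ⊗ 1` vanishes.
  let i : KerIndex s.d := ⟨q, ζ, hζ, hf⟩
  let y : Q.X 3 := (Finsupp.single i 1 : KerIndex s.d →₀ A)
  have hy : y ∈ Q.comp 3 q := single_mem_homogeneous g KerIndex.deg i g.one_mem
  have hdy : Q.d 2 y = ζ :=
    (freeLift_single (KerIndex.elt (f := s.d)) i 1).trans (one_smul Aᵐᵒᵖ ζ)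
  have h := Q.mem_closure_of_subsingleton (hTor Q q hq) y hy (by rw [hdy]; exact h1)
  rw [hdy] at h
  refine AddSubgroup.closure_mono ?_ h
  rintro _ ⟨a, ha, y', rfl⟩
  exact ⟨a, ha, Q.d 2 y', (coverHom_exact g s.d _).2 ⟨y', rfl⟩, rfl⟩

end Generation

/-! ### Homogeneous elements of `M ⊗_K A` -/

section Induced

variable {K : Type u} [Ring K] {A : Type w} [Ring A] [RingOver K A] {𝒜 : ℕ → AddSubgroup A}
  (g : RingGrading 𝒜) (h0 : ∀ k : K, (RingOver.hom k : A) ∈ 𝒜 0)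
  {M : Type v} [AddCommGroup M] [Module Kᵐᵒᵖ M] {d : ℕ}

theorem mem_closure_of_mem_homogeneous {p : ℕ} {z : BTensor K M A}
    (hz : z ∈ homogeneous (inducedPr g h0 M d) p) :
    z ∈ AddSubgroup.closure {z : BTensor K M A |
      ∃ m q, d + q = p ∧ ∃ a ∈ 𝒜 q, z = BTensor.tmul K m a} := by
  rw [← pr_self hz]
  clear hz
  have hz : z ∈ AddSubgroup.closure
      {z : BTensor K M A | ∃ m q, ∃ a ∈ 𝒜 q, z = BTensor.tmul K m a} := by
    rw [closure_tmul M g]; trivial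
  induction hz using AddSubgroup.closure_induction with
  | mem z hz =>
    obtain ⟨m, q, a, ha, rfl⟩ := hz
    rw [tmul_mem_homogeneous g h0 d m ha p]
    split_ifs with h
    · exact AddSubgroup.subset_closure ⟨m, q, h, a, ha, rfl⟩
    · exact zero_mem _
  | zero => rw [map_zero]; exact zero_mem _
  | add a b _ _ h1 h2 => rw [map_add]; exact add_mem h1 h2
  | neg a _ h => rw [map_neg]; exact neg_mem h

theorem eq_zero_of_mem_homogeneous {p : ℕ} (hp : p < d) {z : BTensor K M A}
    (hz : z ∈ homogeneous (inducedPr g h0 M d) p) : z = 0 := by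
  rw [← pr_self hz, inducedPr, if_neg (by omega)]
  rfl

/-- Above the degree of `M`, the factor `a` of a homogeneous `m ⊗ a` lies in `A⁺`; it moves across
the tensor and annihilates the class of `1` in `A⁰`. -/
theorem tmul_quotient_eq_zero {p : ℕ} (hp : d < p) {z : BTensor K M A}
    (hz : z ∈ homogeneous (inducedPr g h0 M d) p) :
    BTensor.tmul A z (Submodule.Quotient.mk 1 : A ⧸ leftAug 𝒜) = 0 := by
  have h := mem_closure_of_mem_homogeneous g h0 hz
  clear hz
  induction h using AddSubgroup.closure_induction with
  | mem z hz =>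
    obtain ⟨m, q, hq, a, ha, rfl⟩ := hz
    have e : BTensor.tmul K m a = op a • BTensor.tmul K m (1 : A) := by
      rw [BTensor.op_smul_tmul, op_smul_eq_mul, one_mul]
    have ha' : a ∈ leftAug 𝒜 := Submodule.subset_span ⟨q, by omega, ha⟩
    rw [e, BTensor.smul_tmul, ← Submodule.Quotient.mk_smul, smul_eq_mul, mul_one,
      (Submodule.Quotient.mk_eq_zero _).2 ha', BTensor.tmul_zero]
  | zero => exact BTensor.zero_tmul _
  | add a b _ _ h1 h2 => rw [BTensor.add_tmul, h1, h2, add_zero]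
  | neg a _ h => rw [BTensor.neg_tmul, h, neg_zero]

end Induced

/-! ### Purity of `Tor_3` implies linear syzygies (here `R` has degree `n + 1`) -/

section LinearSyzygies

variable {K : Type u} [Ring K] {V : Type v} [AddCommGroup V] [Module K V] [Module Kᵐᵒᵖ V]
  {R : SubBimodule K (TensorRing K V)} {n : ℕ}

theorem hom_mem_quotGr (X : Set (TensorRing K V)) (k : K) :
    (RingOver.hom k : QuotRing X) ∈ quotGr X 0 := mk_mem_quotGr (ofBase_mem_gr k)

/-- `⟨R⟩` vanishes in degree `n` and is `R` in degree `n + 1`; multiplication by `V` raises both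
degrees by one. -/
theorem proj_of_mem_idealV (hRn : ∀ r ∈ R, r ∈ gr K V (n + 1)) {x : TensorRing K V}
    (hx : x ∈ idealV R) :
    proj K V (n + 1) x = 0 ∧ ∃ y, leftTensor R.incl y = proj K V (n + 1 + 1) x := by
  induction hx using AddSubgroup.closure_induction with
  | mem x hx =>
    obtain ⟨v, i, hi, rfl⟩ := hx
    rw [proj_add_left_mul (ι_mem_gr v), proj_add_left_mul (ι_mem_gr v),
      idealGr_eq_zero (Nat.lt_succ_self n) (proj_mem_idealGr hRn hi n), mul_zero]
    exact ⟨rfl, BTensor.tmul K v ⟨_, mem_of_mem_idealGr_self (proj_mem_idealGr hRn hi (n + 1))⟩,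
      rfl⟩
  | zero => exact ⟨map_zero _, 0, by rw [map_zero, map_zero]⟩
  | add a b _ _ h1 h2 =>
    obtain ⟨h1, y, hy⟩ := h1
    obtain ⟨h2, y', hy'⟩ := h2
    exact ⟨by rw [map_add, h1, h2, add_zero], y + y', by rw [map_add, hy, hy', map_add]⟩
  | neg a _ h =>
    obtain ⟨h, y, hy⟩ := h
    exact ⟨by rw [map_neg, h, neg_zero], -y, by rw [map_neg, hy, map_neg]⟩

theorem rightTensor_mem_gr (hRn : ∀ r ∈ R, r ∈ gr K V (n + 1)) (z : BTensor K R V) :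
    rightTensor R.incl z ∈ gr K V (n + 1 + 1) := by
  induction z using BTensor.induction with
  | h0 => rw [map_zero]; exact zero_mem _
  | ht r v => exact mul_ι_mem_gr v (hRn r r.2)
  | ha a b h1 h2 => rw [map_add]; exact add_mem h1 h2

theorem d₀_mem (hRn : ∀ r ∈ R, r ∈ gr K V n) (p : ℕ)
    (y : BTensor K V (QuotRing (R : Set (TensorRing K V))))
    (hy : y ∈ homogeneous (inducedPr (quotGrading hRn) (hom_mem_quotGr _) V 1) p) :
    d₀ R y ∈ homogeneous (quotGrading hRn).pr p := by
  have h := mem_closure_of_mem_homogeneous (quotGrading hRn) (hom_mem_quotGr _) hy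
  clear hy
  induction h using AddSubgroup.closure_induction with
  | mem z hz =>
    obtain ⟨v, q, rfl, a, ha, rfl⟩ := hz
    exact (quotGrading hRn).pr_of_mem _
      ((quotGrading hRn).mul_mem (mk_mem_quotGr (ι_mem_gr v)) ha)
  | zero => rw [map_zero]; exact zero_mem _
  | add a b _ _ h1 h2 => rw [map_add]; exact add_mem h1 h2
  | neg a _ h => rw [map_neg]; exact neg_mem h

theorem mkQ_of_mem_homogeneous (hRn : ∀ r ∈ R, r ∈ gr K V n) (p : ℕ)
    (y : QuotRing (R : Set (TensorRing K V))) (hp : 0 < p)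
    (hy : y ∈ homogeneous (quotGrading hRn).pr p) :
    (rightAug (quotGr (R : Set (TensorRing K V)))).mkQ y = 0 :=
  (Submodule.Quotient.mk_eq_zero _).2 (Submodule.subset_span
    ⟨p, hp, (quotGrading hRn).mem_of_mem_homogeneous hy⟩)

variable [SMulCommClass K Kᵐᵒᵖ V]

theorem tailQuot_mem (hRn : ∀ r ∈ R, r ∈ gr K V n) {m : ℕ} {x : TensorRing K V}
    (hx : x ∈ gr K V (m + 1)) :
    tailQuot R x ∈ homogeneous (inducedPr (quotGrading hRn) (hom_mem_quotGr _) V 1) (m + 1) := by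
  induction hx using gr_succ_induction with
  | hι v y hy =>
    change toQuotTensor R V (tail K V (ι K v * y)) ∈ _
    rw [tail_ι_mul, toQuotTensor_tmul, add_comm m 1]
    exact tmul_mem_homogeneous _ _ 1 v (mk_mem_quotGr hy)
  | h0 => rw [map_zero]; exact zero_mem _
  | hadd a b _ _ h1 h2 => rw [map_add]; exact add_mem h1 h2
  | hneg a _ h => rw [map_neg]; exact neg_mem h

theorem d₁_mem [Module.Projective Kᵐᵒᵖ V] (hRn : ∀ r ∈ R, r ∈ gr K V (n + 1)) (p : ℕ)
    (y : BTensor K R (QuotRing (R : Set (TensorRing K V))))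
    (hy : y ∈ homogeneous (inducedPr (quotGrading hRn) (hom_mem_quotGr _) R (n + 1)) p) :
    d₁ hRn y ∈ homogeneous (inducedPr (quotGrading hRn) (hom_mem_quotGr _) V 1) p := by
  have h := mem_closure_of_mem_homogeneous (quotGrading hRn) (hom_mem_quotGr _) hy
  clear hy
  induction h using AddSubgroup.closure_induction with
  | mem z hz =>
    obtain ⟨r, q, rfl, a, ha, rfl⟩ := hz
    exact (induced (quotGrading hRn) (hom_mem_quotGr _) V 1).smul_mem _ _ _ _
      (tailQuot_mem hRn (hRn r r.2)) ha
  | zero => rw [map_zero]; exact zero_mem _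
  | add a b _ _ h1 h2 => rw [map_add]; exact add_mem h1 h2
  | neg a _ h => rw [map_neg]; exact neg_mem h

/-- The graded map `V ⊗_K A → A`. -/
noncomputable def homD₀ [Module.Projective Kᵐᵒᵖ V] (hRn : ∀ r ∈ R, r ∈ gr K V n) :
    GrHom (induced (quotGrading hRn) (hom_mem_quotGr _) V 1) (quotGrading hRn).self where
  lin := d₀ R
  mem := d₀_mem hRn

/-- The graded map `R ⊗_K A → V ⊗_K A`. -/
noncomputable def homD₁ [Module.Projective Kᵐᵒᵖ V] [Module.Projective Kᵐᵒᵖ R]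
    (hRn : ∀ r ∈ R, r ∈ gr K V (n + 1)) :
    GrHom (induced (quotGrading hRn) (hom_mem_quotGr _) R (n + 1))
      (induced (quotGrading hRn) (hom_mem_quotGr _) V 1) where
  lin := d₁ hRn
  mem := d₁_mem hRn

/-- In the lowest degree the elements have the form `r ⊗ 1`. If `d₁` kills it, then `r ∈ V⟨R⟩`,
which has no component in degree `n + 1`, so `r = 0`. -/
theorem d₁_injective_of_degree (hRn : ∀ r ∈ R, r ∈ gr K V (n + 1))
    {ζ : BTensor K R (QuotRing (R : Set (TensorRing K V)))}
    (hζ : ζ ∈ homogeneous (inducedPr (quotGrading hRn) (hom_mem_quotGr _) R (n + 1)) (n + 1))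
    (h : d₁ hRn ζ = 0) : ζ = 0 := by
  obtain ⟨r, rfl⟩ : ∃ r, toQuotTensor R R (BTensor.tmul K r 1) = ζ := by
    replace hζ := mem_closure_of_mem_homogeneous _ _ hζ
    clear h
    induction hζ using AddSubgroup.closure_induction with
    | mem z hz =>
      obtain ⟨r, q, hq, a, ha, rfl⟩ := hz
      obtain rfl : q = 0 := by omega
      obtain ⟨_, ⟨k, rfl⟩, rfl⟩ := ha
      refine ⟨op k • r, ?_⟩
      rw [BTensor.smul_tmul, toQuotTensor_tmul, smul_eq', mul_one]
      rfl
    | zero => exact ⟨0, by rw [BTensor.zero_tmul, map_zero]⟩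
    | add a b _ _ h1 h2 =>
      obtain ⟨a, rfl⟩ := h1
      obtain ⟨b, rfl⟩ := h2
      exact ⟨a + b, by rw [BTensor.add_tmul, map_add]⟩
    | neg a _ h =>
      obtain ⟨a, rfl⟩ := h
      exact ⟨-a, by rw [BTensor.neg_tmul, map_neg]⟩
  rw [d₁_toQuotTensor_eq_zero_iff, mulR_tmul, mul_one] at h
  have h0 := (proj_of_mem_idealV hRn h).1
  rw [show R.incl r = (r : TensorRing K V) from rfl, proj_self (hRn r r.2)] at h0
  rw [show r = 0 from Subtype.ext h0, BTensor.zero_tmul, map_zero]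

/-- In degree `n + 2` an element comes from some `z ∈ R ⊗_K V`. If `d₁` kills it, the image of `z`
in `T` lies in `V⟨R⟩` and, by its degree, is the image of some `y ∈ V ⊗_K R`. The pair `(y, z)`
gives an obvious syzygy. -/
theorem exists_syzygy_of_degree (hRn : ∀ r ∈ R, r ∈ gr K V (n + 1))
    {ζ : BTensor K R (QuotRing (R : Set (TensorRing K V)))}
    (hζ : ζ ∈ homogeneous (inducedPr (quotGrading hRn) (hom_mem_quotGr _) R (n + 1)) (n + 1 + 1))
    (h : d₁ hRn ζ = 0) (a : QuotRing (R : Set (TensorRing K V))) :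
    ∃ τ ∈ syzygies R, toQuotTensor R R τ = op a • ζ := by
  obtain ⟨z, hz⟩ : ∃ z : BTensor K R V, ∀ b, toQuotTensor R R (extendR R b z) =
      op (QuotRing.mk (R : Set (TensorRing K V)) b) • ζ := by
    replace hζ := mem_closure_of_mem_homogeneous _ _ hζ
    clear h
    induction hζ using AddSubgroup.closure_induction with
    | mem z hz =>
      obtain ⟨r, q, hq, a, ha, rfl⟩ := hz
      obtain rfl : q = 1 := by omega
      obtain ⟨x, hx, rfl⟩ := ha
      obtain ⟨v, rfl⟩ := exists_eq_ι hx
      refine ⟨BTensor.tmul K r v, fun b => ?_⟩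
      rw [extendR_tmul, toQuotTensor_tmul, BTensor.op_smul_tmul, op_smul_eq_mul, map_mul]
      rfl
    | zero => exact ⟨0, fun b => by rw [map_zero, map_zero, smul_zero]⟩
    | add a b _ _ h1 h2 =>
      obtain ⟨a, h1⟩ := h1
      obtain ⟨b, h2⟩ := h2
      exact ⟨a + b, fun c => by rw [map_add, map_add, h1, h2, smul_add]⟩
    | neg a _ h =>
      obtain ⟨a, h⟩ := h
      exact ⟨-a, fun c => by rw [map_neg, map_neg, h, smul_neg]⟩
  obtain ⟨b, rfl⟩ := QuotRing.mk_surjective _ a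
  refine ⟨extendR R b z, ?_, hz b⟩
  have h1 := hz 1
  rw [map_one, op_one, one_smul] at h1
  rw [← h1, d₁_toQuotTensor_eq_zero_iff, mulR_extendR, mul_one] at h
  obtain ⟨y, hy⟩ := (proj_of_mem_idealV hRn h).2
  rw [proj_self (rightTensor_mem_gr hRn z)] at hy
  exact AddSubgroup.subset_closure (Or.inl ⟨y, z, hy, b, rfl⟩)

/-- Below degree `n + 1` the module `R ⊗_K A` is zero, and in degree `n + 1` the map `d₁` is
injective. Above it `ζ ⊗ 1` vanishes over `A⁰`, so a free generator covering `ζ` gives a cycle for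
`Tor_3`, which is a boundary by purity. -/
theorem mem_closure_of_d₁_eq_zero [Module.Projective Kᵐᵒᵖ V] [Module.Projective Kᵐᵒᵖ R]
    (hRn : ∀ r ∈ R, r ∈ gr K V (n + 1))
    (hTor : TorSuccIsPure (quotGr (R : Set (TensorRing K V))) 2 (n + 1 + 1)) (q : ℕ)
    (ζ : BTensor K R (QuotRing (R : Set (TensorRing K V)))) (hq : q ≠ n + 1 + 1)
    (hζ : ζ ∈ homogeneous (inducedPr (quotGrading hRn) (hom_mem_quotGr _) R (n + 1)) q)
    (hf : d₁ hRn ζ = 0) :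
    ζ ∈ AddSubgroup.closure {z | ∃ a ∈ leftAug (quotGr (R : Set (TensorRing K V))),
      ∃ y, d₁ hRn y = 0 ∧ z = op a • y} := by
  rcases lt_trichotomy q (n + 1) with h | rfl | h
  · rw [eq_zero_of_mem_homogeneous _ (hom_mem_quotGr _) h hζ]
    exact zero_mem _
  · rw [d₁_injective_of_degree hRn hζ hf]
    exact zero_mem _
  · have hs := Submodule.mkQ_surjective (rightAug (quotGr (R : Set (TensorRing K V))))
    have h1 := tmul_quotient_eq_zero (quotGrading hRn) (hom_mem_quotGr _) h hζ
    exact mem_closure_of_torSuccIsPure (quotGrading hRn) (quotGrading hRn).self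
      ⟨_, _, homD₁ hRn⟩ (homD₀ hRn)
      (rightAug (quotGr (R : Set (TensorRing K V)))).mkQ
      (mkQ_of_mem_homogeneous hRn) hs (d₀_mkQ_exact R)
      (d₁_d₀_exact hRn) hTor hq hζ hf h1

theorem mem_map_syzygies [Module.Projective Kᵐᵒᵖ V] [Module.Projective Kᵐᵒᵖ R]
    (hRn : ∀ r ∈ R, r ∈ gr K V (n + 1))
    (hTor : TorSuccIsPure (quotGr (R : Set (TensorRing K V))) 2 (n + 1 + 1)) (q : ℕ)
    (ζ : BTensor K R (QuotRing (R : Set (TensorRing K V))))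
    (hζ : ζ ∈ homogeneous (inducedPr (quotGrading hRn) (hom_mem_quotGr _) R (n + 1)) q)
    (hf : d₁ hRn ζ = 0) : ζ ∈ (syzygies R).map (toQuotTensor R R) := by
  refine AddSubgroup.closure_le _ |>.2 ?_
    (mem_closure_of_generated (homD₁ hRn) (mem_closure_of_d₁_eq_zero hRn hTor) q ζ hζ hf)
  rintro _ ⟨a, y, hy, hfy, rfl⟩
  exact exists_syzygy_of_degree hRn hy hfy a

/-- If `Tor_3` is concentrated in the lowest possible degree, then the syzygies of the relations
are linear. -/
theorem hasLinearSyzygies_of_torSuccIsPure (hRn : ∀ r ∈ R, r ∈ gr K V (n + 1))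
    (hV : Module.Projective Kᵐᵒᵖ V) (hR : Module.Projective Kᵐᵒᵖ R)
    (hTor : TorSuccIsPure (quotGr (R : Set (TensorRing K V))) 2 (n + 1 + 1)) :
    HasLinearSyzygies R := by
  intro σ hσ
  have hgen := (induced (quotGrading hRn) (hom_mem_quotGr _) R (n + 1)).gen
  have hd : d₁ hRn (toQuotTensor R R σ) = 0 := (d₁_toQuotTensor_eq_zero_iff hRn σ).2 hσ
  have hτ : toQuotTensor R R σ ∈ (syzygies R).map (toQuotTensor R R) := by
    obtain ⟨N, hN⟩ := exists_sum_pr hgen (toQuotTensor R R σ)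
    rw [← hN N le_rfl]
    refine sum_mem fun p _ => mem_map_syzygies hRn hTor p _ (pr_mem_homogeneous hgen p _) ?_
    refine ((homD₁ hRn).lin_pr p (toQuotTensor R R σ)).trans ?_
    exact (congrArg (inducedPr (quotGrading hRn) (hom_mem_quotGr _) V 1 p) hd).trans (map_zero _)
  obtain ⟨τ, hτ, e⟩ := hτ
  -- `σ` and `τ` agree in `R ⊗_K A`, so they differ by an element of the image of `R ⊗ ⟨R⟩`, the
  -- second kind of obvious syzygies.
  have h0 := mem_closure_of_toQuotTensor_eq_zero R
    (show toQuotTensor R R (σ - τ) = 0 by rw [map_sub, e, sub_self])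
  rw [← sub_add_cancel σ τ]
  refine add_mem (AddSubgroup.closure_mono ?_ h0) hτ
  rintro _ ⟨r, x, hx, rfl⟩
  exact Or.inr ⟨r, x, hx, rfl⟩

end LinearSyzygies

open TensorRing
-- Degrees in `R̄` and a dual basis of `V ⊗_t S`
namespace Twisting

variable {K : Type u} {S : Type w} {V : Type v} [Ring K] [Ring S] [RingOver K S]
    [AddCommGroup V] [Module K V] [Module Kᵐᵒᵖ V] [SMulCommClass K Kᵐᵒᵖ V] (t : Twisting K S V)

theorem j_mem_gr {m : ℕ} {x : TensorRing K V} (hx : x ∈ gr K V m) : t.j x ∈ gr S t.Bimod m := by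
  induction m generalizing x with
  | zero =>
    obtain ⟨k, rfl⟩ := hx
    exact ⟨_, (t.j_ofBase k).symm⟩
  | succ m ih =>
    induction hx using gr_succ_induction with
    | hι v y hy =>
      rw [map_mul, j_ι]
      exact ι_mul_mem_gr _ (ih hy)
    | h0 => rw [map_zero]; exact zero_mem _
    | hadd a b _ _ h1 h2 => rw [map_add]; exact add_mem h1 h2
    | hneg a _ h => rw [map_neg]; exact neg_mem h

theorem mem_gr_of_mem_Rbar {R : SubBimodule K (TensorRing K V)} {n : ℕ}
    (hRn : ∀ r ∈ R, r ∈ gr K V n) (hR : t.IsInvariant R) {y : t.Tbar} (hy : y ∈ t.Rbar R hR) :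
    y ∈ gr S t.Bimod n := by
  obtain ⟨z, hz, rfl⟩ := hy
  induction hz using AddSubgroup.closure_induction with
  | mem z hz =>
    obtain ⟨r, hr, s, rfl⟩ := hz
    rw [psi_tmul]
    exact mul_mem_gr (t.j_mem_gr (hRn r hr)) (ofBase_mem_gr s)
  | zero => rw [map_zero]; exact zero_mem _
  | add a b _ _ h1 h2 => rw [map_add]; exact add_mem h1 h2
  | neg a _ h => rw [map_neg]; exact neg_mem h

/-- The dual basis of `V ⊗_t S` over `S`. -/
noncomputable def dualBasis (D : DualBasis.{u, v, x} K V) :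
    DualBasis.{w, max v w, x} S t.Bimod := D.baseChange S

end Twisting

end NCPBW

theorem mainTheorem11 {K : Type u} {S : Type w} {V : Type v} [Ring K] [Ring S] [RingOver K S]
    [AddCommGroup V] [Module K V] [Module Kᵐᵒᵖ V] [SMulCommClass K Kᵐᵒᵖ V]
    (t : Twisting K S V) (n : ℕ) (hn : 2 ≤ n)
    (R : SubBimodule K (TensorRing K V)) (hRn : ∀ r ∈ R, r ∈ TensorRing.gr K V n)
    (hinv : t.IsInvariant R)
    (hS : IsLeftFlat.{u, w, v} K S)
    (hV : Module.Projective Kᵐᵒᵖ V) (hR : Module.Projective Kᵐᵒᵖ R)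
    (hTor : TorSuccIsPure (quotGr (R : Set (TensorRing K V))) 2 (n + 1))
    (P : SubBimodule S t.Tbar) (hP : ∀ p ∈ P, p ∈ TensorRing.filt S t.Bimod n)
    (hPR : ∀ y, y ∈ t.Rbar R hinv ↔ ∃ p ∈ P, TensorRing.proj S t.Bimod n p = y) :
    (∃ e : (t.quot R hinv).Tensor ≃+* QuotRing (t.Rbar R hinv : Set t.Tbar),
        ∀ (a : TensorRing K V) (s : S), e ((t.quot R hinv).tmul (QuotRing.mk _ a) s) =
          QuotRing.mk _ (t.j a * TensorRing.ofBase S t.Bimod s)) ∧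
    (IsPBWDeformation (t.Rbar R hinv : Set t.Tbar) (P : Set t.Tbar) ↔
      ∃ α : BimoduleHom S (t.Rbar R hinv) t.Tbar, IsFilteredMorphism α ∧ SatisfiesJacobi n α ∧
        ∀ y, y ∈ P ↔ ∃ r, α r = y) := by
  have hRn' : ∀ r ∈ t.Rbar R hinv, r ∈ TensorRing.gr S t.Bimod n :=
    fun r hr => t.mem_gr_of_mem_Rbar hRn hinv hr
  refine ⟨t.exists_ringEquiv R hinv,
    exists_jacobi_of_isPBWDeformation (by omega) hRn' P hP hPR, ?_⟩
  rintro ⟨α, hα, hJ, hX⟩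
  -- The lemmas on the resolution write the positive degree of `R` as a successor, so that `Tor_3`
  -- sits in degree `n + 1 + 1`.
  obtain ⟨n, rfl⟩ : ∃ m, n = m + 1 := ⟨n - 1, by omega⟩
  exact isPBWDeformation_of_satisfiesJacobi (t.dualBasis (DualBasis.ofProjective K V))
    (by omega) hRn' (t.hasLinearSyzygies_Rbar R hinv hS
      (hasLinearSyzygies_of_torSuccIsPure hRn hV hR hTor)) hα hJ hX
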